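/- Fix $\alpha\in(0,1)$. For $j\in\{1,2\}$ let $C^{j,\alpha}_{p,e}(\mathbb R)$ be the space of even, $2\pi$-periodic functions in $C^{j,\alpha}(\mathbb R)$, with the norm $\|u\|=\sum_{i\le j}\sup|u^{(i)}|+[u^{(j)}]_{\alpha}$, and let $\mathcal U$ be the set of strictly positive functions in $C^{2,\alpha}_{p,e}(\mathbb R)$. For $\varphi\in\mathcal U$ let $Z_\varphi=\{(z,t)\in\mathbb R^2\times\mathbb R:|z|=\varphi(t)\}$, with surface measure $\sigma$ and unit normal $\nu^+$ pointing into $\{|z|>\varphi(t)\}$, and put $$H(\varphi)(s)=\int_{Z_\varphi}\frac{(y-x)\cdot\nu^+(x)}{|x-y|^3}\,d\sigma(y),\qquad x=(\varphi(s),0,s).$$ Let $\lambda>0$, regarded as a constant function in $\mathcal U$. For all $\varphi$ in a neighbourhood of $\lambda$ in $\mathcal U$ these integrals converge absolutely and $H(\varphi)\in C^{1,\alpha}_{p,e}(\mathbb R)$, and $H$, as a map from this neighbourhood in $C^{2,\alpha}_{p,e}(\mathbb R)$ to $C^{1,\alpha}_{p,e}(\mathbb R)$, is Fréchet differentiable at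 $\lambda$. Its linearization $L_\lambda:=-\lambda D_\varphi H(\lambda)$ is diagonal in the basis $e_k(s)=\cos(ks)$, $k\in\mathbb N\cup\{0\}$: for every $k\ge 0$, $$L_\lambda e_k=V(\lambda k)\,e_k,\qquad V(\rho)=4\pi\rho\, I_1(\rho)\bigl(\rho K_1(\rho)-K_0(\rho)\bigr)\ \ (\rho>0),\qquad V(0):=0,$$ and, more generally, for every $v\in C^{2,\alpha}_{p,e}(\mathbb R)$ and every $k\ge0$, $$\int_{-\pi}^{\pi}(L_\lambda v)(s)\cos(ks)\,ds=V(\lambda k)\int_{-\pi}^{\pi}v(s)\cos(ks)\,ds .$$ Here $$I_\nu(x)=\sum_{m=0}^\infty\frac{(x/2)^{\nu+2m}}{m!\,\Gamma(\nu+m+1)},\qquad K_\nu(x)=\int_0^\infty e^{-x\cosh t}\cosh(\nu t)\,dt$$ are the modified Bessel functions. -/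

import Mathlib

open Real MeasureTheory Filter Topology
open scoped NNReal

/-! ### Hölder spaces of even `2π`-periodic functions -/

/-- The functions `u : ℝ → ℝ` of class `C^{j,α}` that are even and `2π`-periodic.  (Boundedness of
the derivatives of order at most `j` is automatic, by periodicity.) -/
def evenPeriodicHolder (j : ℕ) (α : ℝ≥0) : Submodule ℝ (ℝ → ℝ) where
  carrier := {u | ContDiff ℝ j u ∧ MemHolder α (iteratedDeriv j u) ∧
    Function.Even u ∧ Function.Periodic u (2 * π)}
  zero_mem' := by
    refine ⟨contDiff_const, ?_, fun _ => rfl, fun _ => rfl⟩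
    have h : iteratedDeriv j (0 : ℝ → ℝ) = 0 := by
      funext s
      have := iteratedDeriv_const_mul_field (n := j) (x := s) (0 : ℝ) (0 : ℝ → ℝ)
      simpa [Pi.zero_def] using this
    rw [h]
    exact memHolder_zero
  add_mem' := by
    rintro u v ⟨hu, hu1, hu2, hu3⟩ ⟨hv, hv1, hv2, hv3⟩
    refine ⟨hu.add hv, ?_, fun s => ?_, hu3.add hv3⟩
    · have h : iteratedDeriv j (u + v) = iteratedDeriv j u + iteratedDeriv j v := by
        funext s
        exact iteratedDeriv_add hu.contDiffAt hv.contDiffAt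
      rw [h]
      exact hu1.add hv1
    · simp [hu2 s, hv2 s]
  smul_mem' := by
    rintro c u ⟨hu, hu1, hu2, hu3⟩
    refine ⟨contDiff_const.smul hu, ?_, fun s => ?_, fun s => ?_⟩
    · have h : iteratedDeriv j (c • u) = c • iteratedDeriv j u := by
        funext s
        exact iteratedDeriv_const_smul hu.contDiffAt c
      rw [h]
      exact hu1.smul
    · simp [hu2 s]
    · simp [hu3 s]

/-- The space `C^{j,α}_{p,e}(ℝ)` as a type of its own, so that it carries the Hölder norm and not
the topology of pointwise convergence. -/
def HolderPE (j : ℕ) (α : ℝ≥0) : Type := evenPeriodicHolder j α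

namespace HolderPE

variable {j : ℕ} {α : ℝ≥0}

instance : AddCommGroup (HolderPE j α) := inferInstanceAs (AddCommGroup (evenPeriodicHolder j α))

noncomputable instance : Module ℝ (HolderPE j α) :=
  inferInstanceAs (Module ℝ (evenPeriodicHolder j α))

instance : CoeFun (HolderPE j α) (fun _ => ℝ → ℝ) := ⟨fun u => u.1⟩

theorem spec (u : HolderPE j α) : ContDiff ℝ j u ∧ MemHolder α (iteratedDeriv j u) ∧
    Function.Even u ∧ Function.Periodic u (2 * π) := u.2

theorem ext {u v : HolderPE j α} (h : ∀ s, u s = v s) : u = v := Subtype.ext (funext h)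

theorem coe_zero : ((0 : HolderPE j α) : ℝ → ℝ) = 0 := rfl

theorem coe_add (u v : HolderPE j α) : ((u + v : HolderPE j α) : ℝ → ℝ) = u + v := rfl

theorem coe_smul (c : ℝ) (u : HolderPE j α) : ((c • u : HolderPE j α) : ℝ → ℝ) = c • u := rfl

/-- The norm `∑_{i ≤ j} sup |u^{(i)}| + [u^{(j)}]_α`. -/
noncomputable instance : Norm (HolderPE j α) :=
  ⟨fun u => (∑ i ∈ Finset.range (j + 1), ⨆ s, |iteratedDeriv i u s|)
    + (nnHolderNorm α (iteratedDeriv j u) : ℝ)⟩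

theorem norm_def (u : HolderPE j α) :
    ‖u‖ = (∑ i ∈ Finset.range (j + 1), ⨆ s, |iteratedDeriv i u s|)
      + (nnHolderNorm α (iteratedDeriv j u) : ℝ) := rfl

theorem periodic_iteratedDeriv (u : ℝ → ℝ) (hu : Function.Periodic u (2 * π)) (i : ℕ) :
    Function.Periodic (iteratedDeriv i u) (2 * π) := by
  intro s
  have h : (fun z => u (z + 2 * π)) = u := funext hu
  have h2 := iteratedDeriv_comp_add_const i u (2 * π)
  rw [h] at h2
  exact (congrFun h2 s).symm

theorem bddAbove (u : HolderPE j α) {i : ℕ} (hi : i ≤ j) :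
    BddAbove (Set.range fun s => |iteratedDeriv i u s|) := by
  have hc : Continuous (iteratedDeriv i u) :=
    u.spec.1.continuous_iteratedDeriv i (by exact_mod_cast hi)
  have hp : Function.Periodic (fun s => |iteratedDeriv i u s|) (2 * π) := fun s => by
    simp only [periodic_iteratedDeriv u u.spec.2.2.2 i s]
  exact (hp.isBounded_of_continuous (by positivity) hc.abs).bddAbove

theorem iteratedDeriv_add' (u v : HolderPE j α) {i : ℕ} (hi : i ≤ j) :
    iteratedDeriv i ((u + v : HolderPE j α) : ℝ → ℝ)
      = iteratedDeriv i u + iteratedDeriv i v := by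
  funext s
  have h : (i : WithTop ℕ∞) ≤ (j : WithTop ℕ∞) := by exact_mod_cast hi
  exact iteratedDeriv_add (u.spec.1.of_le h).contDiffAt (v.spec.1.of_le h).contDiffAt

theorem iteratedDeriv_smul' (c : ℝ) (u : HolderPE j α) {i : ℕ} (hi : i ≤ j) :
    iteratedDeriv i ((c • u : HolderPE j α) : ℝ → ℝ) = c • iteratedDeriv i u := by
  funext s
  have h : (i : WithTop ℕ∞) ≤ (j : WithTop ℕ∞) := by exact_mod_cast hi
  exact iteratedDeriv_const_smul (u.spec.1.of_le h).contDiffAt c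

theorem normedCore : NormedSpace.Core ℝ (HolderPE j α) where
  norm_nonneg u := by
    rw [norm_def]
    exact add_nonneg (Finset.sum_nonneg fun i _ => Real.iSup_nonneg fun s => abs_nonneg _)
      (NNReal.coe_nonneg _)
  norm_smul c u := by
    rw [norm_def, norm_def, mul_add, Finset.mul_sum]
    congr 1
    · refine Finset.sum_congr rfl fun i hi => ?_
      rw [iteratedDeriv_smul' c u (Nat.lt_succ_iff.mp (Finset.mem_range.mp hi)),
        Real.mul_iSup_of_nonneg (norm_nonneg c)]
      simp [abs_mul]
    · rw [iteratedDeriv_smul' c u le_rfl, MemHolder.nnHolderNorm_smul u.spec.2.1]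
      simp
  norm_triangle u v := by
    rw [norm_def, norm_def, norm_def]
    have h1 : (∑ i ∈ Finset.range (j + 1), ⨆ s, |iteratedDeriv i (u + v : HolderPE j α) s|)
        ≤ (∑ i ∈ Finset.range (j + 1), ⨆ s, |iteratedDeriv i u s|)
          + ∑ i ∈ Finset.range (j + 1), ⨆ s, |iteratedDeriv i v s| := by
      rw [← Finset.sum_add_distrib]
      refine Finset.sum_le_sum fun i hi => ?_
      have hi' : i ≤ j := Nat.lt_succ_iff.mp (Finset.mem_range.mp hi)
      rw [iteratedDeriv_add' u v hi']
      refine ciSup_le fun s => (abs_add_le _ _).trans ?_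
      exact add_le_add (le_ciSup (bddAbove u hi') s) (le_ciSup (bddAbove v hi') s)
    have h2 : (nnHolderNorm α (iteratedDeriv j (u + v : HolderPE j α)) : ℝ)
        ≤ nnHolderNorm α (iteratedDeriv j u) + nnHolderNorm α (iteratedDeriv j v) := by
      rw [iteratedDeriv_add' u v le_rfl]
      exact_mod_cast MemHolder.nnHolderNorm_add_le u.spec.2.1 v.spec.2.1
    linarith
  norm_eq_zero_iff u := by
    constructor
    · intro h
      rw [norm_def] at h
      have hs : ∀ i ∈ Finset.range (j + 1), 0 ≤ ⨆ s, |iteratedDeriv i u s| :=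
        fun i _ => Real.iSup_nonneg fun s => abs_nonneg _
      have h0 : (∑ i ∈ Finset.range (j + 1), ⨆ s, |iteratedDeriv i u s|) = 0 := by
        have := Finset.sum_nonneg hs
        have := NNReal.coe_nonneg (nnHolderNorm α (iteratedDeriv j u))
        linarith
      have h1 := (Finset.sum_eq_zero_iff_of_nonneg hs).mp h0 0 (by simp)
      refine ext fun s => ?_
      have h2 := le_ciSup (bddAbove u (Nat.zero_le j)) s
      rw [h1] at h2
      simpa [coe_zero] using h2
    · rintro rfl
      have h : ((0 : HolderPE j α) : ℝ → ℝ) = 0 := rfl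
      have h3 : ∀ i ≤ j, iteratedDeriv i ((0 : HolderPE j α) : ℝ → ℝ) = 0 := by
        intro i hi
        have := iteratedDeriv_smul' 0 (0 : HolderPE j α) hi
        simpa using this
      rw [norm_def, Finset.sum_eq_zero, h3 j le_rfl, nnHolderNorm_zero]
      · simp
      · intro i hi
        rw [h3 i (Nat.lt_succ_iff.mp (Finset.mem_range.mp hi))]
        simp

noncomputable instance : NormedAddCommGroup (HolderPE j α) := NormedAddCommGroup.ofCore normedCore

noncomputable instance : NormedSpace ℝ (HolderPE j α) := NormedSpace.ofCore normedCore

end HolderPE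

theorem iteratedDeriv_cos_mul_memHolder (j k : ℕ) {α : ℝ≥0} (hα : α ≤ 1) :
    MemHolder α (iteratedDeriv j fun s : ℝ => Real.cos (k * s)) := by
  have hc : ContDiff ℝ 1 (iteratedDeriv j fun s : ℝ => Real.cos (k * s)) := by
    have : ContDiff ℝ ((1 + j : ℕ) : WithTop ℕ∞) (fun s : ℝ => Real.cos (k * s)) :=
      Real.contDiff_cos.comp (contDiff_const.mul contDiff_id)
    rw [iteratedDeriv_eq_iterate]
    exact ContDiff.iterate_deriv' 1 j (by exact_mod_cast this)
  have hb : ∀ (i : ℕ) (s : ℝ), |iteratedDeriv i (fun s : ℝ => Real.cos (k * s)) s| ≤ (k : ℝ) ^ i := by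
    intro i s
    have hd : iteratedDeriv i (fun s : ℝ => Real.cos (k * s))
        = fun s => (k : ℝ) ^ i * iteratedDeriv i Real.cos (k * s) := by
      simpa using iteratedDeriv_comp_const_mul (n := i) Real.contDiff_cos (k : ℝ)
    rw [hd]
    simp only [abs_mul, abs_pow, Nat.abs_cast]
    exact mul_le_of_le_one_right (by positivity) (Real.abs_iteratedDeriv_cos_le_one i _)
  have hL : MemHolder 1 (iteratedDeriv j fun s : ℝ => Real.cos (k * s)) := by
    refine ⟨(k : ℝ≥0) ^ (j + 1), holderWith_one.mpr ?_⟩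
    refine lipschitzWith_of_nnnorm_deriv_le (hc.differentiable (by simp)) fun s => ?_
    rw [← iteratedDeriv_succ, ← NNReal.coe_le_coe]
    simpa using hb (j + 1) s
  have h0 : MemHolder 0 (iteratedDeriv j fun s : ℝ => Real.cos (k * s)) := by
    refine ⟨2 * (k : ℝ≥0) ^ j, fun x y => ?_⟩
    rw [edist_nndist]
    have : nndist (iteratedDeriv j (fun s : ℝ => Real.cos (k * s)) x)
        (iteratedDeriv j (fun s : ℝ => Real.cos (k * s)) y) ≤ 2 * (k : ℝ≥0) ^ j := by
      rw [← NNReal.coe_le_coe, coe_nndist, Real.dist_eq]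
      have h1 := hb j x
      have h2 := hb j y
      have h3 := abs_sub (iteratedDeriv j (fun s : ℝ => Real.cos (k * s)) x)
        (iteratedDeriv j (fun s : ℝ => Real.cos (k * s)) y)
      push_cast
      linarith
    simpa using (ENNReal.coe_le_coe.mpr this)
  exact MemHolder.memHolder_of_le_of_le h0 hL zero_le hα

/-- The function `e_k(s) = cos (k s)` as an element of `C^{j,α}_{p,e}(ℝ)`. -/
noncomputable def cosMode (j : ℕ) (α : ℝ≥0) (hα : α ≤ 1) (k : ℕ) : HolderPE j α :=
  ⟨fun s => Real.cos (k * s), show _ ∧ _ ∧ _ ∧ _ from ⟨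
    Real.contDiff_cos.comp (contDiff_const.mul contDiff_id),
    iteratedDeriv_cos_mul_memHolder j k hα,
    fun s => by simp,
    fun s => by
      have h : (k : ℝ) * (s + 2 * π) = k * s + k * (2 * π) := by ring
      simp only [h, Real.cos_add_nat_mul_two_pi]⟩⟩

theorem iteratedDeriv_const_memHolder (j : ℕ) (α : ℝ≥0) (c : ℝ) :
    MemHolder α (iteratedDeriv j fun _ : ℝ => c) := by
  cases j with
  | zero => simp [memHolder_const']
  | succ n =>
    have : iteratedDeriv (n + 1) (fun _ : ℝ => c) = 0 := by
      funext s
      simp [iteratedDeriv_const]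
    rw [this]
    exact memHolder_zero

/-- The constant function `c` as an element of `C^{j,α}_{p,e}(ℝ)`. -/
noncomputable def constMode (j : ℕ) (α : ℝ≥0) (c : ℝ) : HolderPE j α :=
  ⟨fun _ => c, show _ ∧ _ ∧ _ ∧ _ from
    ⟨contDiff_const, iteratedDeriv_const_memHolder j α c, fun _ => rfl, fun _ => rfl⟩⟩

/-! ### The surface of revolution `Z_φ` and the electric field operator -/

/-- The parametrization `(s, θ) ↦ (φ(s) cos θ, φ(s) sin θ, s)` of
`Z_φ = {(z, t) ∈ ℝ² × ℝ : |z| = φ(t)}`. -/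
noncomputable def surfaceParam (φ : ℝ → ℝ) (q : ℝ × ℝ) : EuclideanSpace ℝ (Fin 3) :=
  !₂[φ q.1 * Real.cos q.2, φ q.1 * Real.sin q.2, q.1]

/-- The unit normal to `Z_φ` at `surfaceParam φ q` that points into `{(z, t) : |z| > φ(t)}`. -/
noncomputable def surfaceNormal (φ : ℝ → ℝ) (q : ℝ × ℝ) : EuclideanSpace ℝ (Fin 3) :=
  (1 / √(1 + deriv φ q.1 ^ 2)) • !₂[Real.cos q.2, Real.sin q.2, -deriv φ q.1]

/-- The surface measure `σ` of `Z_φ`: the image under the parametrization over `ℝ × (-π, π]` of the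
measure with the area density `|∂_s F × ∂_θ F| = φ √(1 + φ'²)`. -/
noncomputable def surfaceMeasure (φ : ℝ → ℝ) : Measure (EuclideanSpace ℝ (Fin 3)) :=
  Measure.map (surfaceParam φ)
    (((volume : Measure (ℝ × ℝ)).restrict (Set.univ ×ˢ Set.Ioc (-π) π)).withDensity
      fun q => ENNReal.ofReal (φ q.1 * √(1 + deriv φ q.1 ^ 2)))

/-- The integrand `y ↦ (y - x) · ν⁺(x) / |x - y|³` at the point `x = surfaceParam φ q` of `Z_φ`. -/
noncomputable def fieldIntegrand (φ : ℝ → ℝ) (q : ℝ × ℝ) (y : EuclideanSpace ℝ (Fin 3)) : ℝ :=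
  inner ℝ (y - surfaceParam φ q) (surfaceNormal φ q) / ‖surfaceParam φ q - y‖ ^ 3

/-- The function `𝒩_φ` at the point `surfaceParam φ q` of `Z_φ`. -/
noncomputable def normalField (φ : ℝ → ℝ) (q : ℝ × ℝ) : ℝ :=
  1 / (4 * π) * ∫ y, fieldIntegrand φ q y ∂(surfaceMeasure φ)

/-- The function `H(φ)(s) = 4π 𝒩_φ(φ(s) e₁, s)`. -/
noncomputable def fieldFun (φ : ℝ → ℝ) (s : ℝ) : ℝ := 4 * π * normalField φ (s, 0)

open Classical in
/-- `H` as a map from `C^{2,α}_{p,e}(ℝ)` to `C^{1,α}_{p,e}(ℝ)`, with the default value `0` where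
`fieldFun φ` is not in the target space. -/
noncomputable def fieldOperator (α : ℝ≥0) (φ : HolderPE 2 α) : HolderPE 1 α :=
  if h : fieldFun φ ∈ evenPeriodicHolder 1 α then ⟨fieldFun φ, h⟩ else 0

/-- The linearization `L_λ = -λ D_φ H(λ)`, where `D_φ H(λ)` is the Fréchet derivative of `H` at the
constant function `λ`. -/
noncomputable def linearization (α : ℝ≥0) (lam : ℝ) : HolderPE 2 α →L[ℝ] HolderPE 1 α :=
  -lam • fderiv ℝ (fieldOperator α) (constMode 2 α lam)

/-! ### Modified Bessel functions -/

/-- The modified Bessel function `I_ν(x)`, for `ν ≥ 0` and `x ≥ 0`. -/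
noncomputable def besselI (ν x : ℝ) : ℝ :=
  ∑' m : ℕ, (x / 2) ^ (ν + 2 * m) / (m.factorial * Real.Gamma (ν + m + 1))

/-- The modified Bessel function `K_ν(x)`, for `x > 0`. -/
noncomputable def besselK (ν x : ℝ) : ℝ :=
  ∫ t in Set.Ioi (0 : ℝ), Real.exp (-x * Real.cosh t) * Real.cosh (ν * t)

/-- `V(ρ) = 4πρ I₁(ρ) (ρ K₁(ρ) - K₀(ρ))` for `ρ > 0`.  At `ρ = 0` the first factor makes the value
`0`, which is the limit of `V(ρ)` as `ρ → 0⁺`. -/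
noncomputable def eigenvalueV (ρ : ℝ) : ℝ :=
  4 * π * ρ * besselI 1 ρ * (ρ * besselK 1 ρ - besselK 0 ρ)

/-!
The field of a surface of revolution near a round cylinder, and the Fourier multiplier of its
linearization.

**Differentiability.**  In the coordinates `(τ, θ)` of the strip `ℝ × (-π, π]`, the height difference
and the angle, the field of `lam + v` at height `s` is, up to the factor `1 / √(1 + v'(s)²)`, the
integral of
`taylorGap v τ s * gapDensity * |x - y|⁻³ - (lam + v(s + τ)) * gapDensity * (1 - cos θ) * |x - y|⁻³`,
where `|x - y|` is the distance on the unperturbed cylinder and `taylorGap v τ s` is the Taylor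
remainder `v(s + τ) - v(s) - τ v'(s)`.  The kernel of the second part is integrable, and the densities
are smooth functions of quantities of the order of `v` (`exists_gapDensity_expansion`).  The first
part is a singular integral: after integration over `θ` the kernel is of size `τ⁻²`, and the Taylor
remainder compensates for it.  That the integral is in `C^{1,a}` rests on the symmetry `τ ↦ -τ`, which
replaces the derivative of the Taylor remainder by a second difference of `v'`
(`exists_holderC1_integral_taylorGap`).  The outcome is `exists_fieldFun_expansion`: the field is
`-2π + linField lam v` with an error that is quadratic in `C^{1,a}`; hence `H` is differentiable and
`L v = -lam * linField lam v` (`fieldOperator_differentiableAt`).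

**Diagonalization.**  The symmetry in `τ` shows that `linField` maps `cos(k ·)` to a multiple of itself
(`linField_cos`); the same factor governs the cosine coefficients of `linField v`, by Fubini's theorem
(`integral_linField_mul_cos`).  The factor is the integral of `modeIntegrand` over the strip.

* Its integral over `τ` consists of the Fourier transforms of `(τ² + m)^(-3/2)` and
  `(τ² + m)^(-5/2)` with `m = 2 lam² (1 - cos θ)`.  Written as superpositions of Gaussians, these are
  the Laplace integrals `gaussLaplace n k m` with `n = 0, 1`, and they reduce to `K_0(k √m)` and
  `∫_0^k κ K_0(κ √m) dκ` (`mul_gaussLaplace_one`, `gaussLaplace_zero_eq`).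
* The integral over `θ` is evaluated by two cases of the addition theorem of the Bessel functions:
  the integrals of `K_0(ρ √(2 (1 - cos θ)))` and of `cos θ K_0(ρ √(2 (1 - cos θ)))` over a period are
  `2π I_0(ρ) K_0(ρ)` and `2π I_1(ρ) K_1(ρ)`.  For the proof `K_0` is written as an integral of plane
  waves and the contour of the integral over `θ` is shifted (`integral_mul_coshExpIntegral_chord`).
* The remaining integral `∫_0^ρ x I_1(x) K_1(x) dx` has an explicit primitive
  (`integral_mul_cosExpIntegral_mul_coshExpIntegral`), in which the terms with `I_0 K_0` cancel.
  What is left is `V(ρ)` with `ρ = lam * k` (`mul_integral_modeIntegrand`).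
-/

/-! ### Functions of class `C^{1,a}` with explicit bounds -/

/-- `u` is differentiable and `M` bounds `|u|`, `|u'|` and the `a`-Hölder seminorm of `u'`. -/
structure HolderC1 (a M : ℝ) (u : ℝ → ℝ) : Prop where
  diff : Differentiable ℝ u
  bound : ∀ s, |u s| ≤ M
  deriv_bound : ∀ s, |deriv u s| ≤ M
  holder : ∀ s t, |deriv u s - deriv u t| ≤ M * |s - t| ^ a

theorem abs_sub_le_of_deriv_bound {u : ℝ → ℝ} {M : ℝ} (hu : Differentiable ℝ u)
    (hM : ∀ s, |deriv u s| ≤ M) (s t : ℝ) : |u s - u t| ≤ M * |s - t| := by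
  have := Convex.norm_image_sub_le_of_norm_deriv_le (f := u) (s := Set.univ) (x := t) (y := s)
    (C := M) (fun x _ => hu x) (fun x _ => hM x) convex_univ trivial trivial
  simpa [Real.norm_eq_abs] using this

/-- A bounded Lipschitz function is `a`-Hölder: the Lipschitz bound is used for distances at most `1`,
and boundedness for the larger ones. -/
theorem abs_sub_le_mul_rpow {u : ℝ → ℝ} {a M K : ℝ} (ha0 : 0 < a) (ha1 : a ≤ 1)
    (hK : 0 ≤ K) (hM : ∀ s, |u s| ≤ M) (hMK : 2 * M ≤ K)
    (hL : ∀ s t, |u s - u t| ≤ K * |s - t|) (s t : ℝ) : |u s - u t| ≤ K * |s - t| ^ a := by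
  rcases le_total |s - t| 1 with h | h
  · refine (hL s t).trans (mul_le_mul_of_nonneg_left ?_ hK)
    simpa using Real.rpow_le_rpow_of_exponent_ge_of_imp (abs_nonneg (s - t)) h ha1
      (fun _ h1 => absurd h1 one_ne_zero)
  · have h1 : 1 ≤ |s - t| ^ a := Real.one_le_rpow h ha0.le
    have h2 := abs_sub (u s) (u t)
    have h3 := hM s
    have h4 := hM t
    nlinarith

namespace HolderC1

variable {a M N : ℝ} {u w : ℝ → ℝ}

theorem nonneg (hu : HolderC1 a M u) : 0 ≤ M := (abs_nonneg _).trans (hu.bound 0)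

theorem mono (hu : HolderC1 a M u) (h : M ≤ N) : HolderC1 a N u where
  diff := hu.diff
  bound s := (hu.bound s).trans h
  deriv_bound s := (hu.deriv_bound s).trans h
  holder s t := (hu.holder s t).trans (by gcongr)

theorem congr (hu : HolderC1 a M u) (h : ∀ s, w s = u s) : HolderC1 a M w := by
  rwa [show w = u from funext h]

theorem abs_sub_le (hu : HolderC1 a M u) (s t : ℝ) : |u s - u t| ≤ M * |s - t| :=
  abs_sub_le_of_deriv_bound hu.diff hu.deriv_bound s t

theorem abs_sub_le_rpow (ha0 : 0 < a) (ha1 : a ≤ 1) (hu : HolderC1 a M u) (s t : ℝ) :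
    |u s - u t| ≤ 2 * M * |s - t| ^ a :=
  abs_sub_le_mul_rpow ha0 ha1 (by linarith [hu.nonneg]) hu.bound le_rfl
    (fun s t => (hu.abs_sub_le s t).trans
      (mul_le_mul_of_nonneg_right (by linarith [hu.nonneg]) (abs_nonneg _))) s t

theorem const (c : ℝ) : HolderC1 a |c| (fun _ => c) where
  diff := differentiable_const c
  bound _ := le_rfl
  deriv_bound s := by simp
  holder s t := by simpa using by positivity

theorem add (hu : HolderC1 a M u) (hw : HolderC1 a N w) :
    HolderC1 a (M + N) (fun s => u s + w s) := by
  have hd : ∀ s, deriv (fun s => u s + w s) s = deriv u s + deriv w s :=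
    fun s => deriv_fun_add (hu.diff s) (hw.diff s)
  refine ⟨hu.diff.add hw.diff, fun s => ?_, fun s => ?_, fun s t => ?_⟩
  · exact (abs_add_le _ _).trans (add_le_add (hu.bound s) (hw.bound s))
  · rw [hd]
    exact (abs_add_le _ _).trans (add_le_add (hu.deriv_bound s) (hw.deriv_bound s))
  · rw [hd, hd, add_sub_add_comm, add_mul]
    exact (abs_add_le _ _).trans (add_le_add (hu.holder s t) (hw.holder s t))

theorem const_mul (c : ℝ) (hu : HolderC1 a M u) :
    HolderC1 a (|c| * M) (fun s => c * u s) := by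
  have hd : ∀ s, deriv (fun s => c * u s) s = c * deriv u s := fun s => by simp
  refine ⟨hu.diff.const_mul c, fun s => ?_, fun s => ?_, fun s t => ?_⟩
  · rw [abs_mul]; exact mul_le_mul_of_nonneg_left (hu.bound s) (abs_nonneg c)
  · rw [hd, abs_mul]; exact mul_le_mul_of_nonneg_left (hu.deriv_bound s) (abs_nonneg c)
  · rw [hd, hd, ← mul_sub, abs_mul, mul_assoc]
    exact mul_le_mul_of_nonneg_left (hu.holder s t) (abs_nonneg c)

theorem mul (ha0 : 0 < a) (ha1 : a ≤ 1) (hu : HolderC1 a M u) (hw : HolderC1 a N w) :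
    HolderC1 a (6 * (M * N)) (fun s => u s * w s) := by
  have hd : ∀ s, deriv (fun s => u s * w s) s = deriv u s * w s + u s * deriv w s :=
    fun s => deriv_fun_mul (hu.diff s) (hw.diff s)
  have hM := hu.nonneg
  have hN := hw.nonneg
  have hMN := mul_nonneg hM hN
  refine ⟨hu.diff.mul hw.diff, fun s => ?_, fun s => ?_, fun s t => ?_⟩
  · rw [abs_mul]
    have := mul_le_mul (hu.bound s) (hw.bound s) (abs_nonneg _) hM
    linarith
  · rw [hd]
    refine (abs_add_le _ _).trans ?_
    rw [abs_mul, abs_mul]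
    have h1 := mul_le_mul (hu.deriv_bound s) (hw.bound s) (abs_nonneg _) hM
    have h2 := mul_le_mul (hu.bound s) (hw.deriv_bound s) (abs_nonneg _) hM
    linarith
  · rw [hd, hd]
    have hr : (0 : ℝ) ≤ |s - t| ^ a := by positivity
    have e : deriv u s * w s + u s * deriv w s - (deriv u t * w t + u t * deriv w t)
        = (deriv u s - deriv u t) * w s + deriv u t * (w s - w t)
          + ((u s - u t) * deriv w s + u t * (deriv w s - deriv w t)) := by ring
    rw [e]
    refine (abs_add_le _ _).trans ((add_le_add (abs_add_le _ _) (abs_add_le _ _)).trans ?_)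
    simp only [abs_mul]
    have h1 := mul_le_mul (hu.holder s t) (hw.bound s) (abs_nonneg _) (by positivity)
    have h2 := mul_le_mul (hu.deriv_bound t) (hw.abs_sub_le_rpow ha0 ha1 s t) (abs_nonneg _) hM
    have h3 := mul_le_mul (hu.abs_sub_le_rpow ha0 ha1 s t) (hw.deriv_bound s) (abs_nonneg _)
      (by positivity)
    have h4 := mul_le_mul (hu.bound t) (hw.holder s t) (abs_nonneg _) hM
    linarith

theorem comp_add_const (hu : HolderC1 a M u) (c : ℝ) : HolderC1 a M (fun s => u (s + c)) := by
  have hd : ∀ s, deriv (fun s => u (s + c)) s = deriv u (s + c) :=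
    fun s => deriv_comp_add_const u c s
  refine ⟨hu.diff.comp (differentiable_id.add_const c), fun s => hu.bound _, fun s => ?_,
    fun s t => ?_⟩
  · rw [hd]; exact hu.deriv_bound _
  · rw [hd, hd]; simpa using hu.holder (s + c) (t + c)

theorem comp (ha0 : 0 < a) (ha1 : a ≤ 1) (hu : HolderC1 a M u) {f : ℝ → ℝ} {L0 L1 L2 : ℝ}
    (hf : ∀ y, |y| ≤ M → DifferentiableAt ℝ f y) (h0 : ∀ y, |y| ≤ M → |f y| ≤ L0)
    (h1 : ∀ y, |y| ≤ M → |deriv f y| ≤ L1)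
    (h2 : ∀ y z, |y| ≤ M → |z| ≤ M → |deriv f y - deriv f z| ≤ L2 * |y - z|) (hL2 : 0 ≤ L2) :
    HolderC1 a (L0 + L1 * M + 2 * L2 * M ^ 2) (fun s => f (u s)) := by
  have hM := hu.nonneg
  have hL0 : 0 ≤ L0 := (abs_nonneg _).trans (h0 _ (hu.bound 0))
  have hL1 : 0 ≤ L1 := (abs_nonneg _).trans (h1 _ (hu.bound 0))
  have hd : ∀ s, HasDerivAt (fun s => f (u s)) (deriv f (u s) * deriv u s) s := fun s =>
    (hf _ (hu.bound s)).hasDerivAt.comp s (hu.diff s).hasDerivAt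
  have hL1M := mul_nonneg hL1 hM
  have hL2M : 0 ≤ 2 * L2 * M ^ 2 := by positivity
  refine ⟨fun s => (hd s).differentiableAt, fun s => ?_, fun s => ?_, fun s t => ?_⟩
  · have := h0 _ (hu.bound s)
    linarith
  · rw [(hd s).deriv, abs_mul]
    have := mul_le_mul (h1 _ (hu.bound s)) (hu.deriv_bound s) (abs_nonneg _) hL1
    linarith
  · rw [(hd s).deriv, (hd t).deriv]
    have hr : (0 : ℝ) ≤ |s - t| ^ a := by positivity
    have e : deriv f (u s) * deriv u s - deriv f (u t) * deriv u t
      = deriv f (u s) * (deriv u s - deriv u t) + (deriv f (u s) - deriv f (u t)) * deriv u t := by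
      ring
    rw [e]
    refine (abs_add_le _ _).trans ?_
    rw [abs_mul, abs_mul]
    have e1 := mul_le_mul (h1 _ (hu.bound s)) (hu.holder s t) (abs_nonneg _) hL1
    have e2 : |deriv f (u s) - deriv f (u t)| ≤ L2 * (2 * M * |s - t| ^ a) :=
      (h2 _ _ (hu.bound s) (hu.bound t)).trans
        (mul_le_mul_of_nonneg_left (hu.abs_sub_le_rpow ha0 ha1 s t) hL2)
    have e3 := mul_le_mul e2 (hu.deriv_bound t) (abs_nonneg _) (by positivity)
    have e4 := mul_nonneg hL0 hr
    nlinarith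

end HolderC1

/-- Uniform constants for the functional calculus of a `C²` function on `[-1/2, 1/2]`. -/
theorem exists_calculus_bound {f : ℝ → ℝ} (hf : ∀ y : ℝ, |y| ≤ 1 / 2 → ContDiffAt ℝ 2 f y) :
    ∃ C, 0 ≤ C ∧ (∀ y, |y| ≤ 1 / 2 → |deriv f y| ≤ C) ∧
      (∀ y z, |y| ≤ 1 / 2 → |z| ≤ 1 / 2 → |deriv f y - deriv f z| ≤ C * |y - z|) ∧
      (∀ y z, |y| ≤ 1 / 2 → |z| ≤ 1 / 2 → |f y - f z| ≤ C * |y - z|) ∧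
      (∀ y, |y| ≤ 1 / 2 → |f y - f 0 - deriv f 0 * y| ≤ C * y ^ 2) := by
  have hI : ∀ y : ℝ, y ∈ Set.Icc (-(1 / 2) : ℝ) (1 / 2) ↔ |y| ≤ 1 / 2 := fun y => by
    rw [abs_le, Set.mem_Icc]
  have hc1 : ∀ y : ℝ, |y| ≤ 1 / 2 → ContDiffAt ℝ 1 (deriv f) y := fun y hy =>
    (hf y hy).derivWithin (by norm_num)
  have hc2 : ∀ y : ℝ, |y| ≤ 1 / 2 → ContDiffAt ℝ 0 (deriv (deriv f)) y := fun y hy =>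
    (hc1 y hy).derivWithin (by norm_num)
  have hk : IsCompact (Set.Icc (-(1 / 2) : ℝ) (1 / 2)) := isCompact_Icc
  obtain ⟨C1, hC1⟩ := hk.exists_bound_of_continuousOn (f := deriv f)
    (fun y hy => (hc1 y ((hI y).1 hy)).continuousAt.continuousWithinAt)
  obtain ⟨C2, hC2⟩ := hk.exists_bound_of_continuousOn (f := deriv (deriv f))
    (fun y hy => (hc2 y ((hI y).1 hy)).continuousAt.continuousWithinAt)
  have hconv : Convex ℝ (Set.Icc (-(1 / 2) : ℝ) (1 / 2)) := convex_Icc _ _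
  have l1 : ∀ y z, |y| ≤ 1 / 2 → |z| ≤ 1 / 2 → |f y - f z| ≤ C1 * |y - z| := fun y z hy hz =>
    hconv.norm_image_sub_le_of_norm_deriv_le
      (fun x hx => (hf x ((hI x).1 hx)).differentiableAt (by norm_num)) hC1
      ((hI z).2 hz) ((hI y).2 hy)
  have l2 : ∀ y z, |y| ≤ 1 / 2 → |z| ≤ 1 / 2 → |deriv f y - deriv f z| ≤ C2 * |y - z| :=
    fun y z hy hz => hconv.norm_image_sub_le_of_norm_deriv_le
      (fun x hx => (hc1 x ((hI x).1 hx)).differentiableAt (by norm_num)) hC2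
      ((hI z).2 hz) ((hI y).2 hy)
  refine ⟨|C1| + |C2|, by positivity, fun y hy => ?_, fun y z hy hz => ?_, fun y z hy hz => ?_,
    fun y hy => ?_⟩
  · have := hC1 y ((hI y).2 hy)
    rw [Real.norm_eq_abs] at this
    linarith [le_abs_self C1, abs_nonneg C2]
  · refine (l2 y z hy hz).trans (mul_le_mul_of_nonneg_right ?_ (abs_nonneg _))
    linarith [le_abs_self C2, abs_nonneg C1]
  · refine (l1 y z hy hz).trans (mul_le_mul_of_nonneg_right ?_ (abs_nonneg _))
    linarith [le_abs_self C1, abs_nonneg C2]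
  · have hy' : ∀ x ∈ Set.uIcc 0 y, |x| ≤ |y| := fun x hx => by
      rcases le_total 0 y with h | h
      · rw [Set.uIcc_of_le h] at hx
        rw [abs_of_nonneg hx.1, abs_of_nonneg h]; exact hx.2
      · rw [Set.uIcc_of_ge h] at hx
        rw [abs_of_nonpos hx.2, abs_of_nonpos h]; linarith [hx.1]
    have hd : ∀ x ∈ Set.uIcc 0 y, HasDerivWithinAt (fun x => f x - deriv f 0 * x)
        (deriv f x - deriv f 0) (Set.uIcc 0 y) x := fun x hx => by
      have h1 := ((hf x ((hy' x hx).trans hy)).differentiableAt (by norm_num)).hasDerivAt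
      simpa using (h1.fun_sub ((hasDerivAt_id x).const_mul (deriv f 0))).hasDerivWithinAt
    have hb : ∀ x ∈ Set.uIcc 0 y, ‖deriv f x - deriv f 0‖ ≤ |C2| * |y| := fun x hx => by
      refine (l2 x 0 ((hy' x hx).trans hy) (by norm_num)).trans ?_
      rw [sub_zero]
      exact mul_le_mul (le_abs_self _) (hy' x hx) (abs_nonneg _) (abs_nonneg _)
    have := (convex_uIcc 0 y).norm_image_sub_le_of_norm_hasDerivWithin_le hd hb
      Set.left_mem_uIcc Set.right_mem_uIcc
    rw [Real.norm_eq_abs, Real.norm_eq_abs] at this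
    have e : f y - deriv f 0 * y - (f 0 - deriv f 0 * 0) = f y - f 0 - deriv f 0 * y := by ring
    rw [e, sub_zero, mul_assoc, ← sq, sq_abs] at this
    nlinarith [abs_nonneg C1, sq_nonneg y]

/-! ### Families indexed by the shift -/

/-- A family of `C^{1,a}` functions, indexed by the shift `τ`, with a common bound `k`, whose odd
part in `τ` is of order `τ`. -/
structure HolderFamily (a k : ℝ) (W : ℝ → ℝ → ℝ) : Prop where
  holderC1 : ∀ τ, HolderC1 a k (W τ)
  odd_bound : ∀ τ s, |W τ s - W (-τ) s| ≤ k * |τ|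

namespace HolderFamily

variable {a M N : ℝ} {u w : ℝ → ℝ → ℝ}

theorem nonneg (hu : HolderFamily a M u) : 0 ≤ M := (hu.holderC1 0).nonneg

theorem mono (hu : HolderFamily a M u) (h : M ≤ N) : HolderFamily a N u where
  holderC1 τ := (hu.holderC1 τ).mono h
  odd_bound τ s := (hu.odd_bound τ s).trans (by gcongr)

theorem congr (hu : HolderFamily a M u) (h : ∀ τ s, w τ s = u τ s) : HolderFamily a M w := by
  rwa [show w = u from funext fun τ => funext (h τ)]

theorem of_const {f : ℝ → ℝ} (hf : HolderC1 a M f) : HolderFamily a M (fun _ => f) where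
  holderC1 _ := hf
  odd_bound τ s := by simpa using mul_nonneg hf.nonneg (abs_nonneg τ)

theorem add (hu : HolderFamily a M u) (hw : HolderFamily a N w) :
    HolderFamily a (M + N) (fun τ s => u τ s + w τ s) where
  holderC1 τ := (hu.holderC1 τ).add (hw.holderC1 τ)
  odd_bound τ s := by
    rw [add_sub_add_comm, add_mul]
    exact (abs_add_le _ _).trans (add_le_add (hu.odd_bound τ s) (hw.odd_bound τ s))

theorem mul (ha0 : 0 < a) (ha1 : a ≤ 1) (hu : HolderFamily a M u) (hw : HolderFamily a N w) :
    HolderFamily a (6 * (M * N)) (fun τ s => u τ s * w τ s) where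
  holderC1 τ := (hu.holderC1 τ).mul ha0 ha1 (hw.holderC1 τ)
  odd_bound τ s := by
    have e : u τ s * w τ s - u (-τ) s * w (-τ) s
        = (u τ s - u (-τ) s) * w τ s + u (-τ) s * (w τ s - w (-τ) s) := by ring
    rw [e]
    refine (abs_add_le _ _).trans ?_
    rw [abs_mul, abs_mul]
    have hM := hu.nonneg
    have hN := hw.nonneg
    have h1 := mul_le_mul (hu.odd_bound τ s) ((hw.holderC1 τ).bound s) (abs_nonneg _)
      (by positivity)
    have h2 := mul_le_mul ((hu.holderC1 (-τ)).bound s) (hw.odd_bound τ s) (abs_nonneg _) hM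
    have h3 : 0 ≤ M * N * |τ| := by positivity
    linarith

/-- An even multiplier is only required to be bounded, since it does not contribute to the odd part. -/
theorem even_mul {c : ℝ → ℝ} {K : ℝ} (hc : ∀ τ, c (-τ) = c τ) (hK : ∀ τ, |c τ| ≤ K)
    (hu : HolderFamily a M u) : HolderFamily a (K * M) (fun τ s => c τ * u τ s) where
  holderC1 τ := ((hu.holderC1 τ).const_mul (c τ)).mono
    (mul_le_mul_of_nonneg_right (hK τ) hu.nonneg)
  odd_bound τ s := by
    rw [hc, ← mul_sub, abs_mul, mul_assoc]
    exact mul_le_mul (hK τ) (hu.odd_bound τ s) (abs_nonneg _) ((abs_nonneg _).trans (hK τ))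

end HolderFamily

/-- First order functional calculus: `f ∘ u - f 0` is of the order of `u`. -/
theorem exists_holderFamily_comp {a : ℝ} (ha0 : 0 < a) (ha1 : a ≤ 1) {f : ℝ → ℝ}
    (hf : ∀ y : ℝ, |y| ≤ 1 / 2 → ContDiffAt ℝ 2 f y) :
    ∃ C, 0 ≤ C ∧ ∀ (M : ℝ) (u : ℝ → ℝ → ℝ), M ≤ 1 / 2 → HolderFamily a M u →
      HolderFamily a (C * M) (fun τ s => f (u τ s) - f 0) := by
  obtain ⟨C, hC0, hC1, hC2, hC3, -⟩ := exists_calculus_bound hf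
  refine ⟨3 * C, by positivity, fun M u hM hu => ?_⟩
  have hMn := hu.nonneg
  have hd : ∀ y, deriv (fun y => f y - f 0) y = deriv f y := fun y => deriv_sub_const _
  refine ⟨fun τ => ?_, fun τ s => ?_⟩
  · refine ((hu.holderC1 τ).comp ha0 ha1 (f := fun y => f y - f 0) (L0 := C * M) (L1 := C) (L2 := C)
      (fun y hy => ?_) (fun y hy => ?_) (fun y hy => ?_) (fun y z hy hz => ?_) hC0).mono ?_
    · exact ((hf y (hy.trans hM)).differentiableAt (by norm_num)).sub_const _
    · refine (hC3 y 0 (hy.trans hM) (by norm_num)).trans ?_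
      rw [sub_zero]; gcongr
    · rw [hd]; exact hC1 y (hy.trans hM)
    · rw [hd, hd]; exact hC2 y z (hy.trans hM) (hz.trans hM)
    · nlinarith [mul_nonneg hC0 hMn]
  · have h1 := hC3 _ _ (((hu.holderC1 τ).bound s).trans hM) (((hu.holderC1 (-τ)).bound s).trans hM)
    have h2 := mul_le_mul_of_nonneg_left (hu.odd_bound τ s) hC0
    have h3 : 0 ≤ C * (M * |τ|) := by positivity
    rw [sub_sub_sub_cancel_right]
    linarith

/-- Second order functional calculus: `f ∘ u - f 0 - f'(0) u` is quadratic in `u`. -/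
theorem exists_holderC1_comp_sq {a : ℝ} (ha0 : 0 < a) (ha1 : a ≤ 1) {f : ℝ → ℝ}
    (hf : ∀ y : ℝ, |y| ≤ 1 / 2 → ContDiffAt ℝ 2 f y) :
    ∃ C, 0 ≤ C ∧ ∀ (M : ℝ) (u : ℝ → ℝ), M ≤ 1 / 2 → HolderC1 a M u →
      HolderC1 a (C * M ^ 2) (fun s => f (u s) - f 0 - deriv f 0 * u s) := by
  obtain ⟨C, hC0, -, hC2, -, hC4⟩ := exists_calculus_bound hf
  refine ⟨4 * C, by positivity, fun M u hM hu => ?_⟩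
  have hMn := hu.nonneg
  have hd : ∀ y, |y| ≤ 1 / 2 →
      HasDerivAt (fun y => f y - f 0 - deriv f 0 * y) (deriv f y - deriv f 0) y := fun y hy => by
    have h1 := ((hf y hy).differentiableAt (by norm_num)).hasDerivAt
    simpa using (h1.sub_const (f 0)).fun_sub ((hasDerivAt_id y).const_mul (deriv f 0))
  refine (hu.comp ha0 ha1 (f := fun y => f y - f 0 - deriv f 0 * y)
    (L0 := C * M ^ 2) (L1 := C * M) (L2 := C)
      (fun y hy => ?_) (fun y hy => ?_) (fun y hy => ?_) (fun y z hy hz => ?_) hC0).mono ?_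
  · exact (hd y (hy.trans hM)).differentiableAt
  · refine (hC4 y (hy.trans hM)).trans ?_
    rw [← sq_abs y]; gcongr
  · rw [(hd y (hy.trans hM)).deriv]
    refine (hC2 y 0 (hy.trans hM) (by norm_num)).trans ?_
    rw [sub_zero]; gcongr
  · rw [(hd y (hy.trans hM)).deriv, (hd z (hz.trans hM)).deriv, sub_sub_sub_cancel_right]
    exact hC2 y z (hy.trans hM) (hz.trans hM)
  · nlinarith [mul_nonneg hC0 hMn]

/-! ### Differentiation of parameter integrals in `C^{1,a}` -/

/-- A parameter integral is in `C^{1,a}` if the integrand and its derivative are dominated and the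
increments of the derivative over a distance `δ` are dominated by a function whose integral is at
most `M * δ ^ a`. -/
theorem holderC1_integral {Ω : Type*} [MeasurableSpace Ω] {μ : Measure Ω} {a M : ℝ} (hM : 0 ≤ M)
    {g : Ω → ℝ → ℝ} {b : Ω → ℝ} {h : ℝ → Ω → ℝ}
    (hmeas : ∀ s, AEStronglyMeasurable (fun ω => g ω s) μ) (hb : Integrable b μ)
    (hbM : ∫ ω, b ω ∂μ ≤ M) (hdiff : ∀ ω, Differentiable ℝ (g ω))
    (hg : ∀ ω s, |g ω s| ≤ b ω) (hg' : ∀ ω s, |deriv (g ω) s| ≤ b ω)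
    (hh : ∀ ω s t, s ≠ t → |deriv (g ω) s - deriv (g ω) t| ≤ h |s - t| ω)
    (hhint : ∀ δ > 0, Integrable (h δ) μ) (hhM : ∀ δ > 0, ∫ ω, h δ ω ∂μ ≤ M * δ ^ a) :
    HolderC1 a M (fun s => ∫ ω, g ω s ∂μ) := by
  have hmeas' : ∀ s, AEStronglyMeasurable (fun ω => deriv (g ω) s) μ := fun s => by
    have hlim : Tendsto (fun n : ℕ => (1 : ℝ) / ((n : ℝ) + 1)) atTop (𝓝[≠] 0) :=
      tendsto_nhdsWithin_iff.2 ⟨tendsto_one_div_add_atTop_nhds_zero_nat,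
        Eventually.of_forall fun n => (Nat.one_div_pos_of_nat (α := ℝ)).ne'⟩
    refine aestronglyMeasurable_of_tendsto_ae (u := atTop)
      (f := fun (n : ℕ) ω => (1 / ((n : ℝ) + 1))⁻¹ • (g ω (s + 1 / ((n : ℝ) + 1)) - g ω s))
      (fun n => ((hmeas _).fun_sub (hmeas _)).fun_const_smul _) (Eventually.of_forall fun ω => ?_)
    exact ((hasDerivAt_iff_tendsto_slope_zero.1 (hdiff ω s).hasDerivAt).comp hlim)
  have hint : ∀ s, Integrable (fun ω => g ω s) μ := fun s =>
    hb.mono' (hmeas s) (Eventually.of_forall fun ω => hg ω s)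
  have hint' : ∀ s, Integrable (fun ω => deriv (g ω) s) μ := fun s =>
    hb.mono' (hmeas' s) (Eventually.of_forall fun ω => hg' ω s)
  have hd : ∀ s, HasDerivAt (fun s => ∫ ω, g ω s ∂μ) (∫ ω, deriv (g ω) s ∂μ) s := fun s =>
    (hasDerivAt_integral_of_dominated_loc_of_deriv_le (s := Set.univ) (bound := b)
      (F := fun s ω => g ω s) (F' := fun s ω => deriv (g ω) s)
      univ_mem (Eventually.of_forall hmeas) (hint s) (hmeas' s)
      (Eventually.of_forall fun ω s _ => hg' ω s) hb
      (Eventually.of_forall fun ω s _ => (hdiff ω s).hasDerivAt)).2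
  have hle : ∀ (f : Ω → ℝ) (c : Ω → ℝ), Integrable c μ → (∀ ω, |f ω| ≤ c ω) →
      |∫ ω, f ω ∂μ| ≤ ∫ ω, c ω ∂μ := fun f c hc hfc => by
    have := norm_integral_le_of_norm_le hc (Eventually.of_forall hfc : ∀ᵐ ω ∂μ, ‖f ω‖ ≤ c ω)
    exact this
  refine ⟨fun s => (hd s).differentiableAt, fun s => ?_, fun s => ?_, fun s t => ?_⟩
  · exact (hle _ _ hb fun ω => hg ω s).trans hbM
  · rw [(hd s).deriv]
    exact (hle _ _ hb fun ω => hg' ω s).trans hbM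
  · rcases eq_or_ne s t with rfl | hst
    · simpa using by positivity
    · have hδ : 0 < |s - t| := abs_pos.2 (sub_ne_zero.2 hst)
      rw [(hd s).deriv, (hd t).deriv, ← integral_sub (hint' s) (hint' t)]
      exact (hle _ _ (hhint _ hδ) fun ω => hh ω s t hst).trans (hhM _ hδ)

/-- The case in which every integrand is in `C^{1,a}`, with an integrable bound. -/
theorem holderC1_integral_of_holderC1 {Ω : Type*} [MeasurableSpace Ω] {μ : Measure Ω} {a M : ℝ}
    {g : Ω → ℝ → ℝ} {b : Ω → ℝ}
    (hmeas : ∀ s, AEStronglyMeasurable (fun ω => g ω s) μ) (hb : Integrable b μ)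
    (hbM : ∫ ω, b ω ∂μ ≤ M) (hg : ∀ ω, HolderC1 a (b ω) (g ω)) :
    HolderC1 a M (fun s => ∫ ω, g ω s ∂μ) := by
  have hM : 0 ≤ M := (integral_nonneg fun ω => (hg ω).nonneg).trans hbM
  refine holderC1_integral (h := fun δ ω => b ω * δ ^ a) hM hmeas hb hbM
    (fun ω => (hg ω).diff)
    (fun ω => (hg ω).bound) (fun ω => (hg ω).deriv_bound) (fun ω s t _ => (hg ω).holder s t)
    (fun δ _ => hb.mul_const _) fun δ hδ => ?_
  rw [integral_mul_const]
  gcongr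

/-! ### Taylor remainders of a `C^{2,a}` function -/

/-- `v` is twice differentiable and `N` bounds `|v|`, `|v'|`, `|v''|` and the `a`-Hölder seminorm
of `v''`. -/
structure HolderC2 (a N : ℝ) (v : ℝ → ℝ) : Prop where
  diff : Differentiable ℝ v
  bound : ∀ s, |v s| ≤ N
  holderC1_deriv : HolderC1 a N (deriv v)

/-- The first order Taylor remainder `v(s + τ) - v(s) - τ v'(s)`. -/
noncomputable def taylorGap (v : ℝ → ℝ) (τ s : ℝ) : ℝ := v (s + τ) - v s - τ * deriv v s

theorem abs_taylorGap_le_of_deriv {f : ℝ → ℝ} (hf : Differentiable ℝ f) {s τ K : ℝ}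
    (hK : ∀ x, |x| ≤ |τ| → |deriv f (s + x) - deriv f s| ≤ K) :
    |taylorGap f τ s| ≤ K * |τ| := by
  have hy' : ∀ x ∈ Set.uIcc 0 τ, |x| ≤ |τ| := fun x hx => by
    rcases le_total 0 τ with h | h
    · rw [Set.uIcc_of_le h] at hx
      rw [abs_of_nonneg hx.1, abs_of_nonneg h]; exact hx.2
    · rw [Set.uIcc_of_ge h] at hx
      rw [abs_of_nonpos hx.2, abs_of_nonpos h]; linarith [hx.1]
  have hd : ∀ x ∈ Set.uIcc 0 τ, HasDerivWithinAt (fun x => f (s + x) - x * deriv f s)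
      (deriv f (s + x) - deriv f s) (Set.uIcc 0 τ) x := fun x _ => by
    have h1 : HasDerivAt (fun x => f (s + x)) (deriv f (s + x)) x :=
      (hf (s + x)).hasDerivAt.comp_const_add s x
    simpa using (h1.fun_sub ((hasDerivAt_id x).mul_const (deriv f s))).hasDerivWithinAt
  have := (convex_uIcc 0 τ).norm_image_sub_le_of_norm_hasDerivWithin_le hd
    (fun x hx => hK x (hy' x hx)) Set.left_mem_uIcc Set.right_mem_uIcc
  simp only [Real.norm_eq_abs, add_zero, zero_mul, sub_zero] at this
  rwa [sub_right_comm] at this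

namespace HolderC2

variable {a N : ℝ} {v : ℝ → ℝ}

theorem nonneg (hv : HolderC2 a N v) : 0 ≤ N := hv.holderC1_deriv.nonneg

theorem holderC1 (ha0 : 0 < a) (ha1 : a ≤ 1) (hv : HolderC2 a N v) : HolderC1 a (2 * N) v where
  diff := hv.diff
  bound s := (hv.bound s).trans (by linarith [hv.nonneg])
  deriv_bound s := (hv.holderC1_deriv.bound s).trans (by linarith [hv.nonneg])
  holder s t := hv.holderC1_deriv.abs_sub_le_rpow ha0 ha1 s t

theorem hasDerivAt_taylorGap (hv : HolderC2 a N v) (τ s : ℝ) :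
    HasDerivAt (taylorGap v τ) (taylorGap (deriv v) τ s) s := by
  have h1 : HasDerivAt (fun s => v (s + τ)) (deriv v (s + τ)) s :=
    (hv.diff (s + τ)).hasDerivAt.comp_add_const s τ
  exact (h1.fun_sub (hv.diff s).hasDerivAt).fun_sub
    ((hv.holderC1_deriv.diff s).hasDerivAt.const_mul τ)

theorem abs_taylorGap_le_sq (hv : HolderC2 a N v) (τ s : ℝ) : |taylorGap v τ s| ≤ N * τ ^ 2 := by
  have := abs_taylorGap_le_of_deriv (f := v) hv.diff (s := s) (τ := τ) (K := N * |τ|)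
    fun x hx => ((hv.holderC1_deriv.abs_sub_le (s + x) s).trans (by
      rw [add_sub_cancel_left]; exact mul_le_mul_of_nonneg_left hx hv.nonneg))
  rwa [mul_assoc, ← sq, sq_abs] at this

theorem abs_taylorGap_le (hv : HolderC2 a N v) (τ s : ℝ) :
    |taylorGap v τ s| ≤ 2 * N * |τ| :=
  abs_taylorGap_le_of_deriv hv.diff fun x _ => (abs_sub _ _).trans (by
    linarith [hv.holderC1_deriv.bound (s + x), hv.holderC1_deriv.bound s])

theorem abs_deriv_taylorGap_le (hv : HolderC2 a N v) (τ s : ℝ) :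
    |taylorGap (deriv v) τ s| ≤ 2 * N * |τ| :=
  abs_taylorGap_le_of_deriv hv.holderC1_deriv.diff fun x _ => (abs_sub _ _).trans (by
    linarith [hv.holderC1_deriv.deriv_bound (s + x), hv.holderC1_deriv.deriv_bound s])

theorem abs_deriv_taylorGap_le_rpow (ha0 : 0 < a) (hv : HolderC2 a N v) (τ s : ℝ) :
    |taylorGap (deriv v) τ s| ≤ N * |τ| ^ (1 + a) := by
  have := abs_taylorGap_le_of_deriv hv.holderC1_deriv.diff (s := s) (τ := τ) (K := N * |τ| ^ a)
    fun x hx => ((hv.holderC1_deriv.holder (s + x) s).trans (by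
      rw [add_sub_cancel_left]
      exact mul_le_mul_of_nonneg_left (Real.rpow_le_rpow (abs_nonneg _) hx ha0.le) hv.nonneg))
  rwa [mul_assoc, ← Real.rpow_add_one' (abs_nonneg _) (by linarith), add_comm a 1] at this

theorem abs_shift_sub_le (hv : HolderC2 a N v) (τ s t : ℝ) :
    |deriv v (s + τ) - deriv v (t + τ) - (deriv v s - deriv v t)| ≤ N * |s - t| ^ a * |τ| := by
  have h1 : ∀ x, HasDerivAt (fun x => deriv v (s + x) - deriv v (t + x))
      (deriv (deriv v) (s + x) - deriv (deriv v) (t + x)) x := fun x =>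
    ((hv.holderC1_deriv.diff (s + x)).hasDerivAt.comp_const_add s x).fun_sub
      ((hv.holderC1_deriv.diff (t + x)).hasDerivAt.comp_const_add t x)
  have := abs_sub_le_of_deriv_bound (u := fun x => deriv v (s + x) - deriv v (t + x))
    (M := N * |s - t| ^ a) (fun x => (h1 x).differentiableAt) (fun x => by
      rw [(h1 x).deriv]
      simpa using hv.holderC1_deriv.holder (s + x) (t + x)) τ 0
  simpa using this

theorem abs_deriv_taylorGap_sub_le (hv : HolderC2 a N v) (τ s t : ℝ) :
    |taylorGap (deriv v) τ s - taylorGap (deriv v) τ t| ≤ 2 * N * |s - t| ^ a * |τ| := by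
  have e : taylorGap (deriv v) τ s - taylorGap (deriv v) τ t
      = (deriv v (s + τ) - deriv v (t + τ) - (deriv v s - deriv v t))
        - τ * (deriv (deriv v) s - deriv (deriv v) t) := by
    simp only [taylorGap]; ring
  rw [e]
  refine (abs_sub _ _).trans ?_
  rw [abs_mul]
  have h1 := hv.abs_shift_sub_le τ s t
  have h2 := mul_le_mul_of_nonneg_left (hv.holderC1_deriv.holder s t) (abs_nonneg τ)
  linarith

/-- The even part in `τ` of the differentiated Taylor remainder is a second difference of `v'`.  It
is Lipschitz with constant of order `|τ| ^ a`, which is better than what holds for each half. -/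
theorem abs_secondDiff_sub_le (hv : HolderC2 a N v) (τ s t : ℝ) :
    |(taylorGap (deriv v) τ s + taylorGap (deriv v) (-τ) s)
      - (taylorGap (deriv v) τ t + taylorGap (deriv v) (-τ) t)| ≤ 2 * N * |τ| ^ a * |s - t| := by
  have h1 : ∀ x, HasDerivAt (fun x => deriv v (x + τ) + deriv v (x + -τ) - 2 * deriv v x)
      (deriv (deriv v) (x + τ) + deriv (deriv v) (x + -τ) - 2 * deriv (deriv v) x) x := fun x =>
    (((hv.holderC1_deriv.diff (x + τ)).hasDerivAt.comp_add_const x τ).fun_add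
      ((hv.holderC1_deriv.diff (x + -τ)).hasDerivAt.comp_add_const x (-τ))).fun_sub
      ((hv.holderC1_deriv.diff x).hasDerivAt.const_mul 2)
  have := abs_sub_le_of_deriv_bound
    (u := fun x => deriv v (x + τ) + deriv v (x + -τ) - 2 * deriv v x)
    (M := 2 * N * |τ| ^ a) (fun x => (h1 x).differentiableAt) (fun x => by
      rw [(h1 x).deriv]
      have e : deriv (deriv v) (x + τ) + deriv (deriv v) (x + -τ) - 2 * deriv (deriv v) x
        = (deriv (deriv v) (x + τ) - deriv (deriv v) x)
          + (deriv (deriv v) (x + -τ) - deriv (deriv v) x) := by ring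
      rw [e]
      have e1 := hv.holderC1_deriv.holder (x + τ) x
      have e2 := hv.holderC1_deriv.holder (x + -τ) x
      rw [add_sub_cancel_left] at e1 e2
      rw [abs_neg] at e2
      exact (abs_add_le _ _).trans (by linarith)) s t
  refine le_trans (le_of_eq ?_) this
  simp only [taylorGap]
  congr 1
  ring

/-- The difference quotient `(v(s + τ) - v(s)) / τ`; at `τ = 0` its value is `0`. -/
theorem holderFamily_slope (hv : HolderC2 a N v) :
    HolderFamily a (2 * N) (fun τ s => (v (s + τ) - v s) / τ) where
  holderC1 τ := by
    have hN := hv.nonneg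
    rcases eq_or_ne τ 0 with rfl | hτ
    · simpa using (HolderC1.const (a := a) 0).mono (N := 2 * N) (by simpa using hN)
    have hτ' : 0 < |τ| := abs_pos.2 hτ
    have hd : ∀ s, HasDerivAt (fun s => (v (s + τ) - v s) / τ)
        ((deriv v (s + τ) - deriv v s) / τ) s := fun s =>
      (((hv.diff (s + τ)).hasDerivAt.comp_add_const s τ).fun_sub (hv.diff s).hasDerivAt).div_const τ
    refine ⟨fun s => (hd s).differentiableAt, fun s => ?_, fun s => ?_, fun s t => ?_⟩
    · rw [abs_div, div_le_iff₀ hτ']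
      have := abs_sub_le_of_deriv_bound hv.diff hv.holderC1_deriv.bound (s + τ) s
      rw [add_sub_cancel_left] at this
      nlinarith
    · rw [(hd s).deriv, abs_div, div_le_iff₀ hτ']
      have := hv.holderC1_deriv.abs_sub_le (s + τ) s
      rw [add_sub_cancel_left] at this
      nlinarith
    · rw [(hd s).deriv, (hd t).deriv, ← sub_div, abs_div, div_le_iff₀ hτ']
      have := hv.abs_shift_sub_le τ s t
      have h0 : 0 ≤ N * |s - t| ^ a * |τ| := by positivity
      rw [sub_sub_sub_comm] at this
      linarith
  odd_bound τ s := by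
    rcases eq_or_ne τ 0 with rfl | hτ
    · simp
    have hτ' : 0 < |τ| := abs_pos.2 hτ
    have e : (v (s + τ) - v s) / τ - (v (s + -τ) - v s) / -τ
        = (taylorGap v τ s + taylorGap v (-τ) s) / τ := by
      simp only [taylorGap]; field_simp; ring
    rw [e, abs_div, div_le_iff₀ hτ']
    refine (abs_add_le _ _).trans ?_
    have h1 := hv.abs_taylorGap_le_sq τ s
    have h2 := hv.abs_taylorGap_le_sq (-τ) s
    rw [neg_sq] at h2
    have h3 : 2 * N * |τ| * |τ| = 2 * N * τ ^ 2 := by rw [mul_assoc, ← sq, sq_abs]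
    linarith

end HolderC2

theorem HolderC1.holderFamily_shift {a M : ℝ} {u : ℝ → ℝ} (hu : HolderC1 a M u) :
    HolderFamily a (2 * M) (fun τ s => u (s + τ)) where
  holderC1 τ := (hu.comp_add_const τ).mono (by linarith [hu.nonneg])
  odd_bound τ s := by
    have := hu.abs_sub_le (s + τ) (s + -τ)
    rwa [show s + τ - (s + -τ) = 2 * τ by ring, abs_mul, abs_two, ← mul_assoc,
      mul_comm M 2] at this

/-- `min (|τ| ^ (1 + a)) |τ|`, the order of the Taylor remainder and of its derivative. -/
noncomputable def gapOrder (a τ : ℝ) : ℝ := min (|τ| ^ (1 + a)) |τ|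

theorem gapOrder_nonneg (a τ : ℝ) : 0 ≤ gapOrder a τ := le_min (by positivity) (by positivity)

theorem sq_le_gapOrder {a τ : ℝ} (ha1 : a ≤ 1) (hτ : |τ| ≤ 1) :
    τ ^ 2 ≤ gapOrder a τ := by
  refine le_min ?_ ?_
  · rw [← sq_abs, ← Real.rpow_two]
    exact Real.rpow_le_rpow_of_exponent_ge_of_imp (abs_nonneg _) hτ (by linarith)
      (fun _ h => by linarith)
  · rw [← sq_abs]; nlinarith [abs_nonneg τ]

theorem gapOrder_of_one_le {a τ : ℝ} (ha0 : 0 < a) (hτ : 1 ≤ |τ|) : gapOrder a τ = |τ| := by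
  refine min_eq_right ?_
  nth_rw 1 [← Real.rpow_one |τ|]
  exact Real.rpow_le_rpow_of_exponent_le hτ (by linarith)

section
variable {a N k : ℝ} {v : ℝ → ℝ} {W : ℝ → ℝ → ℝ}

/-- The even part in `τ` of the Taylor remainder of `v`, multiplied by a family `W`. -/
noncomputable def symmGap (v : ℝ → ℝ) (W : ℝ → ℝ → ℝ) (τ s : ℝ) : ℝ :=
  (taylorGap v τ s * W τ s + taylorGap v (-τ) s * W (-τ) s) / 2

theorem HolderC2.abs_taylorGap_le_gapOrder (ha0 : 0 < a) (ha1 : a ≤ 1) (hv : HolderC2 a N v)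
    (τ s : ℝ) : |taylorGap v τ s| ≤ 2 * N * gapOrder a τ := by
  have hN := hv.nonneg
  rcases le_total |τ| 1 with h | h
  · have h1 := mul_le_mul_of_nonneg_left (sq_le_gapOrder ha1 h) hN
    have h2 := mul_nonneg hN (gapOrder_nonneg a τ)
    linarith [hv.abs_taylorGap_le_sq τ s]
  · rw [gapOrder_of_one_le ha0 h]; exact hv.abs_taylorGap_le τ s

theorem HolderC2.abs_deriv_taylorGap_le_gapOrder (ha0 : 0 < a) (hv : HolderC2 a N v)
    (τ s : ℝ) : |taylorGap (deriv v) τ s| ≤ 2 * N * gapOrder a τ := by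
  have hN := hv.nonneg
  rw [gapOrder, mul_min_of_nonneg _ _ (by positivity)]
  refine le_min ?_ (hv.abs_deriv_taylorGap_le τ s)
  have : 0 ≤ N * |τ| ^ (1 + a) := by positivity
  linarith [hv.abs_deriv_taylorGap_le_rpow ha0 τ s]

theorem hasDerivAt_symmGap (hv : HolderC2 a N v) (hW : HolderFamily a k W) (τ s : ℝ) :
    HasDerivAt (symmGap v W τ)
      ((taylorGap (deriv v) τ s * W τ s + taylorGap v τ s * deriv (W τ) s
        + (taylorGap (deriv v) (-τ) s * W (-τ) s
          + taylorGap v (-τ) s * deriv (W (-τ)) s)) / 2) s :=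
  (((hv.hasDerivAt_taylorGap τ s).fun_mul ((hW.holderC1 τ).diff s).hasDerivAt).fun_add
    ((hv.hasDerivAt_taylorGap (-τ) s).fun_mul
      ((hW.holderC1 (-τ)).diff s).hasDerivAt)).div_const 2

theorem gapOrder_neg (a τ : ℝ) : gapOrder a (-τ) = gapOrder a τ := by simp [gapOrder]

theorem abs_symmGap_le (ha0 : 0 < a) (ha1 : a ≤ 1) (hv : HolderC2 a N v)
    (hW : HolderFamily a k W) (τ s : ℝ) :
    |symmGap v W τ s| ≤ N * k * (12 * gapOrder a τ) := by
  have hN := hv.nonneg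
  have hk := hW.nonneg
  have hβ := gapOrder_nonneg a τ
  have key : ∀ τ' , gapOrder a τ' = gapOrder a τ →
      |taylorGap v τ' s * W τ' s| ≤ 2 * N * gapOrder a τ * k := fun τ' h => by
    rw [abs_mul, ← h]
    exact mul_le_mul (hv.abs_taylorGap_le_gapOrder ha0 ha1 τ' s) ((hW.holderC1 τ').bound s)
      (abs_nonneg _) (mul_nonneg (by positivity) (gapOrder_nonneg a τ'))
  rw [symmGap, abs_div, abs_two]
  have h1 := key τ rfl
  have h2 := key (-τ) (gapOrder_neg a τ)
  have h3 := abs_add_le (taylorGap v τ s * W τ s) (taylorGap v (-τ) s * W (-τ) s)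
  have h4 : 0 ≤ N * gapOrder a τ * k := by positivity
  linarith

theorem abs_deriv_symmGap_le (ha0 : 0 < a) (ha1 : a ≤ 1) (hv : HolderC2 a N v)
    (hW : HolderFamily a k W) (τ s : ℝ) :
    |deriv (symmGap v W τ) s| ≤ N * k * (12 * gapOrder a τ) := by
  have hN := hv.nonneg
  have hk := hW.nonneg
  have hβ := gapOrder_nonneg a τ
  have key : ∀ τ' , gapOrder a τ' = gapOrder a τ →
      |taylorGap (deriv v) τ' s * W τ' s + taylorGap v τ' s * deriv (W τ') s|
        ≤ 4 * N * gapOrder a τ * k := fun τ' h => by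
    refine (abs_add_le _ _).trans ?_
    rw [abs_mul, abs_mul, ← h]
    have h0 : 0 ≤ 2 * N * gapOrder a τ' := mul_nonneg (by positivity) (gapOrder_nonneg a τ')
    have h1 := mul_le_mul (hv.abs_taylorGap_le_gapOrder ha0 ha1 τ' s)
      ((hW.holderC1 τ').deriv_bound s) (abs_nonneg _) h0
    have h2 := mul_le_mul (hv.abs_deriv_taylorGap_le_gapOrder ha0 τ' s)
      ((hW.holderC1 τ').bound s) (abs_nonneg _) h0
    linarith
  rw [(hasDerivAt_symmGap hv hW τ s).deriv, abs_div, abs_two]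
  have h1 := key τ rfl
  have h2 := key (-τ) (gapOrder_neg a τ)
  have h3 := abs_add_le (taylorGap (deriv v) τ s * W τ s + taylorGap v τ s * deriv (W τ) s)
    (taylorGap (deriv v) (-τ) s * W (-τ) s + taylorGap v (-τ) s * deriv (W (-τ)) s)
  have h4 : 0 ≤ N * gapOrder a τ * k := by positivity
  linarith

/-- The increments of the derivative of `symmGap` consist of a part of order
`gapOrder a τ * |s - t| ^ a` and of the increments of a second difference, which are estimated in
two ways.  Only the latter part is not integrable against the kernel uniformly in `|s - t|`. -/
theorem abs_deriv_symmGap_sub_le (ha0 : 0 < a) (ha1 : a ≤ 1) (hv : HolderC2 a N v)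
    (hW : HolderFamily a k W) (τ s t : ℝ) :
    |deriv (symmGap v W τ) s - deriv (symmGap v W τ) t| ≤
      N * k * (12 * gapOrder a τ * |s - t| ^ a
        + 2 * min (|τ| ^ (1 + a)) (|s - t| * |τ| ^ a)) := by
  have hN := hv.nonneg
  have hk := hW.nonneg
  have hβ := gapOrder_nonneg a τ
  have hr : (0 : ℝ) ≤ |s - t| ^ a := by positivity
  have hlow : ∀ τ', gapOrder a τ' = gapOrder a τ →
      |taylorGap (deriv v) τ' t * (W τ' s - W τ' t)
        + ((taylorGap v τ' s - taylorGap v τ' t) * deriv (W τ') s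
          + taylorGap v τ' t * (deriv (W τ') s - deriv (W τ') t))|
        ≤ 10 * (N * k * gapOrder a τ * |s - t| ^ a) := fun τ' h => by
    have hβ' : 0 ≤ 2 * N * gapOrder a τ := by positivity
    refine (abs_add_le _ _).trans ((add_le_add_right (abs_add_le _ _) _).trans ?_)
    rw [abs_mul, abs_mul, abs_mul]
    have b1 := hv.abs_deriv_taylorGap_le_gapOrder ha0 τ' t
    have b2 := hv.abs_taylorGap_le_gapOrder ha0 ha1 τ' t
    have b3 : |taylorGap v τ' s - taylorGap v τ' t| ≤ 4 * N * gapOrder a τ * |s - t| ^ a := by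
      refine abs_sub_le_mul_rpow (M := 2 * N * gapOrder a τ) ha0 ha1 (by positivity)
        (fun s => ?_) (by linarith) (fun s t => ?_) s t
      · rw [← h]; exact hv.abs_taylorGap_le_gapOrder ha0 ha1 τ' s
      · refine (abs_sub_le_of_deriv_bound (M := 2 * N * gapOrder a τ)
          (fun s => (hv.hasDerivAt_taylorGap τ' s).differentiableAt) (fun s => ?_) s t).trans ?_
        · rw [(hv.hasDerivAt_taylorGap τ' s).deriv, ← h]
          exact hv.abs_deriv_taylorGap_le_gapOrder ha0 τ' s
        · exact mul_le_mul_of_nonneg_right (by linarith) (abs_nonneg _)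
    rw [h] at b1 b2
    have c1 := mul_le_mul b1 ((hW.holderC1 τ').abs_sub_le_rpow ha0 ha1 s t) (abs_nonneg _) hβ'
    have c2 := mul_le_mul b2 ((hW.holderC1 τ').holder s t) (abs_nonneg _) hβ'
    have c3 := mul_le_mul b3 ((hW.holderC1 τ').deriv_bound s) (abs_nonneg _) (by positivity)
    linarith
  have hsym : |(taylorGap (deriv v) τ s + taylorGap (deriv v) (-τ) s)
      - (taylorGap (deriv v) τ t + taylorGap (deriv v) (-τ) t)|
      ≤ 4 * N * min (|τ| ^ (1 + a)) (|s - t| * |τ| ^ a) := by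
    rw [mul_min_of_nonneg _ _ (by positivity)]
    refine le_min ?_ ?_
    · have g : ∀ x, |taylorGap (deriv v) τ x + taylorGap (deriv v) (-τ) x|
          ≤ 2 * N * |τ| ^ (1 + a) := fun x => by
        have h1 := hv.abs_deriv_taylorGap_le_rpow ha0 τ x
        have h2 := hv.abs_deriv_taylorGap_le_rpow ha0 (-τ) x
        rw [abs_neg] at h2
        exact (abs_add_le _ _).trans (by linarith)
      exact (abs_sub _ _).trans (by linarith [g s, g t])
    · have h1 := hv.abs_secondDiff_sub_le τ s t
      have h2 : 0 ≤ N * |τ| ^ a * |s - t| := by positivity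
      linarith
  have hodd : |(taylorGap (deriv v) (-τ) s - taylorGap (deriv v) (-τ) t) * (W (-τ) s - W τ s)|
      ≤ 4 * (N * k * gapOrder a τ * |s - t| ^ a) := by
    rw [abs_mul]
    have h1 := hv.abs_deriv_taylorGap_sub_le (-τ) s t
    rw [abs_neg] at h1
    have h2 : |W (-τ) s - W τ s| * |τ| ≤ 2 * k * gapOrder a τ := by
      rcases le_total |τ| 1 with h | h
      · have h3 := hW.odd_bound τ s
        rw [abs_sub_comm] at h3
        have h4 := mul_le_mul_of_nonneg_right h3 (abs_nonneg τ)
        have h5 := mul_le_mul_of_nonneg_left (sq_le_gapOrder ha1 h) hk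
        rw [mul_assoc, ← sq, sq_abs] at h4
        have : 0 ≤ k * gapOrder a τ := by positivity
        linarith
      · rw [gapOrder_of_one_le ha0 h]
        refine mul_le_mul_of_nonneg_right ((abs_sub _ _).trans ?_) (abs_nonneg _)
        linarith [(hW.holderC1 τ).bound s, (hW.holderC1 (-τ)).bound s]
    have h3 := mul_le_mul_of_nonneg_right h1 (abs_nonneg (W (-τ) s - W τ s))
    have h4 := mul_le_mul_of_nonneg_left h2 (by positivity : 0 ≤ 2 * N * |s - t| ^ a)
    linarith
  have h1 := hlow τ rfl
  have h2 := hlow (-τ) (gapOrder_neg a τ)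
  have h3 := mul_le_mul hsym ((hW.holderC1 τ).bound s) (abs_nonneg _) (by positivity)
  rw [← abs_mul] at h3
  rw [(hasDerivAt_symmGap hv hW τ s).deriv, (hasDerivAt_symmGap hv hW τ t).deriv, ← sub_div,
    abs_div, abs_two, div_le_iff₀ two_pos]
  refine le_trans (le_of_eq (congrArg abs ?_))
    (((abs_add_le _ _).trans (add_le_add (abs_add_le _ _) (abs_add_le _ _))).trans
      ((add_le_add (add_le_add h1 h2) (add_le_add h3 hodd)).trans (le_of_eq ?_)))
  · ring
  · ring

end

/-! ### The kernel of the cylinder -/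

/-- The squared distance `τ² + 2 lam² (1 - cos θ)` of two points of the cylinder of radius `lam`
whose heights differ by `τ` and whose angles differ by `θ`. -/
noncomputable def cylDistSq (lam : ℝ) (q : ℝ × ℝ) : ℝ :=
  q.1 ^ 2 + 2 * lam ^ 2 * (1 - Real.cos q.2)

/-- The kernel `|x - y|⁻³` on the cylinder. -/
noncomputable def cylKernel (lam : ℝ) (q : ℝ × ℝ) : ℝ := cylDistSq lam q ^ (-(3 / 2) : ℝ)

/-- Lebesgue measure on the strip `ℝ × (-π, π]` of the parameters `(τ, θ)`. -/
noncomputable def strip : Measure (ℝ × ℝ) :=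
  (volume : Measure (ℝ × ℝ)).restrict (Set.univ ×ˢ Set.Ioc (-π) π)

theorem strip_eq_prod :
    strip = (volume : Measure ℝ).prod ((volume : Measure ℝ).restrict (Set.Ioc (-π) π)) := by
  rw [strip, Measure.volume_eq_prod, ← Measure.prod_restrict, Measure.restrict_univ]

instance : SFinite strip := by rw [strip]; infer_instance

theorem measurable_cylDistSq (lam : ℝ) : Measurable (cylDistSq lam) := by
  unfold cylDistSq; fun_prop

theorem measurable_cylKernel (lam : ℝ) : Measurable (cylKernel lam) :=
  (measurable_cylDistSq lam).pow_const _

theorem cylDistSq_nonneg (lam : ℝ) (q : ℝ × ℝ) : 0 ≤ cylDistSq lam q := by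
  have := Real.cos_le_one q.2
  unfold cylDistSq
  have : 0 ≤ 2 * lam ^ 2 * (1 - Real.cos q.2) := mul_nonneg (by positivity) (by linarith)
  positivity

theorem cylKernel_nonneg (lam : ℝ) (q : ℝ × ℝ) : 0 ≤ cylKernel lam q :=
  Real.rpow_nonneg (cylDistSq_nonneg lam q) _

theorem sq_le_cylDistSq (lam : ℝ) (q : ℝ × ℝ) : q.1 ^ 2 ≤ cylDistSq lam q := by
  have := Real.cos_le_one q.2
  have : 0 ≤ 2 * lam ^ 2 * (1 - Real.cos q.2) := mul_nonneg (by positivity) (by linarith)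
  unfold cylDistSq; linarith

theorem one_sub_cos_le_cylDistSq (lam : ℝ) (q : ℝ × ℝ) :
    2 * lam ^ 2 * (1 - Real.cos q.2) ≤ cylDistSq lam q := by
  unfold cylDistSq; nlinarith [sq_nonneg q.1]

theorem cylDistSq_neg (lam τ θ : ℝ) : cylDistSq lam (-τ, θ) = cylDistSq lam (τ, θ) := by
  simp [cylDistSq]

theorem cylKernel_neg (lam τ θ : ℝ) : cylKernel lam (-τ, θ) = cylKernel lam (τ, θ) := by
  rw [cylKernel, cylDistSq_neg, cylKernel]

theorem sq_rpow_eq_abs_rpow (τ p : ℝ) : (τ ^ 2) ^ p = |τ| ^ (2 * p) := by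
  rw [← sq_abs, ← Real.rpow_two, ← Real.rpow_mul (abs_nonneg _)]

theorem cylKernel_le_of_ne_zero (lam : ℝ) {τ : ℝ} (hτ : τ ≠ 0) (θ : ℝ) :
    cylKernel lam (τ, θ) ≤ |τ| ^ (-3 : ℝ) := by
  have := Real.rpow_le_rpow_of_nonpos (z := -(3 / 2)) (by positivity : 0 < τ ^ 2)
    (sq_le_cylDistSq lam (τ, θ)) (by norm_num)
  rwa [sq_rpow_eq_abs_rpow, show 2 * (-(3 / 2) : ℝ) = -3 by norm_num] at this

theorem continuous_cylKernel_of_ne_zero (lam : ℝ) {τ : ℝ} (hτ : τ ≠ 0) :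
    Continuous (fun θ => cylKernel lam (τ, θ)) := by
  unfold cylKernel
  refine Continuous.rpow_const (by unfold cylDistSq; fun_prop) fun θ => Or.inl ?_
  have := sq_le_cylDistSq lam (τ, θ)
  have h : 0 < τ ^ 2 := by positivity
  exact (h.trans_le this).ne'

/-- The integral of the kernel over a circle at height difference `τ` is `O(τ⁻²)`. -/
theorem integral_cylKernel_le {lam : ℝ} (hlam : 0 < lam) {τ : ℝ} (hτ : τ ≠ 0) :
    ∫ θ in Set.Ioc (-π) π, cylKernel lam (τ, θ) ≤ π / lam * |τ| ^ (-2 : ℝ) := by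
  have hπ := Real.pi_pos
  set c : ℝ := 4 * lam ^ 2 / π ^ 2 with hc
  have hc0 : 0 < c := by positivity
  have hτ2 : 0 < τ ^ 2 := by positivity
  have hpos : ∀ θ : ℝ, 0 < τ ^ 2 + c * θ ^ 2 := fun θ => by positivity
  have hcont : Continuous fun θ : ℝ => (τ ^ 2 + c * θ ^ 2) ^ (-(3 / 2) : ℝ) :=
    Continuous.rpow_const (by fun_prop) fun θ => Or.inl (hpos θ).ne'
  have hle : ∀ θ ∈ Set.Icc (-π) π,
      cylKernel lam (τ, θ) ≤ (τ ^ 2 + c * θ ^ 2) ^ (-(3 / 2) : ℝ) := fun θ hθ => by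
    refine Real.rpow_le_rpow_of_nonpos (hpos θ) ?_ (by norm_num)
    have h1 := Real.cos_le_one_sub_mul_cos_sq (x := θ) (abs_le.2 hθ)
    have h2 : 2 * lam ^ 2 * (2 / π ^ 2 * θ ^ 2) ≤ 2 * lam ^ 2 * (1 - Real.cos θ) :=
      mul_le_mul_of_nonneg_left (by linarith) (by positivity)
    have h3 : c * θ ^ 2 = 2 * lam ^ 2 * (2 / π ^ 2 * θ ^ 2) := by rw [hc]; ring
    unfold cylDistSq
    simp only
    linarith
  -- an antiderivative of the majorant is `θ / (τ² √(τ² + c θ²))`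
  have hderiv : ∀ θ : ℝ, HasDerivAt (fun θ => θ * (τ ^ 2 + c * θ ^ 2) ^ (-(1 / 2) : ℝ) / τ ^ 2)
      ((τ ^ 2 + c * θ ^ 2) ^ (-(3 / 2) : ℝ)) θ := fun θ => by
    have h0 : HasDerivAt (fun θ : ℝ => τ ^ 2 + c * θ ^ 2) (c * (2 * θ)) θ := by
      have := ((hasDerivAt_pow 2 θ).const_mul c).const_add (τ ^ 2)
      simpa using this
    have h1 := ((hasDerivAt_id' θ).fun_mul (h0.rpow_const (p := -(1 / 2)) (Or.inl (hpos θ).ne'))).div_const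
      (τ ^ 2)
    refine h1.congr_deriv ?_
    have e1 : (τ ^ 2 + c * θ ^ 2) ^ (-(1 / 2) : ℝ)
        = (τ ^ 2 + c * θ ^ 2) ^ (-(3 / 2) : ℝ) * (τ ^ 2 + c * θ ^ 2) := by
      rw [← Real.rpow_add_one (hpos θ).ne']; norm_num
    have e2 : (-(1 / 2) - 1 : ℝ) = -(3 / 2) := by norm_num
    rw [e2, e1, div_eq_iff hτ2.ne']
    ring
  have hint : ∫ θ in (-π)..π, (τ ^ 2 + c * θ ^ 2) ^ (-(3 / 2) : ℝ)
      = 2 * (π * (τ ^ 2 + c * π ^ 2) ^ (-(1 / 2) : ℝ) / τ ^ 2) := by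
    rw [intervalIntegral.integral_eq_sub_of_hasDerivAt (fun θ _ => hderiv θ)
      (hcont.intervalIntegrable _ _), neg_sq]
    ring
  rw [← intervalIntegral.integral_of_le (by linarith)]
  refine (intervalIntegral.integral_mono_on (by linarith)
    ((continuous_cylKernel_of_ne_zero lam hτ).intervalIntegrable _ _)
    (hcont.intervalIntegrable _ _) hle).trans ?_
  rw [hint]
  have h1 : (τ ^ 2 + c * π ^ 2) ^ (-(1 / 2) : ℝ) ≤ (2 * lam)⁻¹ := by
    have e : c * π ^ 2 = (2 * lam) ^ 2 := by rw [hc]; field_simp; ring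
    have h2 := Real.rpow_le_rpow_of_nonpos (z := -(1 / 2)) (by positivity : 0 < (2 * lam) ^ 2)
      (by rw [e]; linarith : (2 * lam) ^ 2 ≤ τ ^ 2 + c * π ^ 2) (by norm_num)
    refine h2.trans (le_of_eq ?_)
    rw [sq_rpow_eq_abs_rpow, abs_of_pos (by positivity)]
    rw [show 2 * (-(1 / 2) : ℝ) = -1 by norm_num, Real.rpow_neg_one]
  have h2 : |τ| ^ (-2 : ℝ) = (τ ^ 2)⁻¹ := by
    rw [Real.rpow_neg (abs_nonneg _), Real.rpow_two, sq_abs]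
  rw [h2]
  calc 2 * (π * (τ ^ 2 + c * π ^ 2) ^ (-(1 / 2) : ℝ) / τ ^ 2)
      ≤ 2 * (π * (2 * lam)⁻¹ / τ ^ 2) := by gcongr
    _ = π / lam * (τ ^ 2)⁻¹ := by field_simp

/-- The decay in `τ` of the kernel integrated over the angle: `min (|τ| ^ (-2)) (|τ| ^ (-3))`. -/
noncomputable def kernelDecay (τ : ℝ) : ℝ := min (|τ| ^ (-2 : ℝ)) (|τ| ^ (-3 : ℝ))

theorem kernelDecay_nonneg (τ : ℝ) : 0 ≤ kernelDecay τ := le_min (by positivity) (by positivity)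

theorem integral_cylKernel_le_kernelDecay {lam : ℝ} (hlam : 0 < lam) {τ : ℝ} (hτ : τ ≠ 0) :
    ∫ θ in Set.Ioc (-π) π, cylKernel lam (τ, θ) ≤ (π / lam + 2 * π) * kernelDecay τ := by
  have hπ := Real.pi_pos
  rw [kernelDecay, mul_min_of_nonneg _ _ (by positivity)]
  refine le_min ((integral_cylKernel_le hlam hτ).trans ?_) ?_
  · have : 0 ≤ 2 * π * |τ| ^ (-2 : ℝ) := by positivity
    linarith
  · have h1 : ∫ θ in Set.Ioc (-π) π, cylKernel lam (τ, θ)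
        ≤ ∫ θ in Set.Ioc (-π) π, |τ| ^ (-3 : ℝ) :=
      integral_mono_of_nonneg (Eventually.of_forall fun θ => cylKernel_nonneg _ _)
        (integrable_const _) (Eventually.of_forall fun θ => cylKernel_le_of_ne_zero lam hτ θ)
    refine h1.trans ?_
    have h2 : 0 ≤ π / lam * |τ| ^ (-3 : ℝ) := by positivity
    simp only [integral_const, MeasurableSet.univ, measureReal_restrict_apply, Set.univ_inter,
      smul_eq_mul, Real.volume_real_Ioc, sub_neg_eq_add]
    rw [max_eq_left (by linarith)]
    linarith

/-- Integration of a function of `τ` against the kernel. -/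
theorem integrable_mul_cylKernel {lam : ℝ} (hlam : 0 < lam) {f : ℝ → ℝ} (hf : Measurable f)
    (hf0 : ∀ τ, 0 ≤ f τ) (hint : Integrable (fun τ => f τ * kernelDecay τ)) :
    Integrable (fun q : ℝ × ℝ => f q.1 * cylKernel lam q) strip ∧
      ∫ q, f q.1 * cylKernel lam q ∂strip
        ≤ (π / lam + 2 * π) * ∫ τ, f τ * kernelDecay τ := by
  have hm : AEStronglyMeasurable (fun q : ℝ × ℝ => f q.1 * cylKernel lam q)
      ((volume : Measure ℝ).prod ((volume : Measure ℝ).restrict (Set.Ioc (-π) π))) :=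
    ((hf.comp measurable_fst).mul (measurable_cylKernel lam)).aestronglyMeasurable
  have hne : ∀ᵐ τ : ℝ, τ ≠ 0 := by simp [ae_iff, measure_singleton]
  have hle : ∀ᵐ τ : ℝ, ‖∫ θ in Set.Ioc (-π) π, ‖f τ * cylKernel lam (τ, θ)‖‖
      ≤ (π / lam + 2 * π) * (f τ * kernelDecay τ) := by
    filter_upwards [hne] with τ hτ
    rw [Real.norm_of_nonneg (integral_nonneg fun _ => norm_nonneg _)]
    simp only [norm_mul, Real.norm_of_nonneg (hf0 τ), Real.norm_of_nonneg (cylKernel_nonneg _ _)]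
    rw [integral_const_mul]
    have := mul_le_mul_of_nonneg_left (integral_cylKernel_le_kernelDecay hlam hτ) (hf0 τ)
    linarith
  have hi : Integrable (fun q : ℝ × ℝ => f q.1 * cylKernel lam q) strip := by
    rw [strip_eq_prod, integrable_prod_iff hm]
    refine ⟨?_, ?_⟩
    · filter_upwards [hne] with τ hτ
      exact (((continuous_cylKernel_of_ne_zero lam hτ).integrableOn_Icc).mono_set
        Set.Ioc_subset_Icc_self).const_mul (f τ)
    · exact (hint.const_mul _).mono' hm.norm.integral_prod_right' hle
  refine ⟨hi, ?_⟩
  rw [strip_eq_prod] at hi ⊢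
  rw [integral_prod _ hi, ← integral_const_mul]
  refine integral_mono_ae hi.integral_prod_left (hint.const_mul _) ?_
  filter_upwards [hle] with τ hτ
  refine ((Real.le_norm_self _).trans (norm_integral_le_integral_norm _)).trans ?_
  exact (le_abs_self _).trans hτ

theorem integrable_comp_abs_of_integrableOn_Ioi {f : ℝ → ℝ}
    (hf : IntegrableOn f (Set.Ioi 0)) : Integrable (fun τ => f |τ|) := by
  have h1 : IntegrableOn (fun τ => f |τ|) (Set.Ioi 0) :=
    hf.congr_fun (fun x hx => by simp [abs_of_pos (Set.mem_Ioi.1 hx)]) measurableSet_Ioi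
  have h2 : IntegrableOn (fun τ => f |τ|) (Set.Iic 0) := by
    have : IntegrableOn (fun τ => f |τ|) (Set.Ici 0) := Iff.mpr integrableOn_Ici_iff_integrableOn_Ioi h1
    rw [← neg_zero] at this
    simpa using this.comp_neg_Iic
  rw [← integrableOn_univ, ← Set.Iic_union_Ioi (a := (0 : ℝ))]
  exact h2.union h1

/-- A function that is a power of `|τ|` near the origin, and another one away from it. -/
theorem integrable_piecewise_rpow {p r δ K : ℝ} (hp : -1 < p) (hr : r < -1) (hδ : 0 < δ) :
    Integrable (fun τ : ℝ => if |τ| ≤ δ then |τ| ^ p else K * |τ| ^ r) ∧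
      ∫ τ : ℝ, (if |τ| ≤ δ then |τ| ^ p else K * |τ| ^ r)
        = 2 * (δ ^ (p + 1) / (p + 1) + K * (-δ ^ (r + 1) / (r + 1))) := by
  have h1 : IntegrableOn (fun τ : ℝ => if τ ≤ δ then τ ^ p else K * τ ^ r) (Set.Ioc 0 δ) := by
    refine IntegrableOn.congr_fun ((intervalIntegrable_iff_integrableOn_Ioc_of_le hδ.le).1
      (intervalIntegral.intervalIntegrable_rpow' hp)) (fun x hx => ?_) measurableSet_Ioc
    simp [hx.2]
  have h2 : IntegrableOn (fun τ : ℝ => if τ ≤ δ then τ ^ p else K * τ ^ r) (Set.Ioi δ) := by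
    refine IntegrableOn.congr_fun ((integrableOn_Ioi_rpow_of_lt hr hδ).const_mul K)
      (fun x hx => ?_) measurableSet_Ioi
    simp [not_le.2 (Set.mem_Ioi.1 hx)]
  have h3 : IntegrableOn (fun τ : ℝ => if τ ≤ δ then τ ^ p else K * τ ^ r) (Set.Ioi 0) := by
    rw [← Set.Ioc_union_Ioi_eq_Ioi hδ.le]; exact h1.union h2
  refine ⟨integrable_comp_abs_of_integrableOn_Ioi h3, ?_⟩
  rw [integral_comp_abs (f := fun τ : ℝ => if τ ≤ δ then τ ^ p else K * τ ^ r),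
    ← Set.Ioc_union_Ioi_eq_Ioi hδ.le,
    setIntegral_union (Set.Ioc_disjoint_Ioi le_rfl) measurableSet_Ioi h1 h2]
  congr 2
  · rw [setIntegral_congr_fun (g := fun τ => τ ^ p) measurableSet_Ioc
      (fun x hx => by simp [hx.2]), ← intervalIntegral.integral_of_le hδ.le,
      integral_rpow (Or.inl hp), Real.zero_rpow (by linarith), sub_zero]
  · rw [setIntegral_congr_fun (g := fun τ => K * τ ^ r) measurableSet_Ioi
      (fun x hx => by simp [not_le.2 (Set.mem_Ioi.1 hx)]), integral_const_mul,
      integral_Ioi_rpow_of_lt hr hδ]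

theorem abs_rpow_mul_abs_rpow {τ p r : ℝ} (h : p + r ≠ 0) : |τ| ^ p * |τ| ^ r = |τ| ^ (p + r) :=
  (Real.rpow_add' (abs_nonneg τ) h).symm

theorem measurable_gapOrder (a : ℝ) : Measurable (gapOrder a) :=
  (measurable_norm.pow_const _).min measurable_norm

theorem measurable_kernelDecay : Measurable kernelDecay :=
  (measurable_norm.pow_const _).min (measurable_norm.pow_const _)

theorem integrable_gapOrder_mul_kernelDecay {a : ℝ} (ha0 : 0 < a) (ha1 : a < 1) :
    Integrable (fun τ => gapOrder a τ * kernelDecay τ) := by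
  refine (integrable_piecewise_rpow (p := a - 1) (r := -2) (δ := 1) (K := 1)
    (by linarith) (by norm_num) one_pos).1.mono'
    ((measurable_gapOrder a).mul measurable_kernelDecay).aestronglyMeasurable
    (Eventually.of_forall fun τ => ?_)
  rw [Real.norm_of_nonneg (mul_nonneg (gapOrder_nonneg a τ) (kernelDecay_nonneg τ))]
  split_ifs with h
  · refine (mul_le_mul (min_le_left _ _) (min_le_left _ _) (kernelDecay_nonneg τ)
      (by positivity)).trans (le_of_eq ?_)
    rw [abs_rpow_mul_abs_rpow (by linarith)]
    congr 1; ring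
  · refine (mul_le_mul (min_le_right _ _) (min_le_right _ _) (kernelDecay_nonneg τ)
      (by positivity)).trans (le_of_eq ?_)
    nth_rw 1 [← Real.rpow_one |τ|]
    rw [abs_rpow_mul_abs_rpow (by norm_num), one_mul]
    norm_num

/-- The logarithmic divergence at the origin is avoided since the exponents `a` and `a - 1` of the
two bounds lie on both sides of the critical one. -/
theorem integrable_min_mul_kernelDecay {a δ : ℝ} (ha0 : 0 < a) (ha1 : a < 1) (hδ : 0 < δ) :
    Integrable (fun τ => min (|τ| ^ (1 + a)) (δ * |τ| ^ a) * kernelDecay τ) ∧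
      ∫ τ, min (|τ| ^ (1 + a)) (δ * |τ| ^ a) * kernelDecay τ
        ≤ 2 * (1 / a + 1 / (1 - a)) * δ ^ a := by
  have hp := integrable_piecewise_rpow (p := a - 1) (r := a - 2) (δ := δ) (K := δ)
    (by linarith) (by linarith) hδ
  have hn : ∀ τ : ℝ, 0 ≤ min (|τ| ^ (1 + a)) (δ * |τ| ^ a) * kernelDecay τ := fun τ =>
    mul_nonneg (le_min (by positivity) (by positivity)) (kernelDecay_nonneg τ)
  have hle : ∀ τ : ℝ, min (|τ| ^ (1 + a)) (δ * |τ| ^ a) * kernelDecay τ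
      ≤ if |τ| ≤ δ then |τ| ^ (a - 1) else δ * |τ| ^ (a - 2) := fun τ => by
    split_ifs with h
    · refine (mul_le_mul (min_le_left _ _) (min_le_left _ _) (kernelDecay_nonneg τ)
        (by positivity)).trans (le_of_eq ?_)
      rw [abs_rpow_mul_abs_rpow (by linarith)]
      congr 1; ring
    · refine (mul_le_mul (min_le_right _ _) (min_le_left _ _) (kernelDecay_nonneg τ)
        (by positivity)).trans (le_of_eq ?_)
      rw [mul_assoc, abs_rpow_mul_abs_rpow (by linarith)]
      congr 2
  have hi : Integrable (fun τ => min (|τ| ^ (1 + a)) (δ * |τ| ^ a) * kernelDecay τ) := by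
    refine hp.1.mono' (Measurable.aestronglyMeasurable ?_)
      (Eventually.of_forall fun τ => by rw [Real.norm_of_nonneg (hn τ)]; exact hle τ)
    exact (((measurable_norm.pow_const _).min ((measurable_norm.pow_const _).const_mul δ))).mul
      measurable_kernelDecay
  refine ⟨hi, (integral_mono hi hp.1 hle).trans (le_of_eq ?_)⟩
  rw [hp.2]
  have e1 : δ * (-δ ^ (a - 2 + 1) / (a - 2 + 1)) = δ ^ a / (1 - a) := by
    have : δ ^ a = δ * δ ^ (a - 2 + 1) := by
      nth_rw 2 [← Real.rpow_one δ]
      rw [← Real.rpow_add hδ]; congr 1; ring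
    rw [this]
    have h1 : a - 2 + 1 ≠ 0 := by linarith
    have h2 : 1 - a ≠ 0 := by linarith
    rw [mul_div_assoc', div_eq_div_iff h1 h2]; ring
  rw [e1, sub_add_cancel]
  ring

theorem measurePreserving_neg_strip :
    MeasurePreserving (fun q : ℝ × ℝ => (-q.1, q.2)) strip strip := by
  rw [strip_eq_prod]
  exact (Measure.measurePreserving_neg (volume : Measure ℝ)).prod (MeasurePreserving.id _)

theorem integral_strip_comp_neg (f : ℝ × ℝ → ℝ) :
    ∫ q, f (-q.1, q.2) ∂strip = ∫ q, f q ∂strip := by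
  have hme : MeasurableEmbedding (fun q : ℝ × ℝ => (-q.1, q.2)) :=
    ((Homeomorph.neg ℝ).prodCongr (Homeomorph.refl ℝ)).measurableEmbedding
  exact measurePreserving_neg_strip.integral_comp hme f

theorem integrable_strip_comp_neg {f : ℝ × ℝ → ℝ} (hf : Integrable f strip) :
    Integrable (fun q : ℝ × ℝ => f (-q.1, q.2)) strip :=
  measurePreserving_neg_strip.integrable_comp_of_integrable hf

section
variable {a N k lam : ℝ} {v : ℝ → ℝ} {W : ℝ → ℝ → ℝ → ℝ}

theorem HolderC2.measurable_taylorGap (hv : HolderC2 a N v) (s : ℝ) :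
    Measurable fun τ => taylorGap v τ s := by
  have := hv.diff.continuous
  unfold taylorGap
  exact Continuous.measurable (by fun_prop)

theorem integrable_gapOrder_mul_cylKernel (hlam : 0 < lam) (ha0 : 0 < a) (ha1 : a < 1) :
    Integrable (fun q : ℝ × ℝ => gapOrder a q.1 * cylKernel lam q) strip :=
  (integrable_mul_cylKernel hlam (measurable_gapOrder a) (gapOrder_nonneg a)
    (integrable_gapOrder_mul_kernelDecay ha0 ha1)).1

theorem HolderC2.integrable_taylorGap (hlam : 0 < lam) (ha0 : 0 < a) (ha1 : a < 1)
    (hv : HolderC2 a N v) (hW : ∀ θ, HolderFamily a k (W θ))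
    (hWm : ∀ s, Measurable fun q : ℝ × ℝ => W q.2 q.1 s) (s : ℝ) :
    Integrable (fun q : ℝ × ℝ => taylorGap v q.1 s * W q.2 q.1 s * cylKernel lam q) strip := by
  refine ((integrable_gapOrder_mul_cylKernel hlam ha0 ha1).const_mul (2 * N * k)).mono'
    ((((hv.measurable_taylorGap s).comp measurable_fst).mul (hWm s)).mul
      (measurable_cylKernel lam)).aestronglyMeasurable (Eventually.of_forall fun q => ?_)
  rw [norm_mul, norm_mul, Real.norm_of_nonneg (cylKernel_nonneg lam q), ← mul_assoc]
  refine mul_le_mul_of_nonneg_right ?_ (cylKernel_nonneg lam q)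
  have h1 := mul_le_mul (hv.abs_taylorGap_le_gapOrder ha0 ha1.le q.1 s)
    (((hW q.2).holderC1 q.1).bound s) (abs_nonneg _)
    (mul_nonneg (by linarith [hv.nonneg]) (gapOrder_nonneg a q.1))
  rw [Real.norm_eq_abs, Real.norm_eq_abs]
  linarith

/-- The singular integral operator with density `W`: it is bounded from `C^{2,a}` to `C^{1,a}`.  By
the symmetry of the kernel only the even part in `τ` of the integrand matters. -/
theorem exists_holderC1_integral_taylorGap (hlam : 0 < lam) (ha0 : 0 < a) (ha1 : a < 1) :
    ∃ C, 0 ≤ C ∧ ∀ (N k : ℝ) (v : ℝ → ℝ) (W : ℝ → ℝ → ℝ → ℝ), HolderC2 a N v →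
      (∀ θ, HolderFamily a k (W θ)) → (∀ s, Measurable fun q : ℝ × ℝ => W q.2 q.1 s) →
      HolderC1 a (C * (N * k))
        (fun s => ∫ q, taylorGap v q.1 s * W q.2 q.1 s * cylKernel lam q ∂strip) := by
  have hπ := Real.pi_pos
  set B := ∫ q : ℝ × ℝ, gapOrder a q.1 * cylKernel lam q ∂strip with hB
  have hB0 : 0 ≤ B := integral_nonneg fun q =>
    mul_nonneg (gapOrder_nonneg a _) (cylKernel_nonneg _ _)
  have hD0 : 0 ≤ 2 * (1 / a + 1 / (1 - a)) := by
    have : 0 < 1 - a := by linarith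
    positivity
  set D := (π / lam + 2 * π) * (2 * (1 / a + 1 / (1 - a))) with hD
  have hD0' : 0 ≤ D := mul_nonneg (by positivity) hD0
  refine ⟨12 * B + 2 * D, by positivity, fun N k v W hv hW hWm => ?_⟩
  have hN := hv.nonneg
  have hk := (hW 0).nonneg
  have hNk := mul_nonneg hN hk
  have hint := fun s => hv.integrable_taylorGap hlam ha0 ha1 hW hWm s
  -- only the part of the integrand that is even in `τ` contributes
  have hsymm : ∀ s, ∫ q, taylorGap v q.1 s * W q.2 q.1 s * cylKernel lam q ∂strip
      = ∫ q, cylKernel lam q * symmGap v (W q.2) q.1 s ∂strip := fun s => by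
    have h1 := integral_strip_comp_neg
      (fun q => taylorGap v q.1 s * W q.2 q.1 s * cylKernel lam q)
    have h2 := integral_add (hint s) (integrable_strip_comp_neg (hint s))
    rw [h1] at h2
    have h3 : ∫ q, taylorGap v q.1 s * W q.2 q.1 s * cylKernel lam q ∂strip
        = (∫ q, taylorGap v q.1 s * W q.2 q.1 s * cylKernel lam q
          + taylorGap v (-q.1) s * W q.2 (-q.1) s * cylKernel lam (-q.1, q.2) ∂strip) / 2 := by
      linarith
    rw [h3, ← integral_div]
    refine integral_congr_ae (Eventually.of_forall fun q => ?_)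
    simp only [symmGap, cylKernel_neg]
    ring
  have hmin := fun δ (hδ : 0 < δ) => integrable_mul_cylKernel hlam
    (f := fun τ => min (|τ| ^ (1 + a)) (δ * |τ| ^ a))
    ((measurable_norm.pow_const _).min ((measurable_norm.pow_const _).const_mul δ))
    (fun τ => le_min (by positivity) (by positivity)) (integrable_min_mul_kernelDecay ha0 ha1 hδ).1
  have hβi := integrable_gapOrder_mul_cylKernel hlam ha0 ha1
  refine HolderC1.congr ?_ hsymm
  have hdiff : ∀ q : ℝ × ℝ, Differentiable ℝ (symmGap v (W q.2) q.1) := fun q s =>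
    (hasDerivAt_symmGap hv (hW q.2) q.1 s).differentiableAt
  have hderiv : ∀ (q : ℝ × ℝ) s, deriv (fun s => cylKernel lam q * symmGap v (W q.2) q.1 s) s
      = cylKernel lam q * deriv (symmGap v (W q.2) q.1) s := fun q s => by simp
  refine holderC1_integral
    (b := fun q => N * k * (12 * (gapOrder a q.1 * cylKernel lam q)))
    (h := fun δ q => N * k * (12 * δ ^ a * (gapOrder a q.1 * cylKernel lam q)
      + 2 * (min (|q.1| ^ (1 + a)) (δ * |q.1| ^ a) * cylKernel lam q)))
    (by positivity) (fun s => ?_) ((hβi.const_mul _).const_mul _) ?_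
    (fun q => (hdiff q).const_mul _) (fun q s => ?_) (fun q s => ?_) (fun q s t _ => ?_)
    (fun δ hδ => ((hβi.const_mul _).add ((hmin δ hδ).1.const_mul _)).const_mul _)
    (fun δ hδ => ?_)
  · refine (Measurable.mul (measurable_cylKernel lam) ?_).aestronglyMeasurable
    have h1 := (hv.measurable_taylorGap s)
    have hneg : Measurable fun q : ℝ × ℝ => (-q.1, q.2) := by fun_prop
    exact (((h1.comp measurable_fst).mul (hWm s)).add
      ((h1.comp measurable_fst.neg).mul ((hWm s).comp hneg))).div_const 2
  · rw [integral_const_mul, integral_const_mul, ← hB]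
    nlinarith [mul_nonneg hNk hB0, mul_nonneg hNk hD0']
  · rw [abs_mul, abs_of_nonneg (cylKernel_nonneg lam q)]
    have := mul_le_mul_of_nonneg_left (abs_symmGap_le ha0 ha1.le hv (hW q.2) q.1 s)
      (cylKernel_nonneg lam q)
    linarith
  · rw [hderiv, abs_mul, abs_of_nonneg (cylKernel_nonneg lam q)]
    have := mul_le_mul_of_nonneg_left (abs_deriv_symmGap_le ha0 ha1.le hv (hW q.2) q.1 s)
      (cylKernel_nonneg lam q)
    linarith
  · rw [hderiv, hderiv, ← mul_sub, abs_mul, abs_of_nonneg (cylKernel_nonneg lam q)]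
    have := mul_le_mul_of_nonneg_left (abs_deriv_symmGap_sub_le ha0 ha1.le hv (hW q.2) q.1 s t)
      (cylKernel_nonneg lam q)
    linarith
  · rw [integral_const_mul, integral_add (hβi.const_mul _) ((hmin δ hδ).1.const_mul _),
      integral_const_mul, integral_const_mul, ← hB]
    have h1 := (hmin δ hδ).2
    have h2 := mul_le_mul_of_nonneg_left (integrable_min_mul_kernelDecay ha0 ha1 hδ).2
      (by positivity : 0 ≤ π / lam + 2 * π)
    have h3 : ∫ q, min (|q.1| ^ (1 + a)) (δ * |q.1| ^ a) * cylKernel lam q ∂strip ≤ D * δ ^ a :=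
      h1.trans (h2.trans (le_of_eq (by rw [hD]; ring)))
    have h4 := mul_le_mul_of_nonneg_left h3 hNk
    linarith

end

/-! ### The regular kernel -/

/-- The kernel `(1 - cos θ) |x - y|⁻³`, which is integrable over the strip. -/
noncomputable def regKernel (lam : ℝ) (q : ℝ × ℝ) : ℝ := (1 - Real.cos q.2) * cylKernel lam q

theorem regKernel_nonneg (lam : ℝ) (q : ℝ × ℝ) : 0 ≤ regKernel lam q :=
  mul_nonneg (by linarith [Real.cos_le_one q.2]) (cylKernel_nonneg lam q)

theorem measurable_regKernel (lam : ℝ) : Measurable (regKernel lam) := by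
  refine Measurable.mul ?_ (measurable_cylKernel lam)
  exact Continuous.measurable (by fun_prop)

theorem regKernel_neg (lam τ θ : ℝ) : regKernel lam (-τ, θ) = regKernel lam (τ, θ) := by
  simp [regKernel, cylKernel_neg]

theorem integral_inv_dist_cube {m : ℝ} (hm : 0 < m) :
    Integrable (fun τ : ℝ => (τ ^ 2 + m) ^ (-(3 / 2) : ℝ)) ∧
      ∫ τ : ℝ, (τ ^ 2 + m) ^ (-(3 / 2) : ℝ) = 2 / m := by
  have hpos : ∀ τ : ℝ, 0 < τ ^ 2 + m := fun τ => by positivity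
  -- an antiderivative is `τ / (m √(τ² + m))`
  have hderiv : ∀ τ : ℝ, HasDerivAt (fun τ => τ * (τ ^ 2 + m) ^ (-(1 / 2) : ℝ) / m)
      ((τ ^ 2 + m) ^ (-(3 / 2) : ℝ)) τ := fun τ => by
    have h0 : HasDerivAt (fun τ : ℝ => τ ^ 2 + m) (2 * τ) τ := by
      simpa using (hasDerivAt_pow 2 τ).add_const m
    have h1 := ((hasDerivAt_id' τ).fun_mul (h0.rpow_const (p := -(1 / 2))
      (Or.inl (hpos τ).ne'))).div_const m
    refine h1.congr_deriv ?_
    have e1 : (τ ^ 2 + m) ^ (-(1 / 2) : ℝ) = (τ ^ 2 + m) ^ (-(3 / 2) : ℝ) * (τ ^ 2 + m) := by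
      rw [← Real.rpow_add_one (hpos τ).ne']; norm_num
    have e2 : (-(1 / 2) - 1 : ℝ) = -(3 / 2) := by norm_num
    rw [e2, e1, div_eq_iff hm.ne']
    ring
  have hsq : ∀ τ : ℝ, 0 < τ → τ * (τ ^ 2 + m) ^ (-(1 / 2) : ℝ) / m
      = (1 + m / τ ^ 2) ^ (-(1 / 2) : ℝ) / m := fun τ hτ => by
    have e : τ ^ 2 + m = τ ^ 2 * (1 + m / τ ^ 2) := by field_simp
    rw [e, Real.mul_rpow (by positivity) (by positivity), sq_rpow_eq_abs_rpow, abs_of_pos hτ,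
      show 2 * (-(1 / 2) : ℝ) = -1 by norm_num, Real.rpow_neg_one]
    field_simp
  have hlim : Tendsto (fun τ => τ * (τ ^ 2 + m) ^ (-(1 / 2) : ℝ) / m) atTop (𝓝 (1 / m)) := by
    have h1 : Tendsto (fun τ : ℝ => m / τ ^ 2) atTop (𝓝 0) :=
      tendsto_const_nhds.div_atTop (tendsto_pow_atTop two_ne_zero)
    have h2 : Tendsto (fun τ : ℝ => (1 + m / τ ^ 2) ^ (-(1 / 2) : ℝ) / m) atTop
        (𝓝 ((1 + 0) ^ (-(1 / 2) : ℝ) / m)) :=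
      (((tendsto_const_nhds.add h1).rpow_const (Or.inl (by norm_num)))).div_const m
    rw [add_zero, Real.one_rpow] at h2
    refine h2.congr' ?_
    filter_upwards [eventually_gt_atTop 0] with τ hτ
    exact (hsq τ hτ).symm
  have hi : IntegrableOn (fun τ : ℝ => (τ ^ 2 + m) ^ (-(3 / 2) : ℝ)) (Set.Ioi 0) :=
    integrableOn_Ioi_deriv_of_nonneg' (fun τ _ => hderiv τ)
      (fun τ _ => Real.rpow_nonneg (hpos τ).le _) hlim
  have e : (fun τ : ℝ => (τ ^ 2 + m) ^ (-(3 / 2) : ℝ))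
      = fun τ : ℝ => (fun x : ℝ => (x ^ 2 + m) ^ (-(3 / 2) : ℝ)) |τ| := by
    funext τ; simp only [sq_abs]
  refine ⟨by rw [e]; exact integrable_comp_abs_of_integrableOn_Ioi hi, ?_⟩
  rw [e, integral_comp_abs (f := fun x : ℝ => (x ^ 2 + m) ^ (-(3 / 2) : ℝ)),
    integral_Ioi_of_hasDerivAt_of_tendsto' (fun τ _ => hderiv τ) hi hlim]
  ring

theorem one_sub_cos_pos {θ : ℝ} (h : θ ∈ Set.Ioc (-π) π) (h0 : θ ≠ 0) : 0 < 1 - Real.cos θ := by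
  have h1 := Real.cos_le_one_sub_mul_cos_sq (x := θ) (abs_le.2 ⟨h.1.le, h.2⟩)
  have : 0 < 2 / π ^ 2 * θ ^ 2 := by positivity
  linarith

theorem ae_one_sub_cos_pos :
    ∀ᵐ θ ∂((volume : Measure ℝ).restrict (Set.Ioc (-π) π)), 0 < 1 - Real.cos θ := by
  have hne : ∀ᵐ τ : ℝ, τ ≠ 0 := by simp [ae_iff, measure_singleton]
  rw [ae_restrict_iff' measurableSet_Ioc]
  filter_upwards [hne] with θ h0 hθ
  exact one_sub_cos_pos hθ h0

/-- The factor `1 - cos θ` cancels the growth of the integral of the kernel as `θ → 0`. -/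
theorem integral_regKernel_fst {lam : ℝ} (hlam : 0 < lam) {θ : ℝ} (hθ : 0 < 1 - Real.cos θ) :
    Integrable (fun τ => regKernel lam (τ, θ)) ∧ ∫ τ, regKernel lam (τ, θ) = 1 / lam ^ 2 := by
  have hm : 0 < 2 * lam ^ 2 * (1 - Real.cos θ) := by positivity
  obtain ⟨h1, h2⟩ := integral_inv_dist_cube hm
  refine ⟨h1.const_mul (1 - Real.cos θ), ?_⟩
  have : ∫ τ, regKernel lam (τ, θ) = (1 - Real.cos θ) * (2 / (2 * lam ^ 2 * (1 - Real.cos θ))) := by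
    rw [← h2, ← integral_const_mul]; rfl
  rw [this]
  field_simp

theorem integrable_regKernel {lam : ℝ} (hlam : 0 < lam) :
    Integrable (regKernel lam) strip ∧ ∫ q, regKernel lam q ∂strip = 2 * π / lam ^ 2 := by
  have hm : AEStronglyMeasurable (regKernel lam)
      ((volume : Measure ℝ).prod ((volume : Measure ℝ).restrict (Set.Ioc (-π) π))) :=
    (measurable_regKernel lam).aestronglyMeasurable
  have hi : Integrable (regKernel lam) strip := by
    rw [strip_eq_prod, integrable_prod_iff' hm]
    refine ⟨?_, ?_⟩
    · filter_upwards [ae_one_sub_cos_pos] with θ hθ using (integral_regKernel_fst hlam hθ).1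
    · refine (integrable_const (1 / lam ^ 2)).congr ?_
      filter_upwards [ae_one_sub_cos_pos] with θ hθ
      simp only [Real.norm_of_nonneg (regKernel_nonneg _ _)]
      exact (integral_regKernel_fst hlam hθ).2.symm
  refine ⟨hi, ?_⟩
  rw [strip_eq_prod] at hi ⊢
  rw [integral_prod_symm _ hi, integral_congr_ae (g := fun _ => 1 / lam ^ 2)
    (by filter_upwards [ae_one_sub_cos_pos] with θ hθ using (integral_regKernel_fst hlam hθ).2)]
  simp only [integral_const, MeasurableSet.univ, measureReal_restrict_apply, Set.univ_inter,
    smul_eq_mul, Real.volume_real_Ioc, sub_neg_eq_add]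
  rw [max_eq_left (by linarith [Real.pi_pos])]
  ring

/-! ### Expansion of the integrand near the cylinder -/

/-- The coefficient `τ² / |x - y|²` on the cylinder. -/
noncomputable def axialCoeff (lam θ τ : ℝ) : ℝ := τ ^ 2 / cylDistSq lam (τ, θ)

/-- The coefficient `(1 - cos θ) / |x - y|²` on the cylinder. -/
noncomputable def angularCoeff (lam θ τ : ℝ) : ℝ := (1 - Real.cos θ) / cylDistSq lam (τ, θ)

/-- The part of the relative change of the squared distance that is linear in `v`. -/
noncomputable def relDistLin (lam : ℝ) (v : ℝ → ℝ) (θ τ s : ℝ) : ℝ :=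
  2 * lam * angularCoeff lam θ τ * (v s + v (s + τ))

/-- The part of the relative change of the squared distance that is quadratic in `v`. -/
noncomputable def relDistQuad (lam : ℝ) (v : ℝ → ℝ) (θ τ s : ℝ) : ℝ :=
  axialCoeff lam θ τ * ((v (s + τ) - v s) / τ * ((v (s + τ) - v s) / τ))
    + 2 * angularCoeff lam θ τ * (v s * v (s + τ))

/-- The relative change of the squared distance of two points when the cylinder of radius `lam` is
replaced by the surface of revolution of `lam + v`. -/
noncomputable def relDist (lam : ℝ) (v : ℝ → ℝ) (θ τ s : ℝ) : ℝ :=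
  relDistLin lam v θ τ s + relDistQuad lam v θ τ s

/-- The density with which the Taylor remainder enters the field of `lam + v`. -/
noncomputable def gapDensity (lam : ℝ) (v : ℝ → ℝ) (θ τ s : ℝ) : ℝ :=
  (lam + v (s + τ)) * √(1 + deriv v (s + τ) ^ 2) * (1 + relDist lam v θ τ s) ^ (-(3 / 2) : ℝ)

theorem axialCoeff_neg (lam θ τ : ℝ) : axialCoeff lam θ (-τ) = axialCoeff lam θ τ := by
  simp [axialCoeff, cylDistSq_neg]

theorem angularCoeff_neg (lam θ τ : ℝ) : angularCoeff lam θ (-τ) = angularCoeff lam θ τ := by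
  simp [angularCoeff, cylDistSq_neg]

theorem abs_axialCoeff_le (lam θ τ : ℝ) : |axialCoeff lam θ τ| ≤ 1 := by
  rw [axialCoeff, abs_of_nonneg (div_nonneg (sq_nonneg τ) (cylDistSq_nonneg _ _))]
  exact div_le_one_of_le₀ (sq_le_cylDistSq lam (τ, θ)) (cylDistSq_nonneg _ _)

theorem angularCoeff_nonneg (lam θ τ : ℝ) : 0 ≤ angularCoeff lam θ τ :=
  div_nonneg (by linarith [Real.cos_le_one θ]) (cylDistSq_nonneg _ _)

theorem abs_angularCoeff_le {lam : ℝ} (hlam : 0 < lam) (θ τ : ℝ) :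
    |angularCoeff lam θ τ| ≤ 1 / (2 * lam ^ 2) := by
  rw [abs_of_nonneg (angularCoeff_nonneg lam θ τ), angularCoeff]
  refine div_le_of_le_mul₀ (cylDistSq_nonneg _ _) (by positivity) ?_
  have := one_sub_cos_le_cylDistSq lam (τ, θ)
  rw [div_mul_eq_mul_div, one_mul, le_div_iff₀ (by positivity)]
  simp only at this
  linarith

theorem measurable_axialCoeff (lam : ℝ) :
    Measurable fun q : ℝ × ℝ => axialCoeff lam q.2 q.1 := by
  unfold axialCoeff
  exact (measurable_fst.pow_const 2).div (measurable_cylDistSq lam)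

theorem measurable_angularCoeff (lam : ℝ) :
    Measurable fun q : ℝ × ℝ => angularCoeff lam q.2 q.1 := by
  unfold angularCoeff
  exact (measurable_const.sub (Real.measurable_cos.comp measurable_snd)).div
    (measurable_cylDistSq lam)

section
variable {a N lam : ℝ} {v : ℝ → ℝ}

theorem HolderC2.measurable_shift (hv : HolderC2 a N v) (s : ℝ) :
    Measurable fun q : ℝ × ℝ => v (s + q.1) := by
  have := hv.diff.continuous
  exact Continuous.measurable (by fun_prop)

theorem HolderC2.measurable_deriv_shift (hv : HolderC2 a N v) (s : ℝ) :
    Measurable fun q : ℝ × ℝ => deriv v (s + q.1) := by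
  have := hv.holderC1_deriv.diff.continuous
  exact Continuous.measurable (by fun_prop)

theorem HolderC2.measurable_relDist (hv : HolderC2 a N v) (s : ℝ) :
    Measurable fun q : ℝ × ℝ => relDist lam v q.2 q.1 s := by
  have h1 := hv.measurable_shift s
  have h2 := measurable_axialCoeff lam
  have h3 := measurable_angularCoeff lam
  have h4 : Measurable fun q : ℝ × ℝ => (v (s + q.1) - v s) / q.1 :=
    (h1.sub_const _).div measurable_fst
  unfold relDist relDistLin relDistQuad
  exact ((h3.const_mul _).mul (h1.const_add _)).add
    ((h2.mul (h4.mul h4)).add ((h3.const_mul 2).mul (h1.const_mul _)))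

theorem HolderC2.measurable_gapDensity (hv : HolderC2 a N v) (s : ℝ) :
    Measurable fun q : ℝ × ℝ => gapDensity lam v q.2 q.1 s := by
  unfold gapDensity
  exact (((hv.measurable_shift s).const_add _).mul
    (((hv.measurable_deriv_shift s).pow_const 2).const_add 1).sqrt).mul
    (((hv.measurable_relDist s).const_add 1).pow_const _)

theorem HolderC2.holderFamily_shift (ha0 : 0 < a) (ha1 : a ≤ 1) (hv : HolderC2 a N v) :
    HolderFamily a (4 * N) (fun τ s => v (s + τ)) :=
  (hv.holderC1 ha0 ha1).holderFamily_shift.mono (by linarith)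

theorem HolderC2.holderFamily_relDistLin (hlam : 0 < lam) (ha0 : 0 < a) (ha1 : a ≤ 1)
    (hv : HolderC2 a N v) (θ : ℝ) :
    HolderFamily a (6 / lam * N) (relDistLin lam v θ) := by
  refine (HolderFamily.even_mul (c := fun τ => 2 * lam * angularCoeff lam θ τ) (K := 1 / lam)
    (fun τ => by rw [angularCoeff_neg]) (fun τ => ?_)
    ((HolderFamily.of_const (hv.holderC1 ha0 ha1)).add (hv.holderFamily_shift ha0 ha1))).mono
    (le_of_eq (by ring))
  rw [abs_mul, abs_of_pos (by positivity : 0 < 2 * lam)]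
  refine (mul_le_mul_of_nonneg_left (abs_angularCoeff_le hlam θ τ) (by positivity)).trans
    (le_of_eq (by field_simp))

theorem HolderC2.holderFamily_relDistQuad (hlam : 0 < lam) (ha0 : 0 < a) (ha1 : a ≤ 1)
    (hv : HolderC2 a N v) (θ : ℝ) :
    HolderFamily a ((24 + 48 / lam ^ 2) * N ^ 2) (relDistQuad lam v θ) := by
  have h1 := HolderFamily.even_mul (c := axialCoeff lam θ) (axialCoeff_neg lam θ)
    (abs_axialCoeff_le lam θ) (hv.holderFamily_slope.mul ha0 ha1 hv.holderFamily_slope)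
  have h2 := HolderFamily.even_mul (c := fun τ => 2 * angularCoeff lam θ τ) (K := 1 / lam ^ 2)
    (fun τ => by rw [angularCoeff_neg]) (fun τ => by
      rw [abs_mul, abs_two]
      exact (mul_le_mul_of_nonneg_left (abs_angularCoeff_le hlam θ τ) two_pos.le).trans
        (le_of_eq (by field_simp)))
    ((HolderFamily.of_const (hv.holderC1 ha0 ha1)).mul ha0 ha1 (hv.holderFamily_shift ha0 ha1))
  exact (h1.add h2).mono (le_of_eq (by ring))

theorem contDiffAt_one_add_rpow {y : ℝ} (hy : |y| ≤ 1 / 2) :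
    ContDiffAt ℝ 2 (fun y : ℝ => (1 + y) ^ (-(3 / 2) : ℝ)) y :=
  (contDiffAt_const.add contDiffAt_id).rpow_const_of_ne (by
    have := (abs_le.1 hy).1
    simp only [id]
    linarith)

theorem contDiffAt_sqrt_one_add_sq (y : ℝ) : ContDiffAt ℝ 2 (fun y : ℝ => √(1 + y ^ 2)) y :=
  (contDiffAt_const.add (contDiffAt_id.pow 2)).sqrt (by simp only [id]; positivity)

theorem contDiffAt_inv_sqrt_one_add_sq (y : ℝ) :
    ContDiffAt ℝ 2 (fun y : ℝ => 1 / √(1 + y ^ 2)) y :=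
  contDiffAt_const.div (contDiffAt_sqrt_one_add_sq y) (by positivity)

theorem deriv_sqrt_one_add_sq : deriv (fun y : ℝ => √(1 + y ^ 2)) 0 = 0 := by
  have h : HasDerivAt (fun y : ℝ => 1 + y ^ 2) (2 * 0) 0 := by
    simpa using (hasDerivAt_pow 2 (0 : ℝ)).const_add 1
  rw [(h.sqrt (by norm_num)).deriv]; simp

theorem deriv_inv_sqrt_one_add_sq : deriv (fun y : ℝ => 1 / √(1 + y ^ 2)) 0 = 0 := by
  have h : HasDerivAt (fun y : ℝ => 1 + y ^ 2) (2 * 0) 0 := by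
    simpa using (hasDerivAt_pow 2 (0 : ℝ)).const_add 1
  have h2 := (h.sqrt (by norm_num)).fun_inv (by norm_num)
  simp only [one_div]
  rw [h2.deriv]; simp

theorem deriv_one_add_rpow : deriv (fun y : ℝ => (1 + y) ^ (-(3 / 2) : ℝ)) 0 = -(3 / 2) := by
  have h : HasDerivAt (fun y : ℝ => 1 + y) 1 0 := by
    simpa using (hasDerivAt_id (0 : ℝ)).const_add 1
  rw [(h.rpow_const (p := -(3 / 2)) (Or.inl (by norm_num))).deriv]; simp

/-- The density differs from its value `lam` on the cylinder by a family of the order of `v`, and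
its product with `lam + v(s + τ)` is known up to an error that is quadratic in `v`. -/
theorem exists_gapDensity_expansion (hlam : 0 < lam) (ha0 : 0 < a) (ha1 : a ≤ 1) :
    ∃ ε C, 0 < ε ∧ 0 ≤ C ∧ ∀ (N : ℝ) (v : ℝ → ℝ), N ≤ ε → HolderC2 a N v → ∀ θ,
      HolderFamily a (C * N) (fun τ s => gapDensity lam v θ τ s - lam) ∧
      (∀ τ s, |relDist lam v θ τ s| ≤ 1 / 2) ∧
      ∀ τ, HolderC1 a (C * N ^ 2) (fun s => (lam + v (s + τ)) * gapDensity lam v θ τ s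
        - lam ^ 2 - (2 * lam * v (s + τ) - 3 / 2 * lam ^ 2 * relDistLin lam v θ τ s)) := by
  obtain ⟨C1, hC1, hrpow⟩ := exists_holderFamily_comp ha0 ha1
    (f := fun y : ℝ => (1 + y) ^ (-(3 / 2) : ℝ)) (fun y hy => contDiffAt_one_add_rpow hy)
  obtain ⟨C2, hC2, hrpow2⟩ := exists_holderC1_comp_sq ha0 ha1
    (f := fun y : ℝ => (1 + y) ^ (-(3 / 2) : ℝ)) (fun y hy => contDiffAt_one_add_rpow hy)
  obtain ⟨C3, hC3, hsqrt⟩ := exists_holderFamily_comp ha0 ha1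
    (f := fun y : ℝ => √(1 + y ^ 2)) (fun y _ => contDiffAt_sqrt_one_add_sq y)
  obtain ⟨C4, hC4, hsqrt2⟩ := exists_holderC1_comp_sq ha0 ha1
    (f := fun y : ℝ => √(1 + y ^ 2)) (fun y _ => contDiffAt_sqrt_one_add_sq y)
  simp only [add_zero, Real.one_rpow, deriv_one_add_rpow] at hrpow hrpow2
  simp only [ne_eq, OfNat.ofNat_ne_zero, not_false_eq_true, zero_pow, add_zero, Real.sqrt_one,
    deriv_sqrt_one_add_sq, zero_mul, sub_zero] at hsqrt hsqrt2
  set X := 6 / lam + (24 + 48 / lam ^ 2) with hX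
  have hX0 : 0 < X := by positivity
  set Y := C1 * X with hY
  have hY0 : 0 ≤ Y := by positivity
  set Q := C3 * 2 with hQ
  have hQ0 : 0 ≤ Q := by positivity
  refine ⟨min (1 / 4) (1 / (2 * X)),
    (6 * (4 * (6 * ((1 + Q) * (1 + Y)))) + lam * (Q + Y + 6 * (Q * Y))) +
      (6 * (6 * ((lam + 4) * (lam + 4)) * (6 * (C4 * 4 * (1 + Y)))) + 6 * (4 * 4)
        + lam ^ 2 * (C2 * X ^ 2 + 3 / 2 * (24 + 48 / lam ^ 2))
        + 6 * ((2 * lam * 4 + 6 * (4 * 4)) * Y)),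
    by positivity, by positivity, fun N v hNε hv θ => ?_⟩
  have hN := hv.nonneg
  have hN1 : N ≤ 1 / 4 := hNε.trans (min_le_left _ _)
  have hNX : X * N ≤ 1 / 2 := by
    have h := mul_le_mul_of_nonneg_left (hNε.trans (min_le_right _ _)) hX0.le
    refine h.trans (le_of_eq (by field_simp))
  have hNsq : N ^ 2 ≤ N := by nlinarith
  have hb := hv.holderFamily_shift ha0 ha1
  have hx2 := hv.holderFamily_relDistQuad hlam ha0 ha1 θ
  have hx : HolderFamily a (X * N) (relDist lam v θ) := by
    refine ((hv.holderFamily_relDistLin hlam ha0 ha1 θ).add hx2).mono ?_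
    rw [hX, add_mul _ _ N]
    have : 0 ≤ 24 + 48 / lam ^ 2 := by positivity
    gcongr
  have hy := hrpow (X * N) _ hNX hx
  have hp := hv.holderC1_deriv.holderFamily_shift
  have hq := hsqrt (2 * N) _ (by linarith) hp
  rw [← mul_assoc, ← hY] at hy
  rw [← mul_assoc, ← hQ] at hq
  have hone : HolderFamily a 1 (fun _ _ => (1 : ℝ)) :=
    HolderFamily.of_const (by simpa using HolderC1.const (a := a) 1)
  have hq1 : HolderFamily a (1 + Q) (fun τ s => 1 + (√(1 + deriv v (s + τ) ^ 2) - 1)) :=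
    (hone.add hq).mono (by nlinarith)
  have hy1 : HolderFamily a (1 + Y)
      (fun τ s => 1 + ((1 + relDist lam v θ τ s) ^ (-(3 / 2) : ℝ) - 1)) :=
    (hone.add hy).mono (by nlinarith)
  have hlamF : ∀ c : ℝ, 0 ≤ c → HolderFamily a c (fun _ _ => c) := fun c hc =>
    HolderFamily.of_const (by simpa [abs_of_nonneg hc] using HolderC1.const (a := a) c)
  have hcm : ∀ (c M : ℝ) (u : ℝ → ℝ → ℝ), 0 ≤ c → HolderFamily a M u →
      HolderFamily a (c * M) (fun τ s => c * u τ s) := fun c M u hc hu =>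
    HolderFamily.even_mul (c := fun _ => c) (fun _ => rfl) (fun _ => (abs_of_nonneg hc).le) hu
  have hB : 0 ≤ 6 * (4 * (6 * ((1 + Q) * (1 + Y)))) + lam * (Q + Y + 6 * (Q * Y)) := by positivity
  have hR : 0 ≤ 6 * (6 * ((lam + 4) * (lam + 4)) * (6 * (C4 * 4 * (1 + Y)))) + 6 * (4 * 4)
        + lam ^ 2 * (C2 * X ^ 2 + 3 / 2 * (24 + 48 / lam ^ 2))
        + 6 * ((2 * lam * 4 + 6 * (4 * 4)) * Y) := by positivity
  refine ⟨?_, fun τ s => ((hx.holderC1 τ).bound s).trans hNX, fun τ => ?_⟩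
  · have h1 := hb.mul ha0 ha1 (hq1.mul ha0 ha1 hy1)
    have h2 := hcm lam _ _ hlam.le ((hq.add hy).add (hq.mul ha0 ha1 hy))
    refine ((h1.add h2).mono (N := (6 * (4 * (6 * ((1 + Q) * (1 + Y))))
      + lam * (Q + Y + 6 * (Q * Y))) * N) ?_).mono ?_ |>.congr fun τ s => ?_
    · have h3 : 6 * (Q * N * (Y * N)) ≤ 6 * (Q * Y) * N := by
        have := mul_le_mul_of_nonneg_left hNsq (mul_nonneg hQ0 hY0)
        linarith
      have h4 := mul_le_mul_of_nonneg_left h3 hlam.le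
      linarith
    · exact mul_le_mul_of_nonneg_right (by linarith) hN
    · unfold gapDensity; ring
  · -- the splitting `b² (1 + Q) (1 + Y) = b² Q (1 + Y) + b² + b² Y` with `b = lam + v(s + τ)`
    have hb1 : HolderFamily a (lam + 4) (fun τ s => lam + v (s + τ)) :=
      ((hlamF lam hlam.le).add hb).mono (by linarith)
    have hbb := hb1.mul ha0 ha1 hb1
    have hQ2 := hsqrt2 (2 * N) _ (by linarith) (hp.holderC1 τ)
    have t1 := (hbb.holderC1 τ).mul ha0 ha1 (hQ2.mul ha0 ha1 (hy1.holderC1 τ))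
    have t2 := (hb.holderC1 τ).mul ha0 ha1 (hb.holderC1 τ)
    have t3 := hrpow2 (X * N) _ hNX (hx.holderC1 τ)
    have t4 := ((t3.add ((hx2.holderC1 τ).const_mul (-(3 / 2))))).const_mul (lam ^ 2)
    have t5 := (((hcm (2 * lam) _ _ (by positivity) hb).holderC1 τ).add t2).mul ha0 ha1
      (hy.holderC1 τ)
    refine (((t1.add t2).add t4).add t5).mono ?_ |>.congr fun s => ?_
    · rw [abs_of_nonneg (sq_nonneg lam), abs_neg, abs_of_nonneg (by norm_num : (0 : ℝ) ≤ 3 / 2)]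
      have h3 : (2 * lam * (4 * N) + 6 * (4 * N * (4 * N))) * (Y * N)
          ≤ (2 * lam * 4 + 6 * (4 * 4)) * Y * N ^ 2 := by
        have h4 : 2 * lam * (4 * N) + 6 * (4 * N * (4 * N)) ≤ (2 * lam * 4 + 6 * (4 * 4)) * N := by
          nlinarith
        have := mul_le_mul_of_nonneg_right h4 (mul_nonneg hY0 hN)
        linarith
      have h5 := mul_nonneg hB (sq_nonneg N)
      linarith
    · simp only [relDist]
      unfold gapDensity relDist
      ring

end

/-! ### The field of a surface of revolution as an integral over the strip -/

theorem measurePreserving_shift_strip (s : ℝ) :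
    MeasurePreserving (fun q : ℝ × ℝ => (s + q.1, q.2)) strip strip := by
  rw [strip_eq_prod]
  exact (measurePreserving_add_left (volume : Measure ℝ) s).prod (MeasurePreserving.id _)

theorem measurableEmbedding_shift_strip (s : ℝ) :
    MeasurableEmbedding (fun q : ℝ × ℝ => (s + q.1, q.2)) :=
  ((Homeomorph.addLeft s).prodCongr (Homeomorph.refl ℝ)).measurableEmbedding

theorem measurable_surfaceParam {φ : ℝ → ℝ} (hφ : Continuous φ) : Measurable (surfaceParam φ) := by
  unfold surfaceParam
  refine (WithLp.measurable_toLp 2 _).comp (measurable_pi_iff.2 fun i => ?_)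
  have : Measurable φ := hφ.measurable
  fin_cases i <;> simp <;> fun_prop

theorem measurable_fieldIntegrand (φ : ℝ → ℝ) (q : ℝ × ℝ) : Measurable (fieldIntegrand φ q) := by
  unfold fieldIntegrand
  refine Measurable.div (Continuous.measurable (by fun_prop)) (Continuous.measurable (by fun_prop))

theorem norm_surfaceParam_sub (φ : ℝ → ℝ) (s τ θ : ℝ) :
    ‖surfaceParam φ (s, 0) - surfaceParam φ (s + τ, θ)‖
      = √(τ ^ 2 + (φ (s + τ) - φ s) ^ 2 + 2 * φ s * φ (s + τ) * (1 - Real.cos θ)) := by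
  rw [EuclideanSpace.norm_eq]
  congr 1
  simp only [surfaceParam, Real.norm_eq_abs, sq_abs, Fin.sum_univ_three, PiLp.sub_apply]
  simp
  linear_combination φ (s + τ) ^ 2 * Real.sin_sq_add_cos_sq θ

theorem inner_surfaceParam_sub (φ : ℝ → ℝ) (s τ θ : ℝ) :
    inner ℝ (surfaceParam φ (s + τ, θ) - surfaceParam φ (s, 0)) (surfaceNormal φ (s, 0))
      = 1 / √(1 + deriv φ s ^ 2) *
        (taylorGap φ τ s - (1 - Real.cos θ) * φ (s + τ)) := by
  simp only [surfaceParam, surfaceNormal, inner_smul_right, PiLp.inner_apply, Fin.sum_univ_three,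
    taylorGap]
  simp
  left
  ring

section
variable {a N lam : ℝ} {v : ℝ → ℝ}

theorem dist_sq_eq_mul_one_add_relDist (v : ℝ → ℝ) (θ τ s : ℝ) (hlam : 0 < lam) :
    τ ^ 2 + (v (s + τ) - v s) ^ 2 + 2 * (lam + v s) * (lam + v (s + τ)) * (1 - Real.cos θ)
      = cylDistSq lam (τ, θ) * (1 + relDist lam v θ τ s) := by
  have h1 : 0 ≤ 1 - Real.cos θ := by linarith [Real.cos_le_one θ]
  -- if the points coincide, both sides vanish, whatever the value of `relDist`
  rcases (cylDistSq_nonneg lam (τ, θ)).eq_or_lt with h | h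
  · have h2 : 0 ≤ 2 * lam ^ 2 * (1 - Real.cos θ) := by positivity
    have h3 : τ ^ 2 + 2 * lam ^ 2 * (1 - Real.cos θ) = 0 := h.symm
    have h4 : τ = 0 := by
      have : τ ^ 2 = 0 := le_antisymm (by linarith) (sq_nonneg τ)
      simpa using this
    have h5 : 1 - Real.cos θ = 0 := by
      rw [h4] at h3
      simpa [hlam.ne'] using h3
    rw [← h, h5, h4]; simp
  · have h' := h.ne'
    have e1 : cylDistSq lam (τ, θ) * axialCoeff lam θ τ = τ ^ 2 := by
      rw [axialCoeff, mul_div_cancel₀ _ h']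
    have e2 : cylDistSq lam (τ, θ) * angularCoeff lam θ τ = 1 - Real.cos θ := by
      rw [angularCoeff, mul_div_cancel₀ _ h']
    have e3 : τ ^ 2 * ((v (s + τ) - v s) / τ * ((v (s + τ) - v s) / τ)) = (v (s + τ) - v s) ^ 2 := by
      rcases eq_or_ne τ 0 with rfl | hτ
      · simp
      · field_simp
    have e4 : cylDistSq lam (τ, θ) = τ ^ 2 + 2 * lam ^ 2 * (1 - Real.cos θ) := rfl
    have e5 : cylDistSq lam (τ, θ) * relDist lam v θ τ s
        = (v (s + τ) - v s) ^ 2 + 2 * (1 - Real.cos θ) *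
          (lam * (v s + v (s + τ)) + v s * v (s + τ)) := by
      rw [← e3, ← e1, ← e2, relDist, relDistLin, relDistQuad]
      ring
    rw [mul_add (cylDistSq lam (τ, θ)), e5, mul_one, e4]
    ring

theorem taylorGap_const_add (c : ℝ) (v : ℝ → ℝ) (τ s : ℝ) :
    taylorGap (fun s => c + v s) τ s = taylorGap v τ s := by
  simp only [taylorGap, deriv_const_add']
  ring

/-- The integrand of the field of the surface of revolution of `lam + v` at height `s`, in the
coordinates `(τ, θ)` of the strip and without the normalizing factor of the normal. -/
noncomputable def stripIntegrand (lam : ℝ) (v : ℝ → ℝ) (s : ℝ) (q : ℝ × ℝ) : ℝ :=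
  taylorGap v q.1 s * gapDensity lam v q.2 q.1 s * cylKernel lam q
    - (lam + v (s + q.1)) * gapDensity lam v q.2 q.1 s * regKernel lam q

/-- The area density times the integrand of the field, in the coordinates of the strip. -/
theorem density_mul_fieldIntegrand (hlam : 0 < lam)
    (hx : ∀ θ τ s, |relDist lam v θ τ s| ≤ 1 / 2) (s τ θ : ℝ) :
    (lam + v (s + τ)) * √(1 + deriv v (s + τ) ^ 2) *
      fieldIntegrand (fun s => lam + v s) (s, 0) (surfaceParam (fun s => lam + v s) (s + τ, θ))
      = 1 / √(1 + deriv v s ^ 2) * stripIntegrand lam v s (τ, θ) := by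
  have hpos : 0 < 1 + relDist lam v θ τ s := by linarith [(abs_le.1 (hx θ τ s)).1]
  rw [fieldIntegrand, inner_surfaceParam_sub, norm_surfaceParam_sub, taylorGap_const_add]
  have e1 : lam + v (s + τ) - (lam + v s) = v (s + τ) - v s := by ring
  have e2 : √(cylDistSq lam (τ, θ) * (1 + relDist lam v θ τ s)) ^ 3
      = ((cylDistSq lam (τ, θ) * (1 + relDist lam v θ τ s)) ^ (-(3 / 2) : ℝ))⁻¹ := by
    have h0 := mul_nonneg (cylDistSq_nonneg lam (τ, θ)) hpos.le
    rw [← Real.rpow_neg h0, Real.sqrt_eq_rpow, ← Real.rpow_natCast, ← Real.rpow_mul h0]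
    norm_num
  simp only [e1, dist_sq_eq_mul_one_add_relDist v θ τ s hlam, e2, deriv_const_add', div_inv_eq_mul,
    Real.mul_rpow (cylDistSq_nonneg lam (τ, θ)) hpos.le]
  simp only [stripIntegrand, gapDensity, regKernel, cylKernel]
  ring

/-- The integral over the surface, pulled back to the strip by the parametrization and translated so
that heights are measured from `s`. -/
theorem integral_surfaceMeasure (hlam : 0 < lam) (hv : HolderC2 a N v) (hpos : ∀ s, 0 < lam + v s)
    (hx : ∀ θ τ s, |relDist lam v θ τ s| ≤ 1 / 2) (s : ℝ) :
    (Integrable (stripIntegrand lam v s) strip →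
      Integrable (fieldIntegrand (fun s => lam + v s) (s, 0))
        (surfaceMeasure fun s => lam + v s)) ∧
    ∫ y, fieldIntegrand (fun s => lam + v s) (s, 0) y ∂(surfaceMeasure fun s => lam + v s)
      = 1 / √(1 + deriv v s ^ 2) * ∫ q, stripIntegrand lam v s q ∂strip := by
  have hc : Continuous v := hv.diff.continuous
  have hc1 : Continuous (deriv v) := hv.holderC1_deriv.diff.continuous
  have hmeas := measurable_surfaceParam (φ := fun s => lam + v s) (by fun_prop)
  have hdens : Measurable fun q : ℝ × ℝ => ENNReal.ofReal
      ((lam + v q.1) * √(1 + deriv v q.1 ^ 2)) :=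
    ENNReal.measurable_ofReal.comp (Continuous.measurable (by fun_prop))
  have hS : surfaceMeasure (fun s => lam + v s) = Measure.map (surfaceParam fun s => lam + v s)
      (strip.withDensity fun q => ENNReal.ofReal ((lam + v q.1) * √(1 + deriv v q.1 ^ 2))) := by
    simp only [surfaceMeasure, deriv_const_add', strip]
  have hreal : ∀ q : ℝ × ℝ, (ENNReal.ofReal ((lam + v q.1) * √(1 + deriv v q.1 ^ 2))).toReal
      = (lam + v q.1) * √(1 + deriv v q.1 ^ 2) := fun q =>
    ENNReal.toReal_ofReal (mul_nonneg (hpos q.1).le (Real.sqrt_nonneg _))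
  have hlt : ∀ᵐ q ∂strip, ENNReal.ofReal ((lam + v q.1) * √(1 + deriv v q.1 ^ 2)) < ⊤ :=
    Eventually.of_forall fun q => ENNReal.ofReal_lt_top
  have hfm := measurable_fieldIntegrand (fun s => lam + v s) (s, 0)
  have hpt : ∀ q : ℝ × ℝ, (fun p : ℝ × ℝ => (lam + v p.1) * √(1 + deriv v p.1 ^ 2) *
      fieldIntegrand (fun s => lam + v s) (s, 0) (surfaceParam (fun s => lam + v s) p))
        (s + q.1, q.2) = 1 / √(1 + deriv v s ^ 2) * stripIntegrand lam v s q := fun q =>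
    density_mul_fieldIntegrand hlam hx s q.1 q.2
  refine ⟨fun hi => ?_, ?_⟩
  · rw [hS, integrable_map_measure hfm.aestronglyMeasurable hmeas.aemeasurable,
      integrable_withDensity_iff_integrable_smul' hdens hlt]
    simp only [hreal, smul_eq_mul, Function.comp_apply]
    rw [← (measurePreserving_shift_strip s).integrable_comp_emb (measurableEmbedding_shift_strip s)]
    exact (hi.const_mul _).congr (Eventually.of_forall fun q => (hpt q).symm)
  · rw [hS, integral_map hmeas.aemeasurable hfm.aestronglyMeasurable,
      integral_withDensity_eq_integral_toReal_smul hdens hlt]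
    simp only [hreal, smul_eq_mul]
    rw [← (measurePreserving_shift_strip s).integral_comp (measurableEmbedding_shift_strip s),
      ← integral_const_mul]
    exact integral_congr_ae (Eventually.of_forall hpt)

theorem fieldFun_eq_integral (φ : ℝ → ℝ) (s : ℝ) :
    fieldFun φ s = ∫ y, fieldIntegrand φ (s, 0) y ∂(surfaceMeasure φ) := by
  rw [fieldFun, normalField]
  field_simp

/-! ### The linearized field -/

/-- The coefficient of the regular kernel in the linearized field. -/
noncomputable def linRegDensity (lam : ℝ) (v : ℝ → ℝ) (θ τ s : ℝ) : ℝ :=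
  2 * lam * v (s + τ) - 3 / 2 * lam ^ 2 * relDistLin lam v θ τ s

/-- The integrand of the derivative of the field at the cylinder in the direction `v`. -/
noncomputable def linIntegrand (lam : ℝ) (v : ℝ → ℝ) (s : ℝ) (q : ℝ × ℝ) : ℝ :=
  taylorGap v q.1 s * lam * cylKernel lam q - linRegDensity lam v q.2 q.1 s * regKernel lam q

/-- The derivative of the field at the cylinder in the direction `v`. -/
noncomputable def linField (lam : ℝ) (v : ℝ → ℝ) (s : ℝ) : ℝ := ∫ q, linIntegrand lam v s q ∂strip

theorem HolderC2.measurable_linRegDensity (hv : HolderC2 a N v) (s : ℝ) :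
    Measurable fun q : ℝ × ℝ => linRegDensity lam v q.2 q.1 s := by
  unfold linRegDensity relDistLin
  exact ((hv.measurable_shift s).const_mul _).sub
    ((((measurable_angularCoeff lam).const_mul _).mul
      ((hv.measurable_shift s).const_add _)).const_mul _)

theorem HolderC2.holderC1_linRegDensity (hlam : 0 < lam) (ha0 : 0 < a) (ha1 : a ≤ 1)
    (hv : HolderC2 a N v) (θ τ : ℝ) :
    HolderC1 a (17 * lam * N) (linRegDensity lam v θ τ) := by
  have h1 := ((hv.holderFamily_shift ha0 ha1).holderC1 τ).const_mul (2 * lam)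
  have h2 := ((hv.holderFamily_relDistLin hlam ha0 ha1 θ).holderC1 τ).const_mul
    (-(3 / 2 * lam ^ 2))
  refine ((h1.add h2).mono ?_).congr fun s => ?_
  · rw [abs_neg, abs_of_pos (by positivity), abs_of_pos (by positivity)]
    refine le_of_eq ?_
    field_simp
    ring
  · unfold linRegDensity; ring

/-- Integration against the regular kernel preserves `C^{1,a}` bounds. -/
theorem holderC1_integral_regKernel (hlam : 0 < lam) {M : ℝ} {u : ℝ × ℝ → ℝ → ℝ}
    (hm : ∀ s, Measurable fun q => u q s) (hu : ∀ q, HolderC1 a M (u q)) :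
    HolderC1 a (M * (2 * π / lam ^ 2)) (fun s => ∫ q, u q s * regKernel lam q ∂strip) := by
  refine holderC1_integral_of_holderC1 (b := fun q => M * regKernel lam q)
    (fun s => ((hm s).mul (measurable_regKernel lam)).aestronglyMeasurable)
    ((integrable_regKernel hlam).1.const_mul M) ?_ fun q => ?_
  · rw [integral_const_mul, (integrable_regKernel hlam).2]
  · refine (((hu q).const_mul (regKernel lam q)).mono (le_of_eq ?_)).congr fun s => mul_comm _ _
    rw [abs_of_nonneg (regKernel_nonneg lam q), mul_comm]

theorem integrable_mul_regKernel (hlam : 0 < lam) {M : ℝ} {u : ℝ × ℝ → ℝ}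
    (hm : Measurable u) (hu : ∀ q, |u q| ≤ M) :
    Integrable (fun q => u q * regKernel lam q) strip :=
  (integrable_regKernel hlam).1.bdd_mul hm.aestronglyMeasurable (Eventually.of_forall hu)

theorem holderFamily_const (hlam : 0 < lam) : HolderFamily a lam (fun _ _ => lam) :=
  HolderFamily.of_const (by simpa [abs_of_pos hlam] using HolderC1.const (a := a) lam)

theorem integrable_linIntegrand (hlam : 0 < lam) (ha0 : 0 < a) (ha1 : a < 1)
    (hv : HolderC2 a N v) (s : ℝ) : Integrable (linIntegrand lam v s) strip :=
  (hv.integrable_taylorGap hlam ha0 ha1 (W := fun _ _ _ => lam)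
    (fun _ => holderFamily_const hlam) (fun _ => measurable_const) s).sub
    (integrable_mul_regKernel hlam (hv.measurable_linRegDensity s)
      fun q => (hv.holderC1_linRegDensity hlam ha0 ha1.le q.2 q.1).bound s)

/-- The field of `lam + v` is well defined and equal to `-2π` plus the linearized field, up to a
quadratic error in `C^{1,a}`. -/
theorem exists_fieldFun_expansion (hlam : 0 < lam) (ha0 : 0 < a) (ha1 : a < 1) :
    ∃ ε C, 0 < ε ∧ 0 ≤ C ∧ (∀ (N : ℝ) (v : ℝ → ℝ), HolderC2 a N v →
        HolderC1 a (C * N) (linField lam v)) ∧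
      ∀ (N : ℝ) (v : ℝ → ℝ), N ≤ ε → HolderC2 a N v →
        (∀ s, 0 < lam + v s) ∧
        (∀ s, Integrable (fieldIntegrand (fun s => lam + v s) (s, 0))
          (surfaceMeasure fun s => lam + v s)) ∧
        (∀ s, fieldFun (fun s => lam + v s) s
          = 1 / √(1 + deriv v s ^ 2) * ∫ q, stripIntegrand lam v s q ∂strip) ∧
        HolderC1 a (C * N ^ 2)
          (fun s => fieldFun (fun s => lam + v s) s + 2 * π - linField lam v s) := by
  obtain ⟨ε, C, hε, hC, hexp⟩ := exists_gapDensity_expansion hlam ha0 ha1.le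
  obtain ⟨C1, hC1, hsing⟩ := exists_holderC1_integral_taylorGap (lam := lam) hlam ha0 ha1
  obtain ⟨C2, hC2, hinv⟩ := exists_holderC1_comp_sq ha0 ha1.le
    (f := fun y : ℝ => 1 / √(1 + y ^ 2)) (fun y _ => contDiffAt_inv_sqrt_one_add_sq y)
  simp only [ne_eq, OfNat.ofNat_ne_zero, not_false_eq_true, zero_pow, add_zero, Real.sqrt_one,
    deriv_inv_sqrt_one_add_sq, zero_mul, sub_zero, div_one] at hinv
  set P := 2 * π / lam ^ 2 with hP
  have hP0 : 0 ≤ P := by positivity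
  set L := C1 * lam + 17 * lam * P with hL
  have hL0 : 0 ≤ L := by positivity
  have hlin : ∀ (N : ℝ) (v : ℝ → ℝ), HolderC2 a N v → HolderC1 a (L * N) (linField lam v) := by
    intro N v hv
    have h1 := hsing N lam v (fun _ _ _ => lam) hv (fun _ => holderFamily_const hlam)
      (fun _ => measurable_const)
    have h2 := holderC1_integral_regKernel hlam (u := fun q => linRegDensity lam v q.2 q.1)
      hv.measurable_linRegDensity (fun q => hv.holderC1_linRegDensity hlam ha0 ha1.le q.2 q.1)
    refine ((h1.add (h2.const_mul (-1))).mono (le_of_eq ?_)).congr fun s => ?_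
    · rw [hL]; simp; ring
    · have := integral_sub (hv.integrable_taylorGap hlam ha0 ha1 (W := fun _ _ _ => lam)
          (fun _ => holderFamily_const hlam) (fun _ => measurable_const) s)
        (integrable_mul_regKernel hlam (hv.measurable_linRegDensity s)
          fun q => (hv.holderC1_linRegDensity hlam ha0 ha1.le q.2 q.1).bound s)
      rw [linField, neg_one_mul, ← sub_eq_add_neg]
      exact this
  set R := C1 * C + C * P with hR
  have hR0 : 0 ≤ R := by positivity
  set S := 2 * π + L + R with hS
  have hS0 : 0 ≤ S := by positivity
  refine ⟨min (min ε (lam / 2)) (1 / 2), L + (R + 6 * (C2 * S)), by positivity, by positivity,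
    fun N v hv => (hlin N v hv).mono ?_, fun N v hNε hv => ?_⟩
  · have := hv.nonneg
    have h1 : 0 ≤ R + 6 * (C2 * S) := by positivity
    nlinarith
  have hN := hv.nonneg
  have hNε1 : N ≤ ε := hNε.trans ((min_le_left _ _).trans (min_le_left _ _))
  have hNlam : N ≤ lam / 2 := hNε.trans ((min_le_left _ _).trans (min_le_right _ _))
  have hN1 : N ≤ 1 / 2 := hNε.trans (min_le_right _ _)
  have hNsq : N ^ 2 ≤ N := by nlinarith
  have hexp' := hexp N v hNε1 hv
  have hpos : ∀ s, 0 < lam + v s := fun s => by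
    have := (abs_le.1 (hv.bound s)).1
    linarith
  have hx : ∀ θ τ s, |relDist lam v θ τ s| ≤ 1 / 2 := fun θ => (hexp' θ).2.1
  -- the field splits into a singular integral with a density of order `v`, a regular integral with
  -- a density `quad` that is quadratic in `v`, the linearized field, and the constant `-2π`
  set quad : ℝ × ℝ → ℝ → ℝ := fun q s => (lam + v (s + q.1)) * gapDensity lam v q.2 q.1 s
    - lam ^ 2 - linRegDensity lam v q.2 q.1 s with hquad
  have hquadm : ∀ s, Measurable fun q => quad q s := fun s =>
    ((((hv.measurable_shift s).const_add _).mul (hv.measurable_gapDensity s)).sub_const _).sub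
      (hv.measurable_linRegDensity s)
  have hquadb : ∀ q, HolderC1 a (C * N ^ 2) (quad q) := fun q => (hexp' q.2).2.2 q.1
  have hgm : ∀ s, Measurable fun q : ℝ × ℝ => gapDensity lam v q.2 q.1 s - lam := fun s =>
    (hv.measurable_gapDensity s).sub_const _
  have i1 := fun s => hv.integrable_taylorGap hlam ha0 ha1
    (W := fun θ τ s => gapDensity lam v θ τ s - lam) (fun θ => (hexp' θ).1) hgm s
  have i2 := fun s => integrable_mul_regKernel hlam (hquadm s) fun q => (hquadb q).bound s
  have i3 := fun s => integrable_linIntegrand hlam ha0 ha1 hv s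
  have i4 := (integrable_regKernel hlam).1.const_mul (lam ^ 2)
  have hsplit : ∀ s q, stripIntegrand lam v s q
      = taylorGap v q.1 s * (gapDensity lam v q.2 q.1 s - lam) * cylKernel lam q
        - quad q s * regKernel lam q + (linIntegrand lam v s q - lam ^ 2 * regKernel lam q) :=
    fun s q => by
      simp only [stripIntegrand, linIntegrand, hquad]; ring
  have hstrip_int : ∀ s, Integrable (stripIntegrand lam v s) strip := fun s =>
    (((i1 s).sub (i2 s)).add ((i3 s).sub i4)).congr
      (Eventually.of_forall fun q => (hsplit s q).symm)
  have hstrip : ∀ s, ∫ q, stripIntegrand lam v s q ∂strip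
      = ((∫ q, taylorGap v q.1 s * (gapDensity lam v q.2 q.1 s - lam) * cylKernel lam q ∂strip)
        - ∫ q, quad q s * regKernel lam q ∂strip) + (linField lam v s - 2 * π) := fun s => by
    have e1 := integral_sub (i1 s) (i2 s)
    have e2 := integral_sub (i3 s) i4
    have e3 := integral_add ((i1 s).sub (i2 s)) ((i3 s).sub i4)
    simp only [Pi.sub_apply] at e1 e2 e3
    rw [integral_congr_ae (Eventually.of_forall (hsplit s)), e3, e1, e2,
      integral_const_mul, (integrable_regKernel hlam).2, linField]
    congr 2
    field_simp
  have hfield : ∀ s, fieldFun (fun s => lam + v s) s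
      = 1 / √(1 + deriv v s ^ 2) * ∫ q, stripIntegrand lam v s q ∂strip := fun s => by
    rw [fieldFun_eq_integral, (integral_surfaceMeasure hlam hv hpos hx s).2]
  refine ⟨hpos, fun s => (integral_surfaceMeasure hlam hv hpos hx s).1 (hstrip_int s), hfield, ?_⟩
  have r1 := hsing N (C * N) v (fun θ τ s => gapDensity lam v θ τ s - lam) hv
    (fun θ => (hexp' θ).1) hgm
  have r2 := holderC1_integral_regKernel hlam hquadm hquadb
  have hrem : HolderC1 a (R * N ^ 2) (fun s =>
      (∫ q, taylorGap v q.1 s * (gapDensity lam v q.2 q.1 s - lam) * cylKernel lam q ∂strip)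
        + -1 * ∫ q, quad q s * regKernel lam q ∂strip) := by
    refine (r1.add (r2.const_mul (-1))).mono (le_of_eq ?_)
    rw [hR, ← hP]; simp; ring
  have htot : HolderC1 a S (fun s => ∫ q, stripIntegrand lam v s q ∂strip) := by
    have h2π : HolderC1 a (2 * π) (fun _ => -(2 * π)) := by
      simpa [abs_of_pos Real.pi_pos] using HolderC1.const (a := a) (-(2 * π))
    refine ((h2π.add (hlin N v hv)).add hrem).mono ?_ |>.congr fun s => ?_
    · nlinarith
    · rw [hstrip]; ring
  have hfac := hinv N _ hN1 hv.holderC1_deriv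
  refine (hrem.add (hfac.mul ha0 ha1.le htot)).mono ?_ |>.congr fun s => ?_
  · have : 0 ≤ L * N ^ 2 := by positivity
    linarith
  · rw [hfield]
    linear_combination hstrip s

end

/-! ### Symmetries -/

section
variable {lam : ℝ} {v : ℝ → ℝ}

theorem Function.Even.deriv_neg (hv : Function.Even v) (s : ℝ) : deriv v (-s) = -deriv v s := by
  have h : (fun x => v (-x)) = v := funext hv
  have h2 := deriv_comp_neg v s
  rw [h] at h2
  rw [h2, neg_neg]

theorem Function.Periodic.deriv_add {c : ℝ} (hv : Function.Periodic v c) (s : ℝ) :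
    deriv v (s + c) = deriv v s := by
  have h : (fun x => v (x + c)) = v := funext hv
  have h2 := deriv_comp_add_const v c s
  rw [h] at h2
  exact h2.symm

theorem Function.Even.shift_neg (hv : Function.Even v) (s τ : ℝ) : v (-s + τ) = v (s + -τ) := by
  rw [← hv (s + -τ)]; congr 1; ring

theorem Function.Even.taylorGap_neg (hv : Function.Even v) (τ s : ℝ) :
    taylorGap v τ (-s) = taylorGap v (-τ) s := by
  rw [taylorGap, taylorGap, hv.shift_neg, hv, hv.deriv_neg]; ring

theorem Function.Even.relDistLin_neg (hv : Function.Even v) (θ τ s : ℝ) :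
    relDistLin lam v θ τ (-s) = relDistLin lam v θ (-τ) s := by
  rw [relDistLin, relDistLin, hv.shift_neg, hv, angularCoeff_neg]

theorem Function.Even.gapDensity_neg (hv : Function.Even v) (θ τ s : ℝ) :
    gapDensity lam v θ τ (-s) = gapDensity lam v θ (-τ) s := by
  have h1 : deriv v (-s + τ) ^ 2 = deriv v (s + -τ) ^ 2 := by
    rw [← neg_sq (deriv v (s + -τ)), ← hv.deriv_neg]; congr 2; ring
  have h2 : relDistQuad lam v θ τ (-s) = relDistQuad lam v θ (-τ) s := by
    rw [relDistQuad, relDistQuad, hv.shift_neg, hv, angularCoeff_neg, axialCoeff_neg, div_neg,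
      neg_mul_neg]
  rw [gapDensity, gapDensity, h1, hv.shift_neg, relDist, relDist, hv.relDistLin_neg, h2]

theorem Function.Even.integral_stripIntegrand_neg (hv : Function.Even v) (s : ℝ) :
    ∫ q, stripIntegrand lam v (-s) q ∂strip = ∫ q, stripIntegrand lam v s q ∂strip := by
  rw [← integral_strip_comp_neg (stripIntegrand lam v s)]
  refine integral_congr_ae (Eventually.of_forall fun q => ?_)
  simp only [stripIntegrand, hv.taylorGap_neg, hv.gapDensity_neg, hv.shift_neg, cylKernel_neg,
    regKernel_neg]

theorem Function.Even.linField (hv : Function.Even v) : Function.Even (linField lam v) := fun s => by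
  rw [_root_.linField, _root_.linField, ← integral_strip_comp_neg (linIntegrand lam v s)]
  refine integral_congr_ae (Eventually.of_forall fun q => ?_)
  simp only [linIntegrand, linRegDensity, hv.taylorGap_neg, hv.relDistLin_neg, hv.shift_neg,
    cylKernel_neg, regKernel_neg]

theorem Function.Periodic.shift_add {c : ℝ} (hv : Function.Periodic v c) (s τ : ℝ) :
    v (s + c + τ) = v (s + τ) := by
  rw [add_right_comm]; exact hv _

theorem Function.Periodic.stripIntegrand {c : ℝ} (hv : Function.Periodic v c) (s : ℝ)
    (q : ℝ × ℝ) : stripIntegrand lam v (s + c) q = stripIntegrand lam v s q := by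
  have h : deriv v (s + c + q.1) = deriv v (s + q.1) := by
    rw [add_right_comm]; exact hv.deriv_add _
  simp only [_root_.stripIntegrand, gapDensity, relDist, relDistLin, relDistQuad, taylorGap,
    hv.shift_add, hv s, h, hv.deriv_add]

theorem Function.Periodic.linField {c : ℝ} (hv : Function.Periodic v c) :
    Function.Periodic (linField lam v) c := fun s => by
  simp only [_root_.linField, linIntegrand, linRegDensity, relDistLin, taylorGap,
    hv.shift_add, hv s, hv.deriv_add]

end

/-! ### Fréchet differentiability at the cylinder -/

section
variable {α : ℝ≥0} {M lam : ℝ}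

namespace HolderPE

theorem coe_sub {j : ℕ} (u v : HolderPE j α) (s : ℝ) : (u - v : HolderPE j α) s = u s - v s := rfl

theorem iSup_le_norm {j i : ℕ} (u : HolderPE j α) (hi : i ≤ j) (s : ℝ) :
    |iteratedDeriv i u s| ≤ ‖u‖ := by
  rw [norm_def]
  have h1 := le_ciSup (bddAbove u hi) s
  have h2 : (⨆ s, |iteratedDeriv i u s|) ≤ ∑ i ∈ Finset.range (j + 1), ⨆ s, |iteratedDeriv i u s| :=
    Finset.single_le_sum (f := fun i => ⨆ s, |iteratedDeriv i u s|)
      (fun i _ => Real.iSup_nonneg fun s => abs_nonneg _)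
      (Finset.mem_range.2 (Nat.lt_succ_of_le hi))
  have h3 := NNReal.coe_nonneg (nnHolderNorm α (iteratedDeriv j u))
  linarith

theorem holder_le_norm {j : ℕ} (u : HolderPE j α) (s t : ℝ) :
    |iteratedDeriv j u s - iteratedDeriv j u t| ≤ ‖u‖ * |s - t| ^ (α : ℝ) := by
  have h1 := u.spec.2.1.holderWith.dist_le s t
  rw [Real.dist_eq, Real.dist_eq] at h1
  refine h1.trans (mul_le_mul_of_nonneg_right ?_ (by positivity))
  rw [norm_def]
  have : 0 ≤ ∑ i ∈ Finset.range (j + 1), ⨆ s, |iteratedDeriv i u s| :=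
    Finset.sum_nonneg fun i _ => Real.iSup_nonneg fun s => abs_nonneg _
  linarith

theorem holderC2 (v : HolderPE 2 α) : HolderC2 α ‖v‖ v := by
  have h1 : ContDiff ℝ 2 (v : ℝ → ℝ) := v.spec.1
  have h2 : iteratedDeriv 2 (v : ℝ → ℝ) = deriv (deriv v) := by
    rw [iteratedDeriv_succ, iteratedDeriv_one]
  have hd : ContDiff ℝ 1 (deriv (v : ℝ → ℝ)) := ContDiff.deriv' (n := 1) (by norm_num; exact h1)
  refine ⟨h1.differentiable (by norm_num), fun s => ?_, ⟨hd.differentiable (by norm_num),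
    fun s => ?_, fun s => ?_, fun s t => ?_⟩⟩
  · simpa using v.iSup_le_norm (i := 0) (by norm_num) s
  · simpa using v.iSup_le_norm (i := 1) (by norm_num) s
  · simpa [h2] using v.iSup_le_norm (i := 2) le_rfl s
  · simpa [h2] using v.holder_le_norm s t

end HolderPE

theorem holderWith_of_abs_sub_le {f : ℝ → ℝ} (hM : 0 ≤ M)
    (h : ∀ s t, |f s - f t| ≤ M * |s - t| ^ (α : ℝ)) : HolderWith M.toNNReal α f := fun s t => by
  rw [edist_dist, edist_dist, ENNReal.ofReal_rpow_of_nonneg dist_nonneg α.coe_nonneg]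
  change _ ≤ ENNReal.ofReal M * _
  rw [← ENNReal.ofReal_mul hM]
  exact ENNReal.ofReal_le_ofReal (by rw [Real.dist_eq, Real.dist_eq]; exact h s t)

theorem HolderC1.mem_evenPeriodicHolder {u : ℝ → ℝ} (hα0 : 0 < α) (hu : HolderC1 α M u)
    (he : Function.Even u) (hp : Function.Periodic u (2 * π)) : u ∈ evenPeriodicHolder 1 α := by
  have hM := hu.nonneg
  have hH : HolderWith M.toNNReal α (deriv u) := holderWith_of_abs_sub_le hM hu.holder
  refine ⟨contDiff_one_iff_deriv.2 ⟨hu.diff, hH.continuous hα0⟩, ?_, he, hp⟩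
  rw [iteratedDeriv_one]
  exact hH.memHolder

theorem HolderPE.norm_le_of_holderC1 (u : HolderPE 1 α) (hu : HolderC1 α M u) :
    ‖u‖ ≤ 3 * M := by
  have hM := hu.nonneg
  have hH : HolderWith M.toNNReal α (deriv u) := holderWith_of_abs_sub_le hM hu.holder
  have h3 : (nnHolderNorm α (deriv (u : ℝ → ℝ)) : ℝ) ≤ M :=
    (NNReal.coe_le_coe.2 hH.nnholderNorm_le).trans (Real.coe_toNNReal M hM).le
  rw [HolderPE.norm_def, Finset.sum_range_succ, Finset.sum_range_one]
  simp only [iteratedDeriv_zero, iteratedDeriv_one]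
  have h1 : (⨆ s, |u s|) ≤ M := ciSup_le hu.bound
  have h2 : (⨆ s, |deriv u s|) ≤ M := ciSup_le hu.deriv_bound
  linarith

theorem fieldOperator_apply {φ : HolderPE 2 α} (h : fieldFun φ ∈ evenPeriodicHolder 1 α) (s : ℝ) :
    fieldOperator α φ s = fieldFun φ s := by
  have e : fieldOperator α φ = ⟨fieldFun φ, h⟩ := dif_pos h
  rw [e]

theorem linIntegrand_add {a N N' : ℝ} {u v : ℝ → ℝ} (hu : HolderC2 a N u) (hv : HolderC2 a N' v)
    (s : ℝ) (q : ℝ × ℝ) :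
    linIntegrand lam (u + v) s q = linIntegrand lam u s q + linIntegrand lam v s q := by
  simp only [linIntegrand, linRegDensity, relDistLin, taylorGap, deriv_add (hu.diff s) (hv.diff s),
    Pi.add_apply]
  ring

theorem linIntegrand_smul (c : ℝ) (v : ℝ → ℝ) (s : ℝ) (q : ℝ × ℝ) :
    linIntegrand lam (c • v) s q = c * linIntegrand lam v s q := by
  simp only [linIntegrand, linRegDensity, relDistLin, taylorGap, deriv_const_smul_field,
    Pi.smul_apply, smul_eq_mul]
  ring

/-- The linearized field as a bounded operator from `C^{2,α}` to `C^{1,α}`. -/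
theorem exists_linFieldOperator (hlam : 0 < lam) (hα0 : 0 < α) (hα1 : α < 1) :
    ∃ L : HolderPE 2 α →L[ℝ] HolderPE 1 α, ∀ v s, L v s = linField lam v s := by
  have ha0 : (0 : ℝ) < α := hα0
  have ha1 : (α : ℝ) < 1 := by exact_mod_cast hα1
  obtain ⟨ε, C, -, hC, hlin, -⟩ := exists_fieldFun_expansion hlam ha0 ha1
  refine ⟨LinearMap.mkContinuous
    { toFun := fun v => ⟨linField lam v, (hlin _ _ v.holderC2).mem_evenPeriodicHolder hα0
        v.spec.2.2.1.linField v.spec.2.2.2.linField⟩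
      map_add' := fun u v => HolderPE.ext fun s => ?_
      map_smul' := fun c v => HolderPE.ext fun s => ?_ } (3 * C) fun v => ?_, fun v s => rfl⟩
  · have h := integral_add (integrable_linIntegrand hlam ha0 ha1 u.holderC2 s)
      (integrable_linIntegrand hlam ha0 ha1 v.holderC2 s)
    refine Eq.trans (integral_congr_ae (Eventually.of_forall fun q => ?_)) h
    exact linIntegrand_add u.holderC2 v.holderC2 s q
  · refine Eq.trans (integral_congr_ae (Eventually.of_forall fun q => ?_))
      (integral_const_mul c (linIntegrand lam v s))
    exact linIntegrand_smul c v s q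
  · refine (HolderPE.norm_le_of_holderC1 _ (hlin _ _ v.holderC2)).trans (le_of_eq ?_)
    ring

/-- The field operator is defined near the cylinder, it is differentiable there, and its
linearization is `-lam` times the linearized field. -/
theorem fieldOperator_differentiableAt (hlam : 0 < lam) (hα0 : 0 < α) (hα1 : α < 1) :
    (∀ᶠ φ : HolderPE 2 α in 𝓝 (constMode 2 α lam),
      (∀ s, 0 < φ s) ∧
      (∀ s, Integrable (fieldIntegrand φ (s, 0)) (surfaceMeasure φ)) ∧
      fieldFun φ ∈ evenPeriodicHolder 1 α) ∧
    DifferentiableAt ℝ (fieldOperator α) (constMode 2 α lam) ∧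
    ∀ v s, linearization α lam v s = -lam * linField lam v s := by
  have ha0 : (0 : ℝ) < α := hα0
  have ha1 : (α : ℝ) < 1 := by exact_mod_cast hα1
  obtain ⟨ε, C, hε, hC, hlin, hexp⟩ := exists_fieldFun_expansion hlam ha0 ha1
  obtain ⟨L, hL⟩ := exists_linFieldOperator (α := α) hlam hα0 hα1
  -- for `v = 0` the error of the expansion vanishes
  have hzero : ∀ s, fieldFun (fun _ => lam) s = -(2 * π) := fun s => by
    have h0 := (0 : HolderPE 2 α).holderC2
    rw [norm_zero] at h0
    have h1 := ((hexp 0 _ hε.le h0).2.2.2).bound s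
    have h2 := (hlin 0 _ h0).bound s
    simp only [HolderPE.coe_zero, Pi.zero_apply, add_zero, ne_eq, OfNat.ofNat_ne_zero,
      not_false_eq_true, zero_pow, mul_zero, abs_nonpos_iff] at h1 h2
    linarith
  -- near the cylinder the field is in the target space, so that `fieldOperator` does not take its
  -- default value
  have hmem : ∀ v : HolderPE 2 α, ‖v‖ ≤ ε →
      fieldFun (fun s => lam + v s) ∈ evenPeriodicHolder 1 α := fun v hv => by
    obtain ⟨-, -, hf, hr⟩ := hexp _ _ hv v.holderC2
    have h2π : HolderC1 (α : ℝ) |-(2 * π)| (fun _ => -(2 * π)) := HolderC1.const _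
    have h := (hr.add ((hlin _ _ v.holderC2).add h2π)).congr
      (w := fieldFun (fun s => lam + v s)) fun s => by ring
    refine h.mem_evenPeriodicHolder hα0 (fun s => ?_) (fun s => ?_)
    · rw [hf, hf, v.spec.2.2.1.integral_stripIntegrand_neg, v.spec.2.2.1.deriv_neg, neg_sq]
    · rw [hf, hf, v.spec.2.2.2.deriv_add]
      simp only [v.spec.2.2.2.stripIntegrand]
  have hval : ∀ v : HolderPE 2 α, ‖v‖ ≤ ε → ∀ s,
      fieldOperator α (constMode 2 α lam + v) s = fieldFun (fun s => lam + v s) s := fun v hv s =>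
    fieldOperator_apply (φ := constMode 2 α lam + v) (hmem v hv) s
  have hval0 : ∀ s, fieldOperator α (constMode 2 α lam) s = -(2 * π) := fun s => by
    have h := hval 0 (by rw [norm_zero]; exact hε.le) s
    rw [add_zero] at h
    rw [h, ← hzero s]
    simp [HolderPE.coe_zero]
  have hball : ∀ᶠ v : HolderPE 2 α in 𝓝 0, ‖v‖ ≤ ε := by
    filter_upwards [Metric.closedBall_mem_nhds (0 : HolderPE 2 α) hε] with v hv
    simpa using hv
  have hderiv : HasFDerivAt (fieldOperator α) L (constMode 2 α lam) := by
    rw [hasFDerivAt_iff_isLittleO_nhds_zero]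
    have hO : (fun v => fieldOperator α (constMode 2 α lam + v) - fieldOperator α (constMode 2 α lam)
        - L v) =O[𝓝 0] fun v : HolderPE 2 α => ‖v‖ ^ 2 := by
      refine Asymptotics.IsBigO.of_bound (3 * C) ?_
      filter_upwards [hball] with v hv
      have h := (hexp _ _ hv v.holderC2).2.2.2
      refine (HolderPE.norm_le_of_holderC1 _ (h.congr fun s => ?_)).trans (le_of_eq ?_)
      · rw [HolderPE.coe_sub, HolderPE.coe_sub, hval v hv, hval0, hL]; ring
      · rw [Real.norm_of_nonneg (sq_nonneg _)]; ring
    refine hO.trans_isLittleO ?_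
    have := Asymptotics.isLittleO_norm_pow_id (E' := HolderPE 2 α) one_lt_two
    exact this
  refine ⟨?_, hderiv.differentiableAt, fun v s => ?_⟩
  · have hsub : Tendsto (fun φ : HolderPE 2 α => φ - constMode 2 α lam) (𝓝 (constMode 2 α lam))
        (𝓝 0) := by
      have h : Continuous fun φ : HolderPE 2 α => φ - constMode 2 α lam := continuous_sub_right _
      simpa using h.tendsto (constMode 2 α lam)
    filter_upwards [hsub.eventually hball] with φ hφ
    have e : (fun s => lam + (φ - constMode 2 α lam : HolderPE 2 α) s) = (φ : ℝ → ℝ) := by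
      funext s
      rw [HolderPE.coe_sub]
      exact add_sub_cancel lam (φ s)
    obtain ⟨h1, h2, -, -⟩ := hexp _ _ hφ (φ - constMode 2 α lam).holderC2
    have h3 := hmem _ hφ
    rw [e] at h2 h3
    exact ⟨fun s => by rw [← e]; exact h1 s, h2, h3⟩
  · rw [linearization, hderiv.fderiv]
    change -lam * (L v) s = _
    rw [hL]

end

/-! ### The functions `I_0` and `I_1` -/

/-- The integral `∫ cos^n θ exp(x cos θ) dθ` over a period, which is `2π I_n(x)` for `n = 0, 1`. -/
noncomputable def cosExpIntegral (n : ℕ) (x : ℝ) : ℝ :=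
  ∫ θ in (-π)..π, Real.cos θ ^ n * Real.exp (x * Real.cos θ)

theorem hasDerivAt_cosExpIntegral (n : ℕ) (x : ℝ) :
    HasDerivAt (cosExpIntegral n) (cosExpIntegral (n + 1) x) x := by
  have hc : ∀ (n : ℕ) (x : ℝ), Continuous fun θ => Real.cos θ ^ n * Real.exp (x * Real.cos θ) :=
    fun n x => by fun_prop
  refine (intervalIntegral.hasDerivAt_integral_of_dominated_loc_of_deriv_le (𝕜 := ℝ)
    (F := fun x θ => Real.cos θ ^ n * Real.exp (x * Real.cos θ))
    (F' := fun x θ => Real.cos θ ^ (n + 1) * Real.exp (x * Real.cos θ))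
    (s := Metric.ball x 1) (bound := fun _ => Real.exp (|x| + 1)) (Metric.ball_mem_nhds x one_pos)
    (Eventually.of_forall fun y => (hc n y).aestronglyMeasurable)
    ((hc n x).intervalIntegrable _ _) (hc (n + 1) x).aestronglyMeasurable
    (Eventually.of_forall fun θ _ y hy => ?_) intervalIntegrable_const
    (Eventually.of_forall fun θ _ y _ => ?_)).2
  · have h1 : |y| ≤ |x| + 1 := by
      have h2 : |y - x| < 1 := hy
      have h3 := abs_add_le (y - x) x
      rw [sub_add_cancel] at h3
      linarith
    have h4 : y * Real.cos θ ≤ |x| + 1 := by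
      refine (le_abs_self _).trans ?_
      rw [abs_mul]
      have := Real.abs_cos_le_one θ
      nlinarith [abs_nonneg y, abs_nonneg (Real.cos θ)]
    rw [norm_mul, norm_pow, Real.norm_eq_abs, Real.norm_eq_abs, Real.abs_exp]
    have h5 : |Real.cos θ| ^ (n + 1) ≤ 1 := pow_le_one₀ (abs_nonneg _) (Real.abs_cos_le_one θ)
    have h6 := Real.exp_le_exp.2 h4
    have h7 := mul_le_mul h5 h6 (Real.exp_pos _).le zero_le_one
    linarith
  · have h1 : HasDerivAt (fun y : ℝ => y * Real.cos θ) (Real.cos θ) y := by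
      simpa using (hasDerivAt_id y).mul_const (Real.cos θ)
    refine (h1.exp.const_mul (Real.cos θ ^ n)).congr_deriv ?_
    ring

/-- The differential equation `x I_0'' + I_0' = x I_0`, integrated by parts. -/
theorem mul_cosExpIntegral_two (x : ℝ) :
    x * cosExpIntegral 2 x + cosExpIntegral 1 x = x * cosExpIntegral 0 x := by
  have hd : ∀ θ : ℝ, HasDerivAt (fun θ => Real.sin θ * Real.exp (x * Real.cos θ))
      (x * (Real.cos θ ^ 2 * Real.exp (x * Real.cos θ))
        + Real.cos θ ^ 1 * Real.exp (x * Real.cos θ)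
        - x * (Real.cos θ ^ 0 * Real.exp (x * Real.cos θ))) θ := fun θ => by
    refine ((Real.hasDerivAt_sin θ).fun_mul
      (((Real.hasDerivAt_cos θ).const_mul x).exp)).congr_deriv ?_
    have := Real.sin_sq_add_cos_sq θ
    linear_combination -(x * Real.exp (x * Real.cos θ)) * this
  have hc : ∀ (n : ℕ), IntervalIntegrable (fun θ => Real.cos θ ^ n * Real.exp (x * Real.cos θ))
      volume (-π) π := fun n => Continuous.intervalIntegrable (by fun_prop) _ _
  have h := intervalIntegral.integral_eq_sub_of_hasDerivAt (fun θ _ => hd θ)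
    ((((hc 2).const_mul x).add (hc 1)).sub ((hc 0).const_mul x))
  rw [intervalIntegral.integral_sub (((hc 2).const_mul x).add (hc 1)) ((hc 0).const_mul x),
    intervalIntegral.integral_add ((hc 2).const_mul x) (hc 1),
    intervalIntegral.integral_const_mul, intervalIntegral.integral_const_mul] at h
  simp only [Real.sin_pi, Real.sin_neg, neg_zero, zero_mul, sub_zero] at h
  unfold cosExpIntegral
  linarith

/-- Wallis integrals, by the reduction formula for powers of the cosine. -/
theorem integral_cos_pow_period (m : ℕ) :
    ∫ θ in (-π)..π, Real.cos θ ^ (2 * m) = 2 * π * ((2 * m).factorial / (4 ^ m * m.factorial ^ 2)) ∧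
      ∫ θ in (-π)..π, Real.cos θ ^ (2 * m + 1) = 0 := by
  induction m with
  | zero =>
    refine ⟨?_, by simp⟩
    simp; ring
  | succ m ih =>
    have e1 : 2 * (m + 1) = 2 * m + 2 := by ring
    have e2 : 2 * (m + 1) + 1 = (2 * m + 1) + 2 := by ring
    refine ⟨?_, ?_⟩
    · rw [e1, integral_cos_pow, ih.1]
      simp only [Real.sin_pi, Real.sin_neg, neg_zero, mul_zero, sub_zero, zero_div, zero_add,
        Nat.factorial_succ, pow_succ]
      push_cast
      have := Nat.cast_ne_zero (R := ℝ).2 (Nat.factorial_ne_zero m)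
      field_simp
      ring
    · rw [e2, integral_cos_pow, ih.2]
      simp

/-- Integration of the exponential series term by term. -/
theorem hasSum_cosExpIntegral (n : ℕ) (x : ℝ) :
    HasSum (fun j : ℕ => x ^ j / j.factorial * ∫ θ in (-π)..π, Real.cos θ ^ (j + n))
      (cosExpIntegral n x) := by
  have h := intervalIntegral.hasSum_integral_of_dominated_convergence (a := -π) (b := π)
    (μ := volume)
    (F := fun (j : ℕ) θ => x ^ j / j.factorial * Real.cos θ ^ (j + n))
    (f := fun θ => Real.cos θ ^ n * Real.exp (x * Real.cos θ))
    (fun j _ => |x| ^ j / j.factorial)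
    (fun j => Continuous.aestronglyMeasurable (by fun_prop))
    (fun j => Eventually.of_forall fun θ _ => ?_)
    (Eventually.of_forall fun θ _ => Real.summable_pow_div_factorial |x|)
    intervalIntegrable_const (Eventually.of_forall fun θ _ => ?_)
  · unfold cosExpIntegral
    simpa only [intervalIntegral.integral_const_mul] using! h
  · rw [norm_mul, norm_div, norm_pow, norm_pow, Real.norm_eq_abs, Real.norm_eq_abs,
      Real.norm_eq_abs, Nat.abs_cast]
    exact mul_le_of_le_one_right (by positivity)
      (pow_le_one₀ (abs_nonneg _) (Real.abs_cos_le_one θ))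
  · have h1 := (NormedSpace.expSeries_div_hasSum_exp (x * Real.cos θ)).mul_left (Real.cos θ ^ n)
    rw [← Real.exp_eq_exp_ℝ] at h1
    refine h1.congr_fun fun j => ?_
    rw [mul_pow, pow_add]; ring

/-- Only the odd powers of `x` survive in the series of `cosExpIntegral 1`, and they give the series
of `I_1`. -/
theorem besselI_one_eq {x : ℝ} (hx : 0 < x) : besselI 1 x = cosExpIntegral 1 x / (2 * π) := by
  have hinj : Function.Injective fun m : ℕ => 2 * m + 1 := fun a b h => by
    simpa using h
  have h := hasSum_cosExpIntegral 1 x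
  rw [← hinj.hasSum_iff] at h
  · rw [besselI, ← (h.div_const (2 * π)).tsum_eq]
    refine tsum_congr fun m => ?_
    simp only [Function.comp_apply]
    rw [show 2 * m + 1 + 1 = 2 * (m + 1) by ring, (integral_cos_pow_period (m + 1)).1,
      show (1 : ℝ) + m + 1 = ((m + 1 : ℕ) : ℝ) + 1 by push_cast; ring,
      Real.Gamma_nat_eq_factorial, show (1 + 2 * m : ℝ) = ((2 * m + 1 : ℕ) : ℝ) by push_cast; ring,
      Real.rpow_natCast, div_pow, show 2 * (m + 1) = 2 * m + 1 + 1 by ring,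
      Nat.factorial_succ (2 * m + 1), Nat.factorial_succ m,
      show (2 : ℝ) ^ (2 * m + 1) = 2 * 4 ^ m by rw [pow_succ, pow_mul]; norm_num; ring]
    push_cast
    have := Nat.cast_ne_zero (R := ℝ).2 (Nat.factorial_ne_zero m)
    have := Nat.cast_ne_zero (R := ℝ).2 (Nat.factorial_ne_zero (2 * m + 1))
    have := Real.pi_ne_zero
    field_simp
    ring
  · intro j hj
    rcases Nat.even_or_odd' j with ⟨m, rfl | rfl⟩
    · rw [(integral_cos_pow_period m).2, mul_zero]
    · exact absurd ⟨m, rfl⟩ hj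

/-! ### The functions `K_0` and `K_1` -/

/-- The integral `∫ cosh^n t exp(-x cosh t) dt` over `(0, ∞)`, which is `K_n(x)` for `n = 0, 1`. -/
noncomputable def coshExpIntegral (n : ℕ) (x : ℝ) : ℝ :=
  ∫ t in Set.Ioi (0 : ℝ), Real.cosh t ^ n * Real.exp (-x * Real.cosh t)

theorem besselK_zero_eq (x : ℝ) : besselK 0 x = coshExpIntegral 0 x := by
  simp [besselK, coshExpIntegral]

theorem besselK_one_eq (x : ℝ) : besselK 1 x = coshExpIntegral 1 x := by
  simp [besselK, coshExpIntegral, mul_comm]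

theorem exp_le_two_mul_cosh (t : ℝ) : Real.exp t ≤ 2 * Real.cosh t := by
  rw [Real.cosh_eq]; linarith [Real.exp_pos (-t)]

/-- A majorant obtained from `y ^ (n + 1) / (n + 1)! ≤ exp y` at `y = x cosh t`. -/
theorem cosh_pow_mul_exp_le (n : ℕ) {x : ℝ} (hx : 0 < x) (t : ℝ) :
    Real.cosh t ^ n * Real.exp (-x * Real.cosh t)
      ≤ 2 * (n + 1).factorial / x ^ (n + 1) * Real.exp (-t) := by
  have hc := Real.cosh_pos t
  have h1 := Real.pow_div_factorial_le_exp (x * Real.cosh t) (by positivity) (n + 1)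
  rw [div_le_iff₀ (by positivity)] at h1
  have h2 := exp_le_two_mul_cosh t
  rw [neg_mul, Real.exp_neg, Real.exp_neg, ← div_eq_mul_inv, ← div_eq_mul_inv, div_div,
    div_le_div_iff₀ (Real.exp_pos _) (mul_pos (by positivity) (Real.exp_pos _))]
  calc Real.cosh t ^ n * (x ^ (n + 1) * Real.exp t)
      ≤ Real.cosh t ^ n * (x ^ (n + 1) * (2 * Real.cosh t)) := by gcongr
    _ = 2 * (x * Real.cosh t) ^ (n + 1) := by ring
    _ ≤ 2 * (Real.exp (x * Real.cosh t) * (n + 1).factorial) := by gcongr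
    _ = 2 * (n + 1).factorial * Real.exp (x * Real.cosh t) := by ring

theorem continuous_cosh_pow_mul_exp (n : ℕ) (x : ℝ) :
    Continuous fun t => Real.cosh t ^ n * Real.exp (-x * Real.cosh t) := by
  have := Real.continuous_cosh
  fun_prop

theorem integrableOn_cosh_pow_mul_exp (n : ℕ) {x : ℝ} (hx : 0 < x) :
    IntegrableOn (fun t => Real.cosh t ^ n * Real.exp (-x * Real.cosh t)) (Set.Ioi 0) := by
  refine ((integrableOn_exp_neg_Ioi 0).const_mul (2 * (n + 1).factorial / x ^ (n + 1))).mono'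
    (continuous_cosh_pow_mul_exp n x).aestronglyMeasurable (Eventually.of_forall fun t => ?_)
  have hc := Real.cosh_pos t
  rw [Real.norm_of_nonneg (by positivity)]
  exact cosh_pow_mul_exp_le n hx t

theorem coshExpIntegral_nonneg (n : ℕ) (x : ℝ) : 0 ≤ coshExpIntegral n x :=
  integral_nonneg fun t => by have := Real.cosh_pos t; positivity

theorem coshExpIntegral_le (n : ℕ) {x : ℝ} (hx : 0 < x) :
    coshExpIntegral n x ≤ 2 * (n + 1).factorial / x ^ (n + 1) := by
  refine (setIntegral_mono (integrableOn_cosh_pow_mul_exp n hx)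
    ((integrableOn_exp_neg_Ioi 0).const_mul _) fun t => cosh_pow_mul_exp_le n hx t).trans ?_
  rw [integral_const_mul, integral_exp_neg_Ioi_zero, mul_one]

theorem hasDerivAt_coshExpIntegral (n : ℕ) {x : ℝ} (hx : 0 < x) :
    HasDerivAt (coshExpIntegral n) (-coshExpIntegral (n + 1) x) x := by
  have h := (hasDerivAt_integral_of_dominated_loc_of_deriv_le (𝕜 := ℝ)
    (μ := volume.restrict (Set.Ioi (0 : ℝ)))
    (F := fun x t => Real.cosh t ^ n * Real.exp (-x * Real.cosh t))
    (F' := fun x t => -(Real.cosh t ^ (n + 1) * Real.exp (-x * Real.cosh t)))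
    (s := Set.Ioi (x / 2))
    (bound := fun t => Real.cosh t ^ (n + 1) * Real.exp (-(x / 2) * Real.cosh t))
    (Ioi_mem_nhds (by linarith))
    (Eventually.of_forall fun y => (continuous_cosh_pow_mul_exp n y).aestronglyMeasurable)
    (integrableOn_cosh_pow_mul_exp n hx)
    (continuous_cosh_pow_mul_exp (n + 1) x).neg.aestronglyMeasurable
    (Eventually.of_forall fun t y hy => ?_) (integrableOn_cosh_pow_mul_exp (n + 1) (half_pos hx))
    (Eventually.of_forall fun t y _ => ?_)).2
  · rwa [integral_neg] at h
  · have hc := Real.cosh_pos t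
    rw [norm_neg, Real.norm_of_nonneg (by positivity)]
    have : x / 2 ≤ y := (Set.mem_Ioi.1 hy).le
    gcongr
  · have h1 : HasDerivAt (fun y : ℝ => -y * Real.cosh t) (-Real.cosh t) y := by
      simpa using ((hasDerivAt_id y).neg.mul_const (Real.cosh t))
    refine (h1.exp.const_mul (Real.cosh t ^ n)).congr_deriv ?_
    ring

/-- The differential equation `x K_0'' + K_0' = x K_0`, integrated by parts. -/
theorem mul_coshExpIntegral_two {x : ℝ} (hx : 0 < x) :
    x * coshExpIntegral 2 x - coshExpIntegral 1 x = x * coshExpIntegral 0 x := by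
  have hd : ∀ t : ℝ, HasDerivAt (fun t => Real.sinh t * Real.exp (-x * Real.cosh t))
      (Real.cosh t ^ 1 * Real.exp (-x * Real.cosh t)
        - x * (Real.cosh t ^ 2 * Real.exp (-x * Real.cosh t))
        + x * (Real.cosh t ^ 0 * Real.exp (-x * Real.cosh t))) t := fun t => by
    refine ((Real.hasDerivAt_sinh t).fun_mul
      (((Real.hasDerivAt_cosh t).const_mul (-x)).exp)).congr_deriv ?_
    have := Real.cosh_sq t
    linear_combination (x * Real.exp (-x * Real.cosh t)) * this
  have hi : IntegrableOn (fun t => Real.cosh t ^ 1 * Real.exp (-x * Real.cosh t)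
        - x * (Real.cosh t ^ 2 * Real.exp (-x * Real.cosh t))
        + x * (Real.cosh t ^ 0 * Real.exp (-x * Real.cosh t))) (Set.Ioi 0) :=
    ((integrableOn_cosh_pow_mul_exp 1 hx).sub
      ((integrableOn_cosh_pow_mul_exp 2 hx).const_mul x)).add
      ((integrableOn_cosh_pow_mul_exp 0 hx).const_mul x)
  have hlim : Tendsto (fun t => Real.sinh t * Real.exp (-x * Real.cosh t)) atTop (𝓝 0) := by
    refine squeeze_zero_norm (a := fun t => 2 * (1 + 1).factorial / x ^ (1 + 1) * Real.exp (-t))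
      (fun t => ?_) ?_
    · refine le_trans ?_ (cosh_pow_mul_exp_le 1 hx t)
      rw [norm_mul, Real.norm_eq_abs, Real.norm_eq_abs, Real.abs_exp, pow_one]
      refine mul_le_mul_of_nonneg_right ?_ (Real.exp_pos _).le
      refine abs_le_of_sq_le_sq ?_ (Real.cosh_pos t).le
      rw [Real.cosh_sq]; linarith
    · have := Real.tendsto_exp_neg_atTop_nhds_zero.const_mul
        (2 * ((1 + 1).factorial : ℝ) / x ^ (1 + 1))
      rw [mul_zero] at this
      exact this
  have h := integral_Ioi_of_hasDerivAt_of_tendsto' (a := 0) (fun t _ => hd t) hi hlim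
  have e1 := integral_add ((integrableOn_cosh_pow_mul_exp 1 hx).sub
      ((integrableOn_cosh_pow_mul_exp 2 hx).const_mul x))
      ((integrableOn_cosh_pow_mul_exp 0 hx).const_mul x)
  have e2 := integral_sub (integrableOn_cosh_pow_mul_exp 1 hx)
      ((integrableOn_cosh_pow_mul_exp 2 hx).const_mul x)
  simp only [Pi.sub_apply] at e1
  rw [e1, e2, integral_const_mul, integral_const_mul, Real.sinh_zero, zero_mul, sub_zero] at h
  unfold coshExpIntegral
  linarith

/-- `K_0(x) = O(x^(-1/4))`.  (Its singularity at the origin is logarithmic.) -/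
theorem exists_coshExpIntegral_zero_le :
    ∃ C, 0 ≤ C ∧ ∀ x : ℝ, 0 < x → coshExpIntegral 0 x ≤ C * x ^ (-(1 / 4) : ℝ) := by
  have hi : IntegrableOn (fun t : ℝ => 2 * Real.exp (-(1 / 4) * t)) (Set.Ioi 0) :=
    (integrableOn_exp_mul_Ioi (by norm_num) 0).const_mul 2
  refine ⟨∫ t in Set.Ioi (0 : ℝ), 2 * Real.exp (-(1 / 4) * t),
    integral_nonneg fun t => by positivity, fun x hx => ?_⟩
  rw [← integral_mul_const]
  refine setIntegral_mono (integrableOn_cosh_pow_mul_exp 0 hx) (hi.mul_const _) fun t => ?_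
  have hc := Real.cosh_pos t
  have hy : 0 < x * Real.cosh t := by positivity
  -- `exp(-y) ≤ y^(-1/4)` and `cosh t ≥ e^t / 2`
  have h1 : (x * Real.cosh t) ^ (1 / 4 : ℝ) ≤ Real.exp (x * Real.cosh t) := by
    refine le_trans ?_ (Real.add_one_le_exp _)
    rcases le_total (x * Real.cosh t) 1 with h | h
    · exact (Real.rpow_le_one hy.le h (by norm_num)).trans (by linarith)
    · refine (Real.rpow_le_rpow_of_exponent_le h (by norm_num : (1 / 4 : ℝ) ≤ 1)).trans ?_
      rw [Real.rpow_one]; linarith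
  have h2 : Real.exp (-x * Real.cosh t) ≤ (x * Real.cosh t) ^ (-(1 / 4) : ℝ) := by
    rw [neg_mul, Real.exp_neg, Real.rpow_neg hy.le]
    exact inv_anti₀ (by positivity) h1
  have h3 : Real.cosh t ^ (-(1 / 4) : ℝ) ≤ 2 * Real.exp (-(1 / 4) * t) := by
    have h4 : Real.exp t / 2 ≤ Real.cosh t := by linarith [exp_le_two_mul_cosh t]
    refine (Real.rpow_le_rpow_of_nonpos (by positivity) h4 (by norm_num)).trans ?_
    rw [Real.div_rpow (Real.exp_pos _).le (by norm_num), ← Real.exp_mul, mul_comm t,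
      Real.rpow_neg (by norm_num : (0 : ℝ) ≤ 2), div_inv_eq_mul, mul_comm]
    refine mul_le_mul_of_nonneg_right ?_ (Real.exp_pos _).le
    refine (Real.rpow_le_rpow_of_exponent_le one_le_two (by norm_num : (1 / 4 : ℝ) ≤ 1)).trans ?_
    rw [Real.rpow_one]
  rw [pow_zero, one_mul]
  refine h2.trans ?_
  rw [Real.mul_rpow hx.le hc.le, mul_comm]
  gcongr

theorem continuousOn_coshExpIntegral (n : ℕ) : ContinuousOn (coshExpIntegral n) (Set.Ioi 0) :=
  fun _ hx => (hasDerivAt_coshExpIntegral n hx).continuousAt.continuousWithinAt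

/-- The primitive of `x I_1 K_1`, where the functions `2π I_n` and `K_n` are written as
integrals. -/
theorem integral_mul_cosExpIntegral_mul_coshExpIntegral {ρ : ℝ} (hρ : 0 < ρ) :
    ∫ x in (0 : ℝ)..ρ, x * (cosExpIntegral 1 x * coshExpIntegral 1 x)
      = ρ ^ 2 / 2 * (cosExpIntegral 0 ρ * coshExpIntegral 0 ρ
          + cosExpIntegral 1 ρ * coshExpIntegral 1 ρ)
        - ρ * (cosExpIntegral 1 ρ * coshExpIntegral 0 ρ) := by
  set F : ℝ → ℝ := fun x => x ^ 2 / 2 * (cosExpIntegral 0 x * coshExpIntegral 0 x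
          + cosExpIntegral 1 x * coshExpIntegral 1 x)
        - x * (cosExpIntegral 1 x * coshExpIntegral 0 x) with hF
  have hderiv : ∀ x : ℝ, 0 < x →
      HasDerivAt F (x * (cosExpIntegral 1 x * coshExpIntegral 1 x)) x := fun x hx => by
    have h0 := hasDerivAt_cosExpIntegral 0 x
    have h1 := hasDerivAt_cosExpIntegral 1 x
    have k0 := hasDerivAt_coshExpIntegral 0 hx
    have k1 := hasDerivAt_coshExpIntegral 1 hx
    have e1 := mul_cosExpIntegral_two x
    have e2 := mul_coshExpIntegral_two hx
    refine (((((hasDerivAt_pow 2 x).div_const 2).fun_mul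
      ((h0.fun_mul k0).fun_add (h1.fun_mul k1)))).fun_sub
      ((hasDerivAt_id' x).fun_mul (h1.fun_mul k0))).congr_deriv ?_
    norm_num
    linear_combination (x / 2 * coshExpIntegral 1 x - coshExpIntegral 0 x) * e1
      - (x / 2 * cosExpIntegral 1 x) * e2
  have hA : ∀ n, Continuous (cosExpIntegral n) := fun n =>
    continuous_iff_continuousAt.2 fun x => (hasDerivAt_cosExpIntegral n x).continuousAt
  have hA1 : cosExpIntegral 1 0 = 0 := by simp [cosExpIntegral]
  obtain ⟨B, hB⟩ := (isCompact_Icc (a := (0 : ℝ)) (b := ρ)).exists_bound_of_continuousOn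
    (hA 2).continuousOn
  have hA1le : ∀ x ∈ Set.Icc 0 ρ, |cosExpIntegral 1 x| ≤ B * x := fun x hx => by
    have h := (convex_Icc 0 ρ).norm_image_sub_le_of_norm_hasDerivWithin_le
      (fun y _ => (hasDerivAt_cosExpIntegral 1 y).hasDerivWithinAt) hB
      (Set.left_mem_Icc.2 hρ.le) hx
    rwa [hA1, sub_zero, sub_zero, Real.norm_eq_abs, Real.norm_eq_abs, abs_of_nonneg hx.1] at h
  have hB0 : 0 ≤ B := (norm_nonneg _).trans (hB 0 (Set.left_mem_Icc.2 hρ.le))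
  have hK0 : ∀ x : ℝ, 0 < x → coshExpIntegral 0 x * x ≤ 2 := fun x hx => by
    have := coshExpIntegral_le 0 hx
    rw [le_div_iff₀ (by positivity)] at this
    simpa using this
  have hK1 : ∀ x : ℝ, 0 < x → coshExpIntegral 1 x * x ^ 2 ≤ 4 := fun x hx => by
    have := coshExpIntegral_le 1 hx
    rw [le_div_iff₀ (by positivity)] at this
    norm_num at this
    exact this
  have hint : IntervalIntegrable (fun x => x * (cosExpIntegral 1 x * coshExpIntegral 1 x))
      volume 0 ρ := by
    rw [intervalIntegrable_iff_integrableOn_Ioc_of_le hρ.le]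
    refine Integrable.of_bound ?_ (B * 4) ?_
    · have hc : ContinuousOn (fun x => x * (cosExpIntegral 1 x * coshExpIntegral 1 x))
          (Set.Ioc 0 ρ) :=
        continuousOn_id.mul ((hA 1).continuousOn.mul
          ((continuousOn_coshExpIntegral 1).mono fun x (hx : x ∈ Set.Ioc 0 ρ) => hx.1))
      exact hc.aestronglyMeasurable measurableSet_Ioc
    · refine (ae_restrict_iff' measurableSet_Ioc).2 (Eventually.of_forall fun x hx => ?_)
      have h1 := hA1le x ⟨hx.1.le, hx.2⟩
      have h2 := hK1 x hx.1
      have h3 := coshExpIntegral_nonneg 1 x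
      rw [norm_mul, norm_mul, Real.norm_of_nonneg hx.1.le, Real.norm_of_nonneg h3,
        Real.norm_eq_abs]
      calc x * (|cosExpIntegral 1 x| * coshExpIntegral 1 x)
          ≤ x * (B * x * coshExpIntegral 1 x) := by have := hx.1; gcongr
        _ = B * (coshExpIntegral 1 x * x ^ 2) := by ring
        _ ≤ B * 4 := by gcongr
  -- the singularities of `K_0` and `K_1` are compensated, since `x K_0` and `x² K_1` are bounded
  have hlim0 : Tendsto F (𝓝[>] 0) (𝓝 0) := by
    obtain ⟨B0, hB0'⟩ := (isCompact_Icc (a := (0 : ℝ)) (b := ρ)).exists_bound_of_continuousOn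
      (hA 0).continuousOn
    have hlin : Tendsto (fun x : ℝ => (B0 + 4 * B) * x) (𝓝[>] 0) (𝓝 0) := by
      have : Tendsto (fun x : ℝ => (B0 + 4 * B) * x) (𝓝 0) (𝓝 ((B0 + 4 * B) * 0)) :=
        (continuous_const.mul continuous_id).tendsto 0
      rw [mul_zero] at this
      exact this.mono_left nhdsWithin_le_nhds
    refine squeeze_zero_norm' ?_ hlin
    filter_upwards [Ioc_mem_nhdsGT hρ] with x hx
    have hx0 := hx.1
    have h0 := hB0' x ⟨hx.1.le, hx.2⟩
    have h1 := hA1le x ⟨hx.1.le, hx.2⟩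
    have k0 := hK0 x hx.1
    have k1 := hK1 x hx.1
    have k0n := coshExpIntegral_nonneg 0 x
    have k1n := coshExpIntegral_nonneg 1 x
    rw [Real.norm_eq_abs] at h0 ⊢
    have e : F x = x / 2 * (cosExpIntegral 0 x * (coshExpIntegral 0 x * x))
        + (1 / 2 * (cosExpIntegral 1 x * (coshExpIntegral 1 x * x ^ 2))
          + -(cosExpIntegral 1 x * (coshExpIntegral 0 x * x))) := by rw [hF]; ring
    rw [e]
    refine (abs_add_le _ _).trans ((add_le_add_right (abs_add_le _ _) _).trans ?_)
    simp only [abs_neg, abs_mul, abs_of_nonneg k0n, abs_of_nonneg k1n, abs_of_pos hx0, abs_div,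
      abs_two, abs_one, abs_pow]
    have m1 : x / 2 * (|cosExpIntegral 0 x| * (coshExpIntegral 0 x * x)) ≤ x / 2 * (B0 * 2) := by
      gcongr
      exact (abs_nonneg _).trans h0
    have m2 : 1 / 2 * (|cosExpIntegral 1 x| * (coshExpIntegral 1 x * x ^ 2))
        ≤ 1 / 2 * (B * x * 4) := by gcongr
    have m3 : |cosExpIntegral 1 x| * (coshExpIntegral 0 x * x) ≤ B * x * 2 := by gcongr
    linarith
  have hlimρ : Tendsto F (𝓝[<] ρ) (𝓝 (F ρ)) :=
    (hderiv ρ hρ).continuousAt.tendsto.mono_left nhdsWithin_le_nhds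
  rw [intervalIntegral.integral_eq_sub_of_hasDerivAt_of_tendsto hρ
    (fun x hx => hderiv x hx.1) hint hlim0 hlimρ, sub_zero]

/-! ### Plane waves and the addition formulas for `K_0` -/

theorem integrable_cosh_pow_mul_exp (n : ℕ) {x : ℝ} (hx : 0 < x) :
    Integrable (fun t : ℝ => Real.cosh t ^ n * Real.exp (-x * Real.cosh t)) ∧
      ∫ t : ℝ, Real.cosh t ^ n * Real.exp (-x * Real.cosh t) = 2 * coshExpIntegral n x := by
  have e : (fun t : ℝ => Real.cosh t ^ n * Real.exp (-x * Real.cosh t))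
      = fun t : ℝ => (fun t : ℝ => Real.cosh t ^ n * Real.exp (-x * Real.cosh t)) |t| := by
    funext t; simp only [Real.cosh_abs]
  refine ⟨?_, ?_⟩
  · rw [e]; exact integrable_comp_abs_of_integrableOn_Ioi (integrableOn_cosh_pow_mul_exp n hx)
  · rw [e, integral_comp_abs (f := fun t : ℝ => Real.cosh t ^ n * Real.exp (-x * Real.cosh t))]
    rfl

theorem re_cosh_add_mul_I (t ψ : ℝ) :
    (Complex.cosh (t + ψ * Complex.I)).re = Real.cosh t * Real.cos ψ := by
  rw [Complex.cosh_add, Complex.cosh_mul_I, Complex.sinh_mul_I, ← Complex.ofReal_cosh,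
    ← Complex.ofReal_sinh, ← Complex.ofReal_cos, ← Complex.ofReal_sin]
  simp only [Complex.add_re, Complex.mul_re, Complex.mul_im, Complex.ofReal_re, Complex.ofReal_im,
    Complex.I_re, Complex.I_im]
  ring

theorem norm_sinh_add_mul_I_le (t ψ : ℝ) :
    ‖Complex.sinh (t + ψ * Complex.I)‖ ≤ Real.cosh t := by
  refine abs_le_of_sq_le_sq' ?_ (Real.cosh_pos t).le |>.2
  rw [← Complex.normSq_eq_norm_sq, Complex.sinh_add, Complex.cosh_mul_I, Complex.sinh_mul_I,
    ← Complex.ofReal_cosh, ← Complex.ofReal_sinh, ← Complex.ofReal_cos, ← Complex.ofReal_sin,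
    Complex.normSq_apply]
  simp only [Complex.add_re, Complex.mul_re, Complex.ofReal_re, Complex.ofReal_im, Complex.I_re,
    Complex.I_im, Complex.add_im, Complex.mul_im]
  have h1 := Real.cosh_sq t
  have h2 := Real.sin_sq_add_cos_sq ψ
  have h3 := sq_nonneg (Real.cos ψ)
  nlinarith

/-- The integral of a plane wave does not change when the contour is moved inside the strip of
convergence. -/
theorem integral_exp_cosh_add_mul_I {R ψ : ℝ} (hR : 0 < R) (hψ : |ψ| < π / 2) :
    ∫ t : ℝ, Complex.exp (-R * Complex.cosh (t + ψ * Complex.I))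
      = (2 * coshExpIntegral 0 R : ℝ) := by
  set F : ℝ → ℝ → ℂ := fun ψ t => Complex.exp (-R * Complex.cosh (t + ψ * Complex.I)) with hF
  have hnorm : ∀ ψ t : ℝ, ‖F ψ t‖ = Real.exp (-(R * Real.cos ψ) * Real.cosh t) := fun ψ t => by
    rw [hF]
    simp only
    rw [Complex.norm_exp, ← Complex.ofReal_neg, Complex.re_ofReal_mul, re_cosh_add_mul_I]
    congr 1; ring
  have hcont : ∀ ψ, Continuous (F ψ) := fun ψ => by
    rw [hF]; fun_prop
  have hint : ∀ ψ : ℝ, 0 < Real.cos ψ → Integrable (F ψ) := fun ψ hc => by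
    have h := (integrable_cosh_pow_mul_exp 0 (mul_pos hR hc)).1
    refine h.mono' (hcont ψ).aestronglyMeasurable (Eventually.of_forall fun t => ?_)
    rw [hnorm, pow_zero, one_mul]
  set G : ℝ → ℝ → ℂ := fun ψ t => F ψ t * (-R * Complex.sinh (t + ψ * Complex.I)) with hG
  have hGle : ∀ ψ t c : ℝ, c ≤ Real.cos ψ →
      ‖G ψ t‖ ≤ R * (Real.cosh t ^ 1 * Real.exp (-(R * c) * Real.cosh t)) := fun ψ t c hc => by
    rw [hG]
    simp only
    rw [norm_mul, hnorm, norm_mul, norm_neg, Complex.norm_real, Real.norm_of_nonneg hR.le]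
    have h1 := norm_sinh_add_mul_I_le t ψ
    have h2 : Real.exp (-(R * Real.cos ψ) * Real.cosh t) ≤ Real.exp (-(R * c) * Real.cosh t) := by
      have := Real.cosh_pos t
      rw [Real.exp_le_exp, neg_mul, neg_mul]
      gcongr
    calc _ ≤ Real.exp (-(R * c) * Real.cosh t) * (R * Real.cosh t) := by gcongr
      _ = _ := by ring
  have hGcont : ∀ ψ, Continuous (G ψ) := fun ψ => by
    rw [hG]; simp only; have := hcont ψ; fun_prop
  have hGint : ∀ ψ : ℝ, 0 < Real.cos ψ → Integrable (G ψ) := fun ψ hc =>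
    ((integrable_cosh_pow_mul_exp 1 (mul_pos hR hc)).1.const_mul R).mono'
      (hGcont ψ).aestronglyMeasurable (Eventually.of_forall fun t => hGle ψ t _ le_rfl)
  have hdt : ∀ ψ t : ℝ, HasDerivAt (F ψ) (G ψ t) t := fun ψ t => by
    have h0 : HasDerivAt (fun t : ℝ => (t : ℂ) + ψ * Complex.I) 1 t :=
      (Complex.ofRealCLM.hasDerivAt (x := t)).add_const _
    refine (((Complex.hasDerivAt_cosh _).comp t h0).const_mul (-R : ℂ)).cexp.congr_deriv ?_
    rw [hG, hF]; simp
  have hdψ : ∀ ψ t : ℝ, HasDerivAt (fun ψ => F ψ t) (Complex.I * G ψ t) ψ := fun ψ t => by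
    have h0 : HasDerivAt (fun ψ : ℝ => (t : ℂ) + ψ * Complex.I) (1 * Complex.I) ψ :=
      ((Complex.ofRealCLM.hasDerivAt (x := ψ)).mul_const Complex.I).const_add _
    refine (((Complex.hasDerivAt_cosh _).comp ψ h0).const_mul (-R : ℂ)).cexp.congr_deriv ?_
    rw [hG, hF]; simp only [Function.comp]; ring
  -- the derivative in `ψ` is `i` times the derivative in `t`, so its integral vanishes
  have hderiv : ∀ ψ : ℝ, 0 < Real.cos ψ → HasDerivAt (fun ψ => ∫ t, F ψ t) 0 ψ := fun ψ hc => by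
    have hs : {φ : ℝ | Real.cos ψ / 2 < Real.cos φ} ∈ 𝓝 ψ :=
      (isOpen_lt continuous_const Real.continuous_cos).mem_nhds (by simpa using by linarith)
    have h := (hasDerivAt_integral_of_dominated_loc_of_deriv_le (μ := volume) (F := F)
      (F' := fun ψ t => Complex.I * G ψ t)
      (bound := fun t => R * (Real.cosh t ^ 1 * Real.exp (-(R * (Real.cos ψ / 2)) * Real.cosh t)))
      hs (Eventually.of_forall fun φ => (hcont φ).aestronglyMeasurable) (hint ψ hc)
      ((hGcont ψ).const_mul Complex.I).aestronglyMeasurable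
      (Eventually.of_forall fun t φ hφ => by
        rw [norm_mul, Complex.norm_I, one_mul]
        exact hGle φ t _ (le_of_lt hφ))
      ((integrable_cosh_pow_mul_exp 1 (mul_pos hR (half_pos hc))).1.const_mul R)
      (Eventually.of_forall fun t φ _ => hdψ φ t)).2
    refine h.congr_deriv ?_
    rw [integral_const_mul,
      integral_eq_zero_of_hasDerivAt_of_integrable (hdt ψ) (hGint ψ hc) (hint ψ hc), mul_zero]
  have hcos : ∀ φ ∈ Set.Ioo (-(π / 2)) (π / 2), 0 < Real.cos φ := fun φ hφ =>
    Real.cos_pos_of_mem_Ioo hφ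
  have hconst : ∫ t, F ψ t = ∫ t, F 0 t :=
    isOpen_Ioo.is_const_of_deriv_eq_zero (s := Set.Ioo (-(π / 2)) (π / 2))
      (f := fun ψ => ∫ t, F ψ t) isPreconnected_Ioo
      (fun φ hφ => (hderiv φ (hcos φ hφ)).differentiableAt.differentiableWithinAt)
      (fun φ hφ => (hderiv φ (hcos φ hφ)).deriv) (abs_lt.1 hψ)
      ⟨by linarith [Real.pi_pos], by linarith [Real.pi_pos]⟩
  rw [hconst, ← (integrable_cosh_pow_mul_exp 0 hR).2, ← integral_complex_ofReal]
  refine integral_congr_ae (Eventually.of_forall fun t => ?_)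
  simp only [hF]
  push_cast
  simp

/-- The integral representation of `K_0(‖z‖)` by plane waves, for `z` in the right half-plane. -/
theorem integral_exp_neg_re_cosh_add_im_sinh {z : ℂ} (hz : 0 < z.re) :
    ∫ t : ℝ, Complex.exp (-(z.re * Complex.cosh t + z.im * Complex.sinh t * Complex.I))
      = (2 * coshExpIntegral 0 ‖z‖ : ℝ) := by
  have hz0 : 0 < ‖z‖ := norm_pos_iff.2 fun h => by simp [h] at hz
  rw [← integral_exp_cosh_add_mul_I hz0 (Complex.abs_arg_lt_pi_div_two_iff.2 (Or.inl hz))]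
  refine integral_congr_ae (Eventually.of_forall fun t => ?_)
  simp only
  congr 1
  rw [Complex.cosh_add, Complex.cosh_mul_I, Complex.sinh_mul_I, ← Complex.ofReal_cos,
    ← Complex.ofReal_sin, ← Complex.norm_mul_cos_arg z, ← Complex.norm_mul_sin_arg z]
  push_cast
  ring

/-- The plane wave representation at `z = ρ (1 - e^{-iθ})`, whose modulus is the length of a chord of
the circle of radius `ρ`. -/
theorem integral_exp_neg_mul_cosh_mul_exp {ρ θ : ℝ} (hρ : 0 < ρ) (hθ : 0 < 1 - Real.cos θ) :
    ∫ t : ℝ, Complex.exp (-ρ * Complex.cosh t) * Complex.exp (ρ * Complex.cos (θ + t * Complex.I))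
      = (2 * coshExpIntegral 0 (ρ * √(2 * (1 - Real.cos θ))) : ℝ) := by
  set z : ℂ := ⟨ρ * (1 - Real.cos θ), ρ * Real.sin θ⟩ with hz
  have hnz : ‖z‖ = ρ * √(2 * (1 - Real.cos θ)) := by
    rw [Complex.norm_def, Complex.normSq_apply, hz]
    simp only
    rw [show ρ * (1 - Real.cos θ) * (ρ * (1 - Real.cos θ)) + ρ * Real.sin θ * (ρ * Real.sin θ)
      = ρ ^ 2 * (2 * (1 - Real.cos θ)) by
        linear_combination ρ ^ 2 * Real.sin_sq_add_cos_sq θ,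
      Real.sqrt_mul (by positivity), Real.sqrt_sq hρ.le]
  rw [← hnz, ← integral_exp_neg_re_cosh_add_im_sinh (z := z) (mul_pos hρ hθ)]
  refine integral_congr_ae (Eventually.of_forall fun t => ?_)
  simp only
  rw [← Complex.exp_add]
  congr 1
  rw [Complex.cos_add_mul_I, hz]
  push_cast
  ring

/-- A contour shift: the integral of an entire `2π`-periodic function over a period. -/
theorem integral_add_mul_I_of_periodic {f : ℂ → ℂ} (hf : Differentiable ℂ f)
    (hp : Function.Periodic f (2 * π)) (t : ℝ) :
    ∫ θ in (-π)..π, f (θ + t * Complex.I) = ∫ θ in (-π)..π, f θ := by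
  have h := Complex.integral_boundary_rect_eq_zero_of_differentiableOn f
    (⟨-π, 0⟩ : ℂ) (⟨π, t⟩ : ℂ) hf.differentiableOn
  simp only at h
  have e : ∀ y : ℝ, f ((π : ℝ) + y * Complex.I) = f ((-π : ℝ) + y * Complex.I) := fun y => by
    rw [← hp ((-π : ℝ) + y * Complex.I)]
    congr 1; push_cast; ring
  simp only [e] at h
  rw [add_sub_cancel_right, sub_eq_zero] at h
  rw [← h]
  refine intervalIntegral.integral_congr fun θ _ => ?_
  simp

theorem integral_exp_cos_add_mul_I (ρ t : ℝ) :
    ∫ θ in (-π)..π, Complex.exp (ρ * Complex.cos (θ + t * Complex.I)) = cosExpIntegral 0 ρ := by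
  rw [integral_add_mul_I_of_periodic (f := fun w => Complex.exp (ρ * Complex.cos w))
    (by fun_prop) (fun w => by simp only [Complex.cos_add_two_pi])]
  unfold cosExpIntegral
  rw [← intervalIntegral.integral_ofReal]
  refine intervalIntegral.integral_congr fun θ _ => ?_
  simp

theorem integral_cos_mul_exp_cos_add_mul_I (ρ t : ℝ) :
    ∫ θ in (-π)..π, Complex.cos θ * Complex.exp (ρ * Complex.cos (θ + t * Complex.I))
      = Real.cosh t * cosExpIntegral 1 ρ := by
  have h1 : ∫ θ in (-π)..π, Complex.cos (θ + t * Complex.I)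
      * Complex.exp (ρ * Complex.cos (θ + t * Complex.I)) = cosExpIntegral 1 ρ := by
    rw [integral_add_mul_I_of_periodic
      (f := fun w => Complex.cos w * Complex.exp (ρ * Complex.cos w))
      (by fun_prop) (fun w => by simp only [Complex.cos_add_two_pi])]
    unfold cosExpIntegral
    rw [← intervalIntegral.integral_ofReal]
    refine intervalIntegral.integral_congr fun θ _ => ?_
    simp
  have h2 : ∫ θ in (-π)..π, Complex.sin (θ + t * Complex.I)
      * Complex.exp (ρ * Complex.cos (θ + t * Complex.I)) = 0 := by
    rw [integral_add_mul_I_of_periodic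
      (f := fun w => Complex.sin w * Complex.exp (ρ * Complex.cos w))
      (by fun_prop) (fun w => by simp only [Complex.cos_add_two_pi, Complex.sin_add_two_pi])]
    -- the integrand is odd
    have h := intervalIntegral.integral_comp_neg (a := -π) (b := π)
      (fun θ : ℝ => Complex.sin θ * Complex.exp (ρ * Complex.cos θ))
    simp only [Complex.ofReal_neg, Complex.sin_neg, Complex.cos_neg, neg_mul, neg_neg,
      intervalIntegral.integral_neg] at h
    exact self_eq_neg.1 h.symm
  have e : ∀ θ : ℝ, Complex.cos θ * Complex.exp (ρ * Complex.cos (θ + t * Complex.I))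
      = Real.cosh t * (Complex.cos (θ + t * Complex.I)
          * Complex.exp (ρ * Complex.cos (θ + t * Complex.I)))
        + Real.sinh t * Complex.I * (Complex.sin (θ + t * Complex.I)
          * Complex.exp (ρ * Complex.cos (θ + t * Complex.I))) := fun θ => by
    -- `cos θ` is the cosine of `(θ + it) - it`
    have : Complex.cos θ = Complex.cosh t * Complex.cos (θ + t * Complex.I)
        + Complex.sinh t * Complex.I * Complex.sin (θ + t * Complex.I) := by
      rw [Complex.cos_add_mul_I, Complex.sin_add_mul_I]
      linear_combination (-Complex.cos θ) * Complex.cosh_sq_sub_sinh_sq t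
        - Complex.cos θ * Complex.sinh t ^ 2 * Complex.I_sq
    push_cast
    linear_combination Complex.exp (ρ * Complex.cos (θ + t * Complex.I)) * this
  simp only [e]
  rw [intervalIntegral.integral_add
      (Continuous.intervalIntegrable (by fun_prop) _ _)
      (Continuous.intervalIntegrable (by fun_prop) _ _),
    intervalIntegral.integral_const_mul, intervalIntegral.integral_const_mul, h1, h2, mul_zero,
    add_zero]

/-- A majorant of `K_0` that is integrable in `θ` across the singularity at `θ = 0`. -/
theorem exists_coshExpIntegral_zero_one_sub_cos_le :
    ∃ C, 0 ≤ C ∧ ∀ x θ y : ℝ, 0 < x → θ ∈ Set.Ioc (-π) π → θ ≠ 0 →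
      x * (1 - Real.cos θ) ≤ y → coshExpIntegral 0 y ≤ C * x ^ (-(1 / 4) : ℝ) * |θ| ^ (-(1 / 2) : ℝ) := by
  obtain ⟨C, hC, h⟩ := exists_coshExpIntegral_zero_le
  refine ⟨C * (2 / π ^ 2) ^ (-(1 / 4) : ℝ), by positivity, fun x θ y hx hθ h0 hy => ?_⟩
  have h1 := Real.cos_le_one_sub_mul_cos_sq (x := θ) (abs_le.2 ⟨hθ.1.le, hθ.2⟩)
  have h2 : 0 < 2 / π ^ 2 * θ ^ 2 := by positivity
  refine (h _ ((mul_pos hx (one_sub_cos_pos hθ h0)).trans_le hy)).trans ?_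
  have h3 : y ^ (-(1 / 4) : ℝ) ≤ (x * (2 / π ^ 2 * θ ^ 2)) ^ (-(1 / 4) : ℝ) := by
    refine Real.rpow_le_rpow_of_nonpos (by positivity) ?_ (by norm_num)
    refine le_trans ?_ hy
    gcongr
    linarith
  refine (mul_le_mul_of_nonneg_left h3 hC).trans (le_of_eq ?_)
  rw [Real.mul_rpow hx.le h2.le, Real.mul_rpow (by positivity) (sq_nonneg θ),
    sq_rpow_eq_abs_rpow]
  norm_num
  ring

theorem integrableOn_abs_rpow_neg_half :
    IntegrableOn (fun θ : ℝ => |θ| ^ (-(1 / 2) : ℝ)) (Set.Ioc (-π) π) := by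
  have h := (integrable_piecewise_rpow (p := -(1 / 2)) (r := -2) (K := 0) (by norm_num)
    (by norm_num) Real.pi_pos).1
  refine h.integrableOn.congr_fun (fun θ hθ => ?_) measurableSet_Ioc
  simp only [abs_le.2 ⟨hθ.1.le, hθ.2⟩, if_true]

/-- If the mean of `w(θ) exp(ρ cos(θ + it))` over a period is `a cosh^n t`, then the mean of
`w(θ) K_0` over the distances between the points of a circle of radius `ρ` is `a K_n(ρ)`. -/
theorem integral_mul_coshExpIntegral_chord {w : ℝ → ℝ} (hw : Continuous w) (hw1 : ∀ θ, |w θ| ≤ 1)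
    {ρ a : ℝ} {n : ℕ} (hρ : 0 < ρ)
    (hin : ∀ t : ℝ, ∫ θ in (-π)..π, (w θ : ℂ) * Complex.exp (ρ * Complex.cos (θ + t * Complex.I))
      = (Real.cosh t ^ n * a : ℝ)) :
    ∫ θ in (-π)..π, w θ * coshExpIntegral 0 (ρ * √(2 * (1 - Real.cos θ)))
      = a * coshExpIntegral n ρ := by
  have hle : -π ≤ π := by linarith [Real.pi_pos]
  set μ := (volume : Measure ℝ).restrict (Set.Ioc (-π) π) with hμ
  set f : ℝ → ℝ → ℂ := fun θ t => (w θ : ℂ) *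
    (Complex.exp (-ρ * Complex.cosh t) * Complex.exp (ρ * Complex.cos (θ + t * Complex.I))) with hf
  have hfc : Continuous (Function.uncurry f) := by
    rw [hf]; simp only [Function.uncurry_def]; fun_prop
  have hfn : ∀ θ t, ‖f θ t‖
      = |w θ| * (Real.cosh t ^ 0 * Real.exp (-(ρ * (1 - Real.cos θ)) * Real.cosh t)) := by
    intro θ t
    rw [hf]
    simp only
    rw [← Complex.exp_add, norm_mul, Complex.norm_real, Real.norm_eq_abs, Complex.norm_exp,
      pow_zero, one_mul, Complex.cos_add_mul_I, ← Complex.ofReal_cos, ← Complex.ofReal_cosh,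
      ← Complex.ofReal_sin, ← Complex.ofReal_sinh]
    congr 2
    simp only [Complex.add_re, Complex.sub_re, Complex.mul_re, Complex.mul_im, Complex.ofReal_re,
      Complex.ofReal_im, Complex.I_re, Complex.I_im, Complex.neg_re, Complex.neg_im]
    ring
  have hint : Integrable (Function.uncurry f) (μ.prod volume) := by
    rw [integrable_prod_iff hfc.aestronglyMeasurable]
    constructor
    · filter_upwards [ae_one_sub_cos_pos] with θ hθ
      refine (((integrable_cosh_pow_mul_exp 0 (mul_pos hρ hθ)).1).const_mul |w θ|).mono'
        (hfc.comp (Continuous.prodMk_right θ)).aestronglyMeasurable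
        (Eventually.of_forall fun t => (hfn θ t).le)
    · obtain ⟨C, hC, hK⟩ := exists_coshExpIntegral_zero_one_sub_cos_le
      refine (integrableOn_abs_rpow_neg_half.const_mul (2 * (C * ρ ^ (-(1 / 4) : ℝ)))).mono'
        hfc.aestronglyMeasurable.norm.integral_prod_right' ?_
      rw [ae_restrict_iff' measurableSet_Ioc]
      have hne : ∀ᵐ θ : ℝ, θ ≠ 0 := by simp [ae_iff, measure_singleton]
      filter_upwards [hne] with θ h0 hθ
      have hc := one_sub_cos_pos hθ h0
      have e : ∫ t, ‖Function.uncurry f (θ, t)‖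
          = |w θ| * (2 * coshExpIntegral 0 (ρ * (1 - Real.cos θ))) := by
        rw [← (integrable_cosh_pow_mul_exp 0 (mul_pos hρ hc)).2, ← integral_const_mul]
        exact integral_congr_ae (Eventually.of_forall fun t => hfn θ t)
      have hk := hK ρ θ _ hρ hθ h0 le_rfl
      have hk0 := coshExpIntegral_nonneg 0 (ρ * (1 - Real.cos θ))
      rw [e, Real.norm_of_nonneg (by positivity)]
      calc _ ≤ 1 * (2 * (C * ρ ^ (-(1 / 4) : ℝ) * |θ| ^ (-(1 / 2) : ℝ))) := by
            gcongr; exact hw1 θ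
        _ = _ := by ring
  have hswap := integral_integral_swap hint
  have hl : ∫ θ, ∫ t, f θ t ∂volume ∂μ
      = (2 * ∫ θ in (-π)..π, w θ * coshExpIntegral 0 (ρ * √(2 * (1 - Real.cos θ))) : ℝ) := by
    rw [intervalIntegral.integral_of_le hle, ← integral_const_mul, ← integral_complex_ofReal]
    refine integral_congr_ae ?_
    filter_upwards [ae_one_sub_cos_pos] with θ hθ
    rw [hf]
    simp only
    rw [integral_const_mul, integral_exp_neg_mul_cosh_mul_exp hρ hθ]
    push_cast; ring
  have hr : ∫ t, ∫ θ, f θ t ∂μ ∂volume = (a * (2 * coshExpIntegral n ρ) : ℝ) := by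
    rw [← (integrable_cosh_pow_mul_exp n hρ).2, ← integral_const_mul, ← integral_complex_ofReal]
    refine integral_congr_ae (Eventually.of_forall fun t => ?_)
    have e : ∀ θ, f θ t = Complex.exp (-ρ * Complex.cosh t) *
        ((w θ : ℂ) * Complex.exp (ρ * Complex.cos (θ + t * Complex.I))) := fun θ => by
      rw [hf]; ring
    simp only [e]
    rw [integral_const_mul, hμ, ← intervalIntegral.integral_of_le hle, hin t]
    push_cast
    ring
  rw [hl, hr] at hswap
  have := Complex.ofReal_injective hswap
  linarith

/-- The addition formula whose right-hand side is `2π I_0(ρ) K_0(ρ)`. -/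
theorem integral_coshExpIntegral_chord {ρ : ℝ} (hρ : 0 < ρ) :
    ∫ θ in (-π)..π, coshExpIntegral 0 (ρ * √(2 * (1 - Real.cos θ)))
      = cosExpIntegral 0 ρ * coshExpIntegral 0 ρ := by
  have h := integral_mul_coshExpIntegral_chord (w := fun _ => 1) (a := cosExpIntegral 0 ρ) (n := 0)
    continuous_const (by simp) hρ (fun t => by
      rw [pow_zero, one_mul, ← integral_exp_cos_add_mul_I ρ t]
      simp only [Complex.ofReal_one, one_mul])
  simpa only [one_mul] using h

/-- The addition formula whose right-hand side is `2π I_1(ρ) K_1(ρ)`. -/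
theorem integral_cos_mul_coshExpIntegral_chord {ρ : ℝ} (hρ : 0 < ρ) :
    ∫ θ in (-π)..π, Real.cos θ * coshExpIntegral 0 (ρ * √(2 * (1 - Real.cos θ)))
      = cosExpIntegral 1 ρ * coshExpIntegral 1 ρ :=
  integral_mul_coshExpIntegral_chord Real.continuous_cos Real.abs_cos_le_one hρ fun t => by
    rw [pow_one, Complex.ofReal_mul, ← integral_cos_mul_exp_cos_add_mul_I ρ t]
    simp only [Complex.ofReal_cos]

/-! ### Fourier transforms of powers of the distance -/

theorem integral_cos_mul_exp_neg_mul_sq {x : ℝ} (hx : 0 < x) (k : ℝ) :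
    ∫ τ : ℝ, Real.cos (k * τ) * Real.exp (-(x * τ ^ 2))
      = √π * x ^ (-(1 / 2) : ℝ) * Real.exp (-(k ^ 2 / (4 * x))) := by
  have h := fourierIntegral_gaussian (b := (x : ℂ)) (by simpa using hx) (k : ℂ)
  have e : ∀ τ : ℝ, Complex.exp (Complex.I * k * τ) * Complex.exp (-x * (τ : ℂ) ^ 2)
      = Complex.exp ((k * τ : ℝ) * Complex.I) * (Real.exp (-(x * τ ^ 2)) : ℝ) := fun τ => by
    push_cast
    congr 2 <;> ring
  have hn : ∀ τ : ℝ, ‖Complex.exp ((k * τ : ℝ) * Complex.I) * (Real.exp (-(x * τ ^ 2)) : ℝ)‖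
      = Real.exp (-x * τ ^ 2) := fun τ => by
    rw [norm_mul, Complex.norm_exp_ofReal_mul_I, one_mul, Complex.norm_real,
      Real.norm_of_nonneg (Real.exp_pos _).le, neg_mul]
  have hi : Integrable fun τ : ℝ =>
      Complex.exp ((k * τ : ℝ) * Complex.I) * (Real.exp (-(x * τ ^ 2)) : ℝ) :=
    (integrable_exp_neg_mul_sq hx).mono' (Continuous.aestronglyMeasurable (by fun_prop))
      (Eventually.of_forall fun τ => (hn τ).le)
  simp only [e] at h
  have h2 := congrArg Complex.re h
  have hre : ∫ τ : ℝ, (Complex.exp ((k * τ : ℝ) * Complex.I) * (Real.exp (-(x * τ ^ 2)) : ℝ)).re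
      = (∫ τ : ℝ, Complex.exp ((k * τ : ℝ) * Complex.I) * (Real.exp (-(x * τ ^ 2)) : ℝ)).re :=
    integral_re hi
  rw [← hre] at h2
  have e2 : ((π : ℂ) / x) ^ (1 / 2 : ℂ) * Complex.exp (-(k : ℂ) ^ 2 / (4 * x))
      = (((π / x) ^ (1 / 2 : ℝ) * Real.exp (-(k ^ 2 / (4 * x))) : ℝ) : ℂ) := by
    rw [Complex.ofReal_mul, Complex.ofReal_cpow (by positivity)]
    push_cast
    congr 2
    ring
  rw [e2] at h2
  rw [Complex.ofReal_re, Real.div_rpow Real.pi_pos.le hx.le, ← Real.sqrt_eq_rpow,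
    div_eq_mul_inv, ← Real.rpow_neg hx.le] at h2
  rw [← h2]
  refine integral_congr_ae (Eventually.of_forall fun τ => ?_)
  simp only [Complex.re_mul_ofReal, Complex.exp_ofReal_mul_I_re]

/-- The integral `∫_0^∞ x^n exp(-mx - k²/(4x)) dx`. -/
noncomputable def gaussLaplace (n : ℕ) (k m : ℝ) : ℝ :=
  ∫ x in Set.Ioi (0 : ℝ), x ^ n * Real.exp (-(m * x) - k ^ 2 / (4 * x))

theorem integrable_sq_add_rpow (n : ℕ) {m : ℝ} (hm : 0 < m) :
    Integrable fun τ : ℝ => (τ ^ 2 + m) ^ (-(n + 3 / 2) : ℝ) := by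
  refine ((integral_inv_dist_cube hm).1.const_mul (m ^ (-n : ℝ))).mono'
    (Continuous.aestronglyMeasurable ?_) (Eventually.of_forall fun τ => ?_)
  · exact (continuous_id.pow 2 |>.add continuous_const).rpow_const
      fun τ => Or.inl (by have : 0 < τ ^ 2 + m := by positivity
                          exact this.ne')
  · have h : 0 < τ ^ 2 + m := by positivity
    rw [Real.norm_of_nonneg (by positivity),
      show (-(n + 3 / 2) : ℝ) = -n + -(3 / 2) by ring, Real.rpow_add h]
    refine mul_le_mul_of_nonneg_right ?_ (by positivity)
    exact Real.rpow_le_rpow_of_nonpos hm (by nlinarith [sq_nonneg τ]) (by simp)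

theorem integrable_cos_mul_sq_add_rpow (n : ℕ) {m : ℝ} (hm : 0 < m) (k : ℝ) :
    Integrable fun τ : ℝ => Real.cos (k * τ) * (τ ^ 2 + m) ^ (-(n + 3 / 2) : ℝ) :=
  (integrable_sq_add_rpow n hm).bdd_mul (c := 1) (Continuous.aestronglyMeasurable (by fun_prop))
    (Eventually.of_forall fun τ => by simpa using Real.abs_cos_le_one _)

/-- The powers of `τ² + m` are superpositions of Gaussians. -/
theorem Gamma_mul_integral_cos_mul_sq_add_rpow (n : ℕ) {m : ℝ} (hm : 0 < m) (k : ℝ) :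
    Real.Gamma (n + 3 / 2) * ∫ τ : ℝ, Real.cos (k * τ) * (τ ^ 2 + m) ^ (-(n + 3 / 2) : ℝ)
      = √π * gaussLaplace n k m := by
  set f : ℝ → ℝ → ℝ := fun τ x =>
    Real.cos (k * τ) * (x ^ ((n + 3 / 2 : ℝ) - 1) * Real.exp (-((τ ^ 2 + m) * x))) with hf
  have hn1 : (0 : ℝ) < (n + 3 / 2 : ℝ) := by positivity
  have hfm : Measurable (Function.uncurry f) := by
    rw [hf]; simp only [Function.uncurry_def]; fun_prop
  have hG : ∀ τ : ℝ, ∫ x in Set.Ioi (0 : ℝ), x ^ ((n + 3 / 2 : ℝ) - 1) * Real.exp (-((τ ^ 2 + m) * x))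
      = (τ ^ 2 + m) ^ (-(n + 3 / 2) : ℝ) * Real.Gamma (n + 3 / 2) := fun τ => by
    have h : 0 < τ ^ 2 + m := by positivity
    rw [Real.integral_rpow_mul_exp_neg_mul_Ioi hn1 h, one_div, Real.inv_rpow h.le,
      Real.rpow_neg h.le]
  have hGi : ∀ τ : ℝ, IntegrableOn
      (fun x : ℝ => x ^ ((n + 3 / 2 : ℝ) - 1) * Real.exp (-((τ ^ 2 + m) * x))) (Set.Ioi 0) := by
    intro τ
    have h := integrableOn_rpow_mul_exp_neg_mul_rpow (p := 1) (s := (n + 3 / 2 : ℝ) - 1)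
      (b := τ ^ 2 + m) (by linarith) one_pos (by positivity)
    simpa only [Real.rpow_one, neg_mul] using h
  have hint : Integrable (Function.uncurry f)
      ((volume : Measure ℝ).prod (volume.restrict (Set.Ioi (0 : ℝ)))) := by
    rw [integrable_prod_iff hfm.aestronglyMeasurable]
    refine ⟨Eventually.of_forall fun τ => (hGi τ).const_mul (Real.cos (k * τ)), ?_⟩
    refine ((integrable_sq_add_rpow n hm).mul_const (Real.Gamma (n + 3 / 2))).mono'
      hfm.aestronglyMeasurable.norm.integral_prod_right' (Eventually.of_forall fun τ => ?_)
    rw [Real.norm_of_nonneg (integral_nonneg fun _ => norm_nonneg _), ← hG τ]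
    refine setIntegral_mono_on ((hGi τ).const_mul (Real.cos (k * τ))).norm (hGi τ) measurableSet_Ioi fun x hx => ?_
    have hx0 : 0 < x := hx
    simp only [Function.uncurry_apply_pair, hf]
    rw [norm_mul, Real.norm_of_nonneg (r := x ^ _ * _) (by positivity)]
    exact mul_le_of_le_one_left (by positivity) (Real.abs_cos_le_one _)
  have hswap := integral_integral_swap hint
  have hl : ∫ τ, ∫ x in Set.Ioi (0 : ℝ), f τ x
      = Real.Gamma (n + 3 / 2) * ∫ τ : ℝ, Real.cos (k * τ) * (τ ^ 2 + m) ^ (-(n + 3 / 2) : ℝ) := by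
    rw [← integral_const_mul]
    refine integral_congr_ae (Eventually.of_forall fun τ => ?_)
    simp only [hf]
    rw [integral_const_mul, hG]
    ring
  rw [← hl, hswap, gaussLaplace, ← integral_const_mul]
  refine setIntegral_congr_fun measurableSet_Ioi fun x hx => ?_
  have hx0 : 0 < x := hx
  have e : ∀ τ, f τ x = x ^ ((n + 3 / 2 : ℝ) - 1) * Real.exp (-(m * x)) *
      (Real.cos (k * τ) * Real.exp (-(x * τ ^ 2))) := fun τ => by
    simp only [hf]
    rw [show -((τ ^ 2 + m) * x) = -(m * x) + -(x * τ ^ 2) by ring, Real.exp_add]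
    ring
  simp only [e]
  rw [integral_const_mul, integral_cos_mul_exp_neg_mul_sq hx0,
    show -(m * x) - k ^ 2 / (4 * x) = -(m * x) + -(k ^ 2 / (4 * x)) by ring, Real.exp_add]
  have : x ^ ((n + 3 / 2 : ℝ) - 1) * x ^ (-(1 / 2) : ℝ) = x ^ n := by
    rw [← Real.rpow_add hx0, show (n + 3 / 2 : ℝ) - 1 + -(1 / 2) = n by ring, Real.rpow_natCast]
  rw [← this]
  ring

theorem integral_cos_mul_inv_dist_cube {m : ℝ} (hm : 0 < m) (k : ℝ) :
    ∫ τ : ℝ, Real.cos (k * τ) * (τ ^ 2 + m) ^ (-(3 / 2) : ℝ) = 2 * gaussLaplace 0 k m := by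
  have h := Gamma_mul_integral_cos_mul_sq_add_rpow 0 hm k
  have hG : Real.Gamma ((0 : ℕ) + 3 / 2) = √π / 2 := by
    rw [show ((0 : ℕ) + 3 / 2 : ℝ) = 1 / 2 + 1 by norm_num, Real.Gamma_add_one (by norm_num),
      Real.Gamma_one_half_eq]
    ring
  rw [hG] at h
  have hp : √π ≠ 0 := (Real.sqrt_pos.2 Real.pi_pos).ne'
  rw [show (-((0 : ℕ) + 3 / 2) : ℝ) = -(3 / 2) by norm_num] at h
  refine mul_left_cancel₀ hp ?_
  linear_combination 2 * h

theorem integral_cos_mul_inv_dist_pow_five {m : ℝ} (hm : 0 < m) (k : ℝ) :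
    ∫ τ : ℝ, Real.cos (k * τ) * (τ ^ 2 + m) ^ (-(5 / 2) : ℝ) = 4 / 3 * gaussLaplace 1 k m := by
  have h := Gamma_mul_integral_cos_mul_sq_add_rpow 1 hm k
  have hG : Real.Gamma ((1 : ℕ) + 3 / 2) = 3 * √π / 4 := by
    rw [show ((1 : ℕ) + 3 / 2 : ℝ) = 1 / 2 + 1 + 1 by norm_num, Real.Gamma_add_one (by norm_num),
      Real.Gamma_add_one (by norm_num), Real.Gamma_one_half_eq]
    ring
  rw [hG] at h
  have hp : √π ≠ 0 := (Real.sqrt_pos.2 Real.pi_pos).ne'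
  rw [show (-((1 : ℕ) + 3 / 2) : ℝ) = -(5 / 2) by norm_num] at h
  refine mul_left_cancel₀ hp ?_
  linear_combination 4 / 3 * h

/-! ### Relations between the Laplace integrals -/

/-- The substitution `x = k/(2√m) e^u`. -/
theorem integral_inv_mul_exp {k m : ℝ} (hk : 0 < k) (hm : 0 < m) :
    IntegrableOn (fun x : ℝ => x⁻¹ * Real.exp (-(m * x) - k ^ 2 / (4 * x))) (Set.Ioi 0) ∧
    ∫ x in Set.Ioi (0 : ℝ), x⁻¹ * Real.exp (-(m * x) - k ^ 2 / (4 * x))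
      = 2 * coshExpIntegral 0 (k * √m) := by
  have hs : 0 < √m := Real.sqrt_pos.2 hm
  set c : ℝ := k / (2 * √m) with hc
  have hc0 : 0 < c := by positivity
  set φ : ℝ → ℝ := fun u => c * Real.exp u with hφ
  set g : ℝ → ℝ := fun x => x⁻¹ * Real.exp (-(m * x) - k ^ 2 / (4 * x)) with hg
  have himg : φ '' Set.univ = Set.Ioi 0 := by
    ext y
    simp only [Set.image_univ, Set.mem_range, Set.mem_Ioi, hφ]
    constructor
    · rintro ⟨u, rfl⟩; positivity
    · intro hy
      exact ⟨Real.log (y / c), by rw [Real.exp_log (by positivity)]; field_simp⟩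
  have hd : ∀ u ∈ Set.univ, HasDerivWithinAt φ (φ u) Set.univ u := fun u _ =>
    ((Real.hasDerivAt_exp u).const_mul c).hasDerivWithinAt
  have hinj : Set.InjOn φ Set.univ := fun u _ v _ h =>
    Real.exp_injective (mul_left_cancel₀ hc0.ne' h)
  have e : ∀ u, |φ u| • g (φ u)
      = Real.cosh u ^ 0 * Real.exp (-(k * √m) * Real.cosh u) := fun u => by
    have hp : 0 < φ u := by positivity
    rw [abs_of_pos hp, smul_eq_mul, hg]
    simp only
    rw [mul_inv_cancel_left₀ hp.ne', pow_zero, one_mul, Real.cosh_eq]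
    congr 1
    have hm2 : m = √m ^ 2 := (Real.sq_sqrt hm.le).symm
    have h2 : Real.exp (-u) = (Real.exp u)⁻¹ := Real.exp_neg u
    have h3 : m * φ u = k * √m / 2 * Real.exp u := by
      simp only [hφ, hc]
      nth_rewrite 1 [hm2]
      field_simp
    have h4 : k ^ 2 / (4 * φ u) = k * √m / 2 * Real.exp (-u) := by
      simp only [hφ, hc, h2]
      field_simp
      ring
    rw [h3, h4]
    ring
  have h := integrable_cosh_pow_mul_exp 0 (mul_pos hk hs)
  refine ⟨?_, ?_⟩
  · rw [← himg, integrableOn_image_iff_integrableOn_abs_deriv_smul MeasurableSet.univ hd hinj g,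
      integrableOn_univ]
    simpa only [e] using h.1
  · rw [← himg, integral_image_eq_integral_abs_deriv_smul MeasurableSet.univ hd hinj g,
      Measure.restrict_univ, ← h.2]
    simp only [e]

theorem integrableOn_pow_mul_exp (n : ℕ) {m : ℝ} (hm : 0 < m) (k : ℝ) :
    IntegrableOn (fun x : ℝ => x ^ n * Real.exp (-(m * x) - k ^ 2 / (4 * x))) (Set.Ioi 0) := by
  have h := integrableOn_rpow_mul_exp_neg_mul_rpow (p := 1) (s := n)
      (b := m) (by have : (0 : ℝ) ≤ n := by positivity
                   linarith) one_pos hm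
  simp only [Real.rpow_one, Real.rpow_natCast] at h
  refine h.mono' (Measurable.aestronglyMeasurable (by fun_prop)) ?_
  refine (ae_restrict_iff' measurableSet_Ioi).2 (Eventually.of_forall fun x hx => ?_)
  have hx0 : 0 < x := hx
  rw [Real.norm_of_nonneg (by positivity)]
  have : 0 ≤ k ^ 2 / (4 * x) := by positivity
  gcongr
  linarith

/-- Integration of the derivative of `x exp(-mx - k²/(4x))`. -/
theorem mul_gaussLaplace_one {k m : ℝ} (hk : 0 ≤ k) (hm : 0 < m) :
    m * gaussLaplace 1 k m
      = gaussLaplace 0 k m + k ^ 2 / 2 * coshExpIntegral 0 (k * √m) := by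
  set E : ℝ → ℝ := fun x => Real.exp (-(m * x) - k ^ 2 / (4 * x)) with hE
  have hI : IntegrableOn (fun x => k ^ 2 / 4 * (x⁻¹ * E x)) (Set.Ioi 0) ∧
      ∫ x in Set.Ioi (0 : ℝ), k ^ 2 / 4 * (x⁻¹ * E x)
        = k ^ 2 / 2 * coshExpIntegral 0 (k * √m) := by
    -- for `k = 0` the factor `k ^ 2` makes both sides vanish
    rcases hk.eq_or_lt with rfl | hk
    · simp
    · have h := integral_inv_mul_exp hk hm
      refine ⟨h.1.const_mul _, ?_⟩
      rw [integral_const_mul, h.2]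
      ring
  have h0 : IntegrableOn (fun x => x ^ 0 * E x) (Set.Ioi 0) := integrableOn_pow_mul_exp 0 hm k
  have h1 : IntegrableOn (fun x => m * (x ^ 1 * E x)) (Set.Ioi 0) :=
    (integrableOn_pow_mul_exp 1 hm k).const_mul m
  have hder : ∀ x ∈ Set.Ioi (0 : ℝ), HasDerivAt (fun x => x * E x)
      (x ^ 0 * E x - m * (x ^ 1 * E x) + k ^ 2 / 4 * (x⁻¹ * E x)) x := fun x hx => by
    have hx0 : x ≠ 0 := (Set.mem_Ioi.1 hx).ne'
    have hd : HasDerivAt (fun x => -(m * x) - k ^ 2 / (4 * x))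
        (-(m * 1) - (0 * (4 * x) - k ^ 2 * (4 * 1)) / (4 * x) ^ 2) x :=
      ((hasDerivAt_id' x).const_mul m).neg.sub
        ((hasDerivAt_const x (k ^ 2)).div ((hasDerivAt_id' x).const_mul 4) (by simpa using hx0))
    refine ((hasDerivAt_id' x).fun_mul hd.exp).congr_deriv ?_
    simp only [hE]
    field_simp
    ring
  have hle : ∀ x, 0 ≤ x → ‖x * E x‖ ≤ x * Real.exp (-(m * x)) := fun x hx => by
    rw [Real.norm_of_nonneg (by positivity)]
    have : 0 ≤ k ^ 2 / (4 * x) := by positivity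
    simp only [hE]
    gcongr
    linarith
  have hlim0 : ContinuousWithinAt (fun x => x * E x) (Set.Ici 0) 0 := by
    rw [ContinuousWithinAt, zero_mul]
    refine squeeze_zero_norm' (a := fun x => x * Real.exp (-(m * x))) ?_ ?_
    · filter_upwards [self_mem_nhdsWithin] with x hx using hle x hx
    · have : Tendsto (fun x : ℝ => x * Real.exp (-(m * x))) (𝓝 0) (𝓝 (0 * Real.exp (-(m * 0)))) :=
        (Continuous.tendsto (by fun_prop) 0)
      rw [zero_mul] at this
      exact this.mono_left nhdsWithin_le_nhds
  have hlim : Tendsto (fun x => x * E x) atTop (𝓝 0) := by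
    refine squeeze_zero_norm' (a := fun x => x * Real.exp (-(m * x))) ?_ ?_
    · filter_upwards [eventually_ge_atTop 0] with x hx using hle x hx
    · have := tendsto_rpow_mul_exp_neg_mul_atTop_nhds_zero 1 m hm
      simpa only [Real.rpow_one, neg_mul] using this
  have h := integral_Ioi_of_hasDerivAt_of_tendsto hlim0 hder ((h0.sub h1).add hI.1) hlim
  have e1 := integral_add (h0.sub h1) hI.1
  have e2 := integral_sub h0 h1
  simp only [Pi.sub_apply] at e1
  rw [e1, e2, hI.2, integral_const_mul, zero_mul, sub_zero] at h
  have g0 : gaussLaplace 0 k m = ∫ x in Set.Ioi (0 : ℝ), x ^ 0 * E x := rfl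
  have g1 : gaussLaplace 1 k m = ∫ x in Set.Ioi (0 : ℝ), x ^ 1 * E x := rfl
  rw [g0, g1]
  linarith

/-- The integral over `κ` of the derivative of `exp(-mx - κ²/(4x))`. -/
theorem gaussLaplace_zero_eq {k m : ℝ} (hk : 0 ≤ k) (hm : 0 < m) :
    gaussLaplace 0 k m = 1 / m - ∫ κ in (0 : ℝ)..k, κ * coshExpIntegral 0 (κ * √m) := by
  have hs : 0 < √m := Real.sqrt_pos.2 hm
  set f : ℝ → ℝ → ℝ := fun κ x => κ / 2 * (x⁻¹ * Real.exp (-(m * x) - κ ^ 2 / (4 * x))) with hf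
  have hfm : Measurable (Function.uncurry f) := by
    rw [hf]; simp only [Function.uncurry_def]; fun_prop
  have hval : ∀ κ, 0 < κ → ∫ x in Set.Ioi (0 : ℝ), f κ x = κ * coshExpIntegral 0 (κ * √m) :=
    fun κ hκ => by
      simp only [hf]
      rw [integral_const_mul, (integral_inv_mul_exp hκ hm).2]
      ring
  have hint : Integrable (Function.uncurry f)
      ((volume.restrict (Set.Ioc (0 : ℝ) k)).prod (volume.restrict (Set.Ioi (0 : ℝ)))) := by
    rw [integrable_prod_iff hfm.aestronglyMeasurable]
    refine ⟨(ae_restrict_iff' measurableSet_Ioc).2 (Eventually.of_forall fun κ hκ =>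
      (integral_inv_mul_exp hκ.1 hm).1.const_mul (κ / 2)), ?_⟩
    refine Integrable.of_bound hfm.aestronglyMeasurable.norm.integral_prod_right' (2 / √m) ?_
    refine (ae_restrict_iff' measurableSet_Ioc).2 (Eventually.of_forall fun κ hκ => ?_)
    have hκ0 := hκ.1
    have e : ∫ x in Set.Ioi (0 : ℝ), ‖Function.uncurry f (κ, x)‖
        = κ * coshExpIntegral 0 (κ * √m) := by
      rw [← hval κ hκ.1]
      refine setIntegral_congr_fun measurableSet_Ioi fun x hx => ?_
      have hx0 : 0 < x := hx
      simp only [Function.uncurry_apply_pair, hf]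
      exact Real.norm_of_nonneg (by positivity)
    have h := coshExpIntegral_le 0 (mul_pos hκ.1 hs)
    have hn := coshExpIntegral_nonneg 0 (κ * √m)
    rw [e, Real.norm_of_nonneg (by positivity), le_div_iff₀ hs]
    rw [le_div_iff₀ (by positivity)] at h
    norm_num at h
    linarith
  have hswap := integral_integral_swap hint
  have hl : ∫ κ in Set.Ioc 0 k, ∫ x in Set.Ioi (0 : ℝ), f κ x
      = ∫ κ in (0 : ℝ)..k, κ * coshExpIntegral 0 (κ * √m) := by
    rw [intervalIntegral.integral_of_le hk]
    exact setIntegral_congr_fun measurableSet_Ioc fun κ hκ => hval κ hκ.1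
  have hin : ∀ x, 0 < x → ∫ κ in Set.Ioc 0 k, f κ x
      = Real.exp (-(m * x)) - Real.exp (-(m * x) - k ^ 2 / (4 * x)) := fun x hx => by
    rw [← intervalIntegral.integral_of_le hk]
    have hd : ∀ κ : ℝ, HasDerivAt (fun κ => -Real.exp (-(m * x) - κ ^ 2 / (4 * x))) (f κ x) κ :=
      fun κ => by
        refine ((((hasDerivAt_pow 2 κ).div_const (4 * x)).const_sub (-(m * x))).exp.neg).congr_deriv
          ?_
        simp only [hf]
        field_simp
        norm_num
        ring
    rw [intervalIntegral.integral_eq_sub_of_hasDerivAt (fun κ _ => hd κ)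
      (Continuous.intervalIntegrable (by simp only [hf]; fun_prop) _ _)]
    norm_num
    ring
  rw [← hl, hswap, setIntegral_congr_fun measurableSet_Ioi fun x hx => hin x hx]
  have i0 := integrableOn_pow_mul_exp 0 hm 0
  have ik := integrableOn_pow_mul_exp 0 hm k
  simp only [pow_zero, one_mul] at i0 ik
  norm_num at i0
  have e0 : ∫ x in Set.Ioi (0 : ℝ), Real.exp (-(m * x)) = 1 / m := by
    have := integral_exp_mul_Ioi (a := -m) (by linarith) 0
    simpa using this
  rw [integral_sub i0 ik, e0, gaussLaplace]
  simp only [pow_zero, one_mul]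
  ring

/-! ### The multiplier of a Fourier mode -/

theorem measurable_coshExpIntegral (n : ℕ) : Measurable (coshExpIntegral n) := by
  have h : StronglyMeasurable (Function.uncurry fun x t : ℝ =>
      Real.cosh t ^ n * Real.exp (-x * Real.cosh t)) :=
    Continuous.stronglyMeasurable (by simp only [Function.uncurry_def]; fun_prop)
  exact (h.integral_prod_right (ν := volume.restrict (Set.Ioi (0 : ℝ)))).measurable

/-- The integrand of the linearized field in the direction `cos(k ·)` at the height `0`. -/
noncomputable def modeIntegrand (lam k : ℝ) (q : ℝ × ℝ) : ℝ :=
  (Real.cos (k * q.1) - 1) * lam * cylKernel lam q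
    - (2 * lam * Real.cos (k * q.1)
      - 3 * lam ^ 3 * angularCoeff lam q.2 q.1 * (1 + Real.cos (k * q.1))) * regKernel lam q

theorem hasDerivAt_cos_mul (k s : ℝ) :
    HasDerivAt (fun s => Real.cos (k * s)) (-(k * Real.sin (k * s))) s := by
  refine (((hasDerivAt_id' s).const_mul k).cos).congr_deriv ?_
  ring

theorem linIntegrand_cos_zero (lam k : ℝ) (q : ℝ × ℝ) :
    linIntegrand lam (fun s => Real.cos (k * s)) 0 q = modeIntegrand lam k q := by
  simp only [linIntegrand, modeIntegrand, taylorGap, linRegDensity, relDistLin,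
    (hasDerivAt_cos_mul k _).deriv, mul_zero, Real.sin_zero, Real.cos_zero, zero_add]
  ring

/-- The part of the integrand that is even in `τ` is a multiple of the mode itself. -/
theorem linIntegrand_cos_add_neg (lam k s : ℝ) (q : ℝ × ℝ) :
    linIntegrand lam (fun s => Real.cos (k * s)) s q
      + linIntegrand lam (fun s => Real.cos (k * s)) s (-q.1, q.2)
      = 2 * (Real.cos (k * s) * modeIntegrand lam k q) := by
  simp only [linIntegrand, modeIntegrand, taylorGap, linRegDensity, relDistLin, cylKernel_neg,
    regKernel_neg, angularCoeff_neg, mul_add, mul_neg, Real.cos_add, Real.cos_neg, Real.sin_neg]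
  ring

theorem integrable_linIntegrand_cos {lam : ℝ} (hlam : 0 < lam) (k : ℕ) (s : ℝ) :
    Integrable (linIntegrand lam (fun s => Real.cos (k * s)) s) strip := by
  have ha : ((1 / 2 : ℝ≥0) : ℝ) = 1 / 2 := by norm_num
  exact integrable_linIntegrand hlam (by rw [ha]; norm_num) (by rw [ha]; norm_num)
    (cosMode 2 (1 / 2) (by rw [← NNReal.coe_le_coe, ha]; norm_num) k).holderC2 s

theorem integrable_modeIntegrand {lam : ℝ} (hlam : 0 < lam) (k : ℕ) :
    Integrable (modeIntegrand lam k) strip :=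
  (integrable_linIntegrand_cos hlam k 0).congr
    (Eventually.of_forall fun q => linIntegrand_cos_zero lam k q)

/-- The modes `cos(k ·)` are eigenfunctions of the linearized field. -/
theorem linField_cos {lam : ℝ} (hlam : 0 < lam) (k : ℕ) (s : ℝ) :
    linField lam (fun s => Real.cos (k * s)) s
      = Real.cos (k * s) * ∫ q, modeIntegrand lam k q ∂strip := by
  have hi := integrable_linIntegrand_cos hlam k s
  have e := integral_add hi (integrable_strip_comp_neg hi)
  simp only [linIntegrand_cos_add_neg] at e
  rw [integral_const_mul, integral_const_mul, integral_strip_comp_neg] at e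
  rw [linField]
  linarith

theorem sqrt_two_mul_sq_mul {lam : ℝ} (hlam : 0 < lam) (c : ℝ) :
    √(2 * lam ^ 2 * c) = lam * √(2 * c) := by
  rw [show 2 * lam ^ 2 * c = lam ^ 2 * (2 * c) by ring, Real.sqrt_mul (by positivity),
    Real.sqrt_sq hlam.le]

/-- The integral over `τ` of the integrand of a mode.  The terms of order `1 / (1 - cos θ)` cancel. -/
theorem mul_integral_modeIntegrand_fst {lam k θ : ℝ} (hlam : 0 < lam) (hk : 0 ≤ k)
    (hθ : 0 < 1 - Real.cos θ) :
    lam * ∫ τ, modeIntegrand lam k (τ, θ)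
      = lam ^ 2 * (k ^ 2 * ((1 - Real.cos θ) *
          coshExpIntegral 0 (lam * k * √(2 * (1 - Real.cos θ)))))
        - 2 * lam ^ 2 * (Real.cos θ *
          ∫ κ in (0 : ℝ)..k, κ * coshExpIntegral 0 (lam * κ * √(2 * (1 - Real.cos θ)))) := by
  set c := Real.cos θ with hc
  set m : ℝ := 2 * lam ^ 2 * (1 - c) with hm
  have hm0 : 0 < m := by positivity
  have hsq : ∀ κ : ℝ, κ * √m = lam * κ * √(2 * (1 - c)) := fun κ => by
    rw [hm, sqrt_two_mul_sq_mul hlam]; ring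
  have i3 := (integral_inv_dist_cube hm0).1
  have v3 := (integral_inv_dist_cube hm0).2
  have i3k := integrable_cos_mul_sq_add_rpow 0 hm0 k
  have i5 := integrable_cos_mul_sq_add_rpow 1 hm0 0
  have i5k := integrable_cos_mul_sq_add_rpow 1 hm0 k
  rw [show (-((0 : ℕ) + 3 / 2) : ℝ) = -(3 / 2) by norm_num] at i3k
  rw [show (-((1 : ℕ) + 3 / 2) : ℝ) = -(5 / 2) by norm_num] at i5 i5k
  have v3k := integral_cos_mul_inv_dist_cube hm0 k
  have v5 := integral_cos_mul_inv_dist_pow_five hm0 0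
  have v5k := integral_cos_mul_inv_dist_pow_five hm0 k
  simp only [zero_mul, Real.cos_zero, one_mul] at i5 v5
  have g0 := gaussLaplace_zero_eq (le_refl (0 : ℝ)) hm0
  have g0k := gaussLaplace_zero_eq hk hm0
  have g1 := mul_gaussLaplace_one (le_refl (0 : ℝ)) hm0
  have g1k := mul_gaussLaplace_one hk hm0
  rw [intervalIntegral.integral_same, sub_zero] at g0
  simp only [hsq] at g0k g1k
  rw [zero_pow two_ne_zero, zero_div, zero_mul, add_zero, g0] at g1
  have e : ∀ τ, modeIntegrand lam k (τ, θ)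
      = (lam - 2 * lam * (1 - c)) * (Real.cos (k * τ) * (τ ^ 2 + m) ^ (-(3 / 2) : ℝ))
        - lam * (τ ^ 2 + m) ^ (-(3 / 2) : ℝ)
        + 3 * lam ^ 3 * (1 - c) ^ 2 * ((τ ^ 2 + m) ^ (-(5 / 2) : ℝ)
          + Real.cos (k * τ) * (τ ^ 2 + m) ^ (-(5 / 2) : ℝ)) := fun τ => by
    have hD : 0 < τ ^ 2 + m := by positivity
    have h52 : (τ ^ 2 + m) ^ (-(5 / 2) : ℝ) = (τ ^ 2 + m) ^ (-(3 / 2) : ℝ) / (τ ^ 2 + m) := by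
      rw [show (-(5 / 2) : ℝ) = -(3 / 2) - 1 by norm_num, Real.rpow_sub_one hD.ne']
    have hq : cylDistSq lam (τ, θ) = τ ^ 2 + m := rfl
    rw [h52]
    simp only [modeIntegrand, regKernel, cylKernel, angularCoeff, hq, ← hc]
    ring
  simp only [e]
  have j1 := integral_add ((i3k.const_mul (lam - 2 * lam * (1 - c))).sub (i3.const_mul lam))
    ((i5.add i5k).const_mul (3 * lam ^ 3 * (1 - c) ^ 2))
  have j2 := integral_sub (i3k.const_mul (lam - 2 * lam * (1 - c))) (i3.const_mul lam)
  have j3 := integral_add i5 i5k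
  simp only [Pi.sub_apply, Pi.add_apply] at j1
  rw [j1, j2, integral_const_mul, integral_const_mul, integral_const_mul, j3, v3, v3k, v5, v5k]
  set S := ∫ κ in (0 : ℝ)..k, κ * coshExpIntegral 0 (lam * κ * √(2 * (1 - c)))
  set K := coshExpIntegral 0 (lam * k * √(2 * (1 - c)))
  rw [g0k] at g1k ⊢
  have h1 : gaussLaplace 1 0 m = 1 / m / m := by rw [eq_div_iff hm0.ne', mul_comm]; exact g1
  have h2 : gaussLaplace 1 k m = (1 / m - S + k ^ 2 / 2 * K) / m := by
    rw [eq_div_iff hm0.ne', mul_comm]; exact g1k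
  have hc0 : (1 - c) = m / (2 * lam ^ 2) := by rw [hm]; field_simp
  have hc1 : c = 1 - m / (2 * lam ^ 2) := by linarith
  rw [h1, h2, hc0, hc1]
  field_simp
  ring

theorem exists_coshExpIntegral_chord_le :
    ∃ C, 0 ≤ C ∧ ∀ x θ : ℝ, 0 < x → θ ∈ Set.Ioc (-π) π → θ ≠ 0 →
      coshExpIntegral 0 (x * √(2 * (1 - Real.cos θ)))
        ≤ C * x ^ (-(1 / 4) : ℝ) * |θ| ^ (-(1 / 2) : ℝ) := by
  obtain ⟨C, hC, h⟩ := exists_coshExpIntegral_zero_one_sub_cos_le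
  refine ⟨C, hC, fun x θ hx hθ h0 => h x θ _ hx hθ h0 ?_⟩
  refine mul_le_mul_of_nonneg_left (Real.le_sqrt_of_sq_le ?_) hx.le
  have := one_sub_cos_pos hθ h0
  have := Real.neg_one_le_cos θ
  nlinarith

theorem integrable_coshExpIntegral_chord {x : ℝ} (hx : 0 < x) :
    Integrable (fun θ => coshExpIntegral 0 (x * √(2 * (1 - Real.cos θ))))
      (volume.restrict (Set.Ioc (-π) π)) := by
  obtain ⟨C, hC, h⟩ := exists_coshExpIntegral_chord_le
  refine (integrableOn_abs_rpow_neg_half.const_mul (C * x ^ (-(1 / 4) : ℝ))).mono'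
    ((measurable_coshExpIntegral 0).comp (by fun_prop)).aestronglyMeasurable ?_
  rw [ae_restrict_iff' measurableSet_Ioc]
  have hne : ∀ᵐ θ : ℝ, θ ≠ 0 := by simp [ae_iff, measure_singleton]
  filter_upwards [hne] with θ h0 hθ
  rw [Real.norm_of_nonneg (coshExpIntegral_nonneg _ _)]
  exact h x θ hx hθ h0

theorem integrable_cos_mul_coshExpIntegral_chord_prod {lam k : ℝ} (hlam : 0 < lam) (hk : 0 < k) :
    Integrable (Function.uncurry fun θ κ : ℝ => Real.cos θ *
        (κ * coshExpIntegral 0 (lam * κ * √(2 * (1 - Real.cos θ)))))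
      ((volume.restrict (Set.Ioc (-π) π)).prod (volume.restrict (Set.Ioc 0 k))) := by
  obtain ⟨C, hC, h⟩ := exists_coshExpIntegral_chord_le
  have hκ : Integrable (fun κ : ℝ => C * lam ^ (-(1 / 4) : ℝ) * κ ^ (3 / 4 : ℝ))
      (volume.restrict (Set.Ioc 0 k)) :=
    (((intervalIntegrable_iff_integrableOn_Ioc_of_le hk.le).1
      (intervalIntegral.intervalIntegrable_rpow' (r := 3 / 4) (by norm_num)))).const_mul _
  refine ((integrableOn_abs_rpow_neg_half).mul_prod hκ).mono' ?_ ?_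
  · refine Measurable.aestronglyMeasurable ?_
    have := measurable_coshExpIntegral 0
    simp only [Function.uncurry_def]
    fun_prop
  · rw [Measure.prod_restrict, ae_restrict_iff' (measurableSet_Ioc.prod measurableSet_Ioc)]
    have hne : ∀ᵐ q : ℝ × ℝ, q.1 ≠ 0 :=
      Measure.quasiMeasurePreserving_fst.ae (p := fun x : ℝ => x ≠ 0)
        (by simp [ae_iff, measure_singleton])
    filter_upwards [hne] with q h0 hq
    have hκ0 : 0 < q.2 := hq.2.1
    have hb := h (lam * q.2) q.1 (mul_pos hlam hκ0) hq.1 h0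
    have hn := coshExpIntegral_nonneg 0 (lam * q.2 * √(2 * (1 - Real.cos q.1)))
    rw [Function.uncurry_def, norm_mul, norm_mul, Real.norm_of_nonneg hn,
      Real.norm_of_nonneg hκ0.le, Real.norm_eq_abs]
    have e : q.2 ^ (3 / 4 : ℝ) = q.2 * q.2 ^ (-(1 / 4) : ℝ) := by
      rw [mul_comm, ← Real.rpow_add_one hκ0.ne']; norm_num
    calc _ ≤ 1 * (q.2 * (C * (lam * q.2) ^ (-(1 / 4) : ℝ) * |q.1| ^ (-(1 / 2) : ℝ))) := by
          gcongr; exact Real.abs_cos_le_one _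
      _ = _ := by rw [Real.mul_rpow hlam.le hκ0.le, e]; ring

/-- The integral over `θ` is carried out first; then `x = lam κ` is substituted. -/
theorem integral_cos_mul_integral_coshExpIntegral_chord {lam k : ℝ} (hlam : 0 < lam) (hk : 0 < k) :
    lam ^ 2 * ∫ θ in Set.Ioc (-π) π, Real.cos θ *
        ∫ κ in (0 : ℝ)..k, κ * coshExpIntegral 0 (lam * κ * √(2 * (1 - Real.cos θ)))
      = ∫ x in (0 : ℝ)..lam * k, x * (cosExpIntegral 1 x * coshExpIntegral 1 x) := by
  have hle : -π ≤ π := by linarith [Real.pi_pos]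
  have hswap := integral_integral_swap (integrable_cos_mul_coshExpIntegral_chord_prod hlam hk)
  simp only [integral_const_mul] at hswap
  simp only [intervalIntegral.integral_of_le hk.le]
  rw [hswap]
  have e : ∫ κ in Set.Ioc 0 k, ∫ θ in Set.Ioc (-π) π, Real.cos θ *
        (κ * coshExpIntegral 0 (lam * κ * √(2 * (1 - Real.cos θ))))
      = ∫ κ in Set.Ioc 0 k, lam⁻¹ * ((lam * κ) *
          (cosExpIntegral 1 (lam * κ) * coshExpIntegral 1 (lam * κ))) := by
    refine setIntegral_congr_fun measurableSet_Ioc fun κ hκ => ?_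
    rw [← integral_cos_mul_coshExpIntegral_chord (mul_pos hlam hκ.1),
      intervalIntegral.integral_of_le hle, ← integral_const_mul, ← integral_const_mul]
    refine integral_congr_ae (Eventually.of_forall fun θ => ?_)
    simp only
    field_simp
  rw [e, ← intervalIntegral.integral_of_le hk.le, intervalIntegral.integral_const_mul,
    intervalIntegral.integral_comp_mul_left
      (fun x => x * (cosExpIntegral 1 x * coshExpIntegral 1 x)) hlam.ne', mul_zero, smul_eq_mul]
  field_simp

/-- The eigenvalue of the linearized field at `cos(k ·)`, in terms of Bessel functions. -/
theorem mul_integral_modeIntegrand {lam : ℝ} (hlam : 0 < lam) (k : ℕ) :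
    lam * ∫ q, modeIntegrand lam k q ∂strip = -eigenvalueV (lam * k) := by
  have hle : -π ≤ π := by linarith [Real.pi_pos]
  have hk0 : (0 : ℝ) ≤ k := k.cast_nonneg
  have hi := integrable_modeIntegrand hlam k
  rw [strip_eq_prod] at hi ⊢
  rw [integral_prod_symm _ hi, ← integral_const_mul]
  have hae : ∀ᵐ θ ∂((volume : Measure ℝ).restrict (Set.Ioc (-π) π)),
      lam * ∫ τ, modeIntegrand lam k (τ, θ)
        = lam ^ 2 * ((k : ℝ) ^ 2 * ((1 - Real.cos θ) *
            coshExpIntegral 0 (lam * k * √(2 * (1 - Real.cos θ)))))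
          - 2 * lam ^ 2 * (Real.cos θ *
            ∫ κ in (0 : ℝ)..k, κ * coshExpIntegral 0 (lam * κ * √(2 * (1 - Real.cos θ)))) := by
    filter_upwards [ae_one_sub_cos_pos] with θ hθ
    exact mul_integral_modeIntegrand_fst hlam hk0 hθ
  rw [integral_congr_ae hae]
  -- for `k = 0` both sides vanish
  rcases hk0.eq_or_lt with h | hk
  · simp [← h, eigenvalueV]
  have hρ : 0 < lam * k := mul_pos hlam hk
  have hK := integrable_coshExpIntegral_chord hρ
  have hcK : Integrable (fun θ => Real.cos θ *
      coshExpIntegral 0 (lam * k * √(2 * (1 - Real.cos θ)))) (volume.restrict (Set.Ioc (-π) π)) :=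
    hK.bdd_mul (c := 1) Real.continuous_cos.aestronglyMeasurable
      (Eventually.of_forall fun θ => Real.abs_cos_le_one θ)
  have hS : Integrable (fun θ => Real.cos θ * ∫ κ in (0 : ℝ)..k,
      κ * coshExpIntegral 0 (lam * κ * √(2 * (1 - Real.cos θ))))
      (volume.restrict (Set.Ioc (-π) π)) := by
    have := (integrable_cos_mul_coshExpIntegral_chord_prod hlam hk).integral_prod_left
    simpa only [Function.uncurry_apply_pair, integral_const_mul,
      intervalIntegral.integral_of_le hk.le] using this
  simp only [sub_mul (1 : ℝ), one_mul]
  have e := integral_sub (((hK.sub hcK).const_mul ((k : ℝ) ^ 2)).const_mul (lam ^ 2))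
    (hS.const_mul (2 * lam ^ 2))
  simp only [Pi.sub_apply] at e
  rw [e, integral_const_mul, integral_const_mul, integral_const_mul, integral_sub hK hcK, mul_assoc 2,
    integral_cos_mul_integral_coshExpIntegral_chord hlam hk,
    integral_mul_cosExpIntegral_mul_coshExpIntegral hρ, ← intervalIntegral.integral_of_le hle,
    ← intervalIntegral.integral_of_le hle, integral_coshExpIntegral_chord hρ,
    integral_cos_mul_coshExpIntegral_chord hρ, eigenvalueV, besselI_one_eq hρ, besselK_zero_eq,
    besselK_one_eq]
  field_simp
  ring

/-! ### Cosine coefficients of the linearized field -/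

section
variable {u v : ℝ → ℝ}

theorem integral_eq_zero_of_odd (hu : ∀ s, u (-s) = -u s) : ∫ s in (-π)..π, u s = 0 := by
  have h := intervalIntegral.integral_comp_neg (a := -π) (b := π) u
  simp only [hu, intervalIntegral.integral_neg, neg_neg] at h
  linarith

/-- By periodicity the translation can be moved to the cosine; the sine that appears then integrates to
`0` by evenness. -/
theorem integral_comp_add_mul_cos (hv : Continuous v) (hve : Function.Even v)
    (hvp : Function.Periodic v (2 * π)) (k : ℕ) (τ : ℝ) :
    ∫ s in (-π)..π, v (s + τ) * Real.cos (k * s)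
      = Real.cos (k * τ) * ∫ s in (-π)..π, v s * Real.cos (k * s) := by
  have hp : Function.Periodic (fun s => v s * Real.cos (k * (s - τ))) (2 * π) := fun s => by
    have h : (k : ℝ) * (s + 2 * π - τ) = k * (s - τ) + k * (2 * π) := by ring
    simp only [hvp s, h, Real.cos_add_nat_mul_two_pi]
  have h1 := hp.intervalIntegral_add_eq (-π) (-π + τ)
  have h2 := intervalIntegral.integral_comp_add_right (a := -π) (b := π)
    (fun s => v s * Real.cos (k * (s - τ))) τ
  simp only [add_sub_cancel_right] at h2
  rw [show -π + τ + 2 * π = π + τ by ring, show -π + 2 * π = π by ring] at h1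
  rw [h2, ← h1]
  have hodd : ∫ s in (-π)..π, v s * Real.sin (k * s) = 0 :=
    integral_eq_zero_of_odd fun s => by rw [hve, mul_neg, Real.sin_neg, mul_neg]
  have e : ∀ s, v s * Real.cos (k * (s - τ)) = Real.cos (k * τ) * (v s * Real.cos (k * s))
      + Real.sin (k * τ) * (v s * Real.sin (k * s)) := fun s => by
    rw [mul_sub, Real.cos_sub]; ring
  simp only [e]
  rw [intervalIntegral.integral_add (Continuous.intervalIntegrable (by fun_prop) _ _)
    (Continuous.intervalIntegrable (by fun_prop) _ _), intervalIntegral.integral_const_mul,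
    intervalIntegral.integral_const_mul, hodd, mul_zero, add_zero]

/-- The integral over the height `s` for fixed `(τ, θ)`.  The term with `v'` in the Taylor remainder
drops out since `v'` is odd. -/
theorem integral_linIntegrand_mul_cos (hv : Continuous v) (hv1 : Continuous (deriv v))
    (hve : Function.Even v) (hvp : Function.Periodic v (2 * π)) (lam : ℝ) (k : ℕ) (q : ℝ × ℝ) :
    ∫ s in (-π)..π, linIntegrand lam v s q * Real.cos (k * s)
      = modeIntegrand lam k q * ∫ s in (-π)..π, v s * Real.cos (k * s) := by
  have h1 := integral_comp_add_mul_cos hv hve hvp k q.1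
  have h2 : ∫ s in (-π)..π, deriv v s * Real.cos (k * s) = 0 :=
    integral_eq_zero_of_odd fun s => by rw [hve.deriv_neg, mul_neg, Real.cos_neg, neg_mul]
  set A := lam * cylKernel lam q with hA
  set B := 3 * lam ^ 3 * angularCoeff lam q.2 q.1 * regKernel lam q with hB
  have e : ∀ s, linIntegrand lam v s q * Real.cos (k * s)
      = (A - 2 * lam * regKernel lam q + B) * (v (s + q.1) * Real.cos (k * s))
        + (B - A) * (v s * Real.cos (k * s))
        + (-(A * q.1)) * (deriv v s * Real.cos (k * s)) := fun s => by
    rw [linIntegrand, taylorGap, linRegDensity, relDistLin]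
    ring
  simp only [e]
  rw [intervalIntegral.integral_add (Continuous.intervalIntegrable (by fun_prop) _ _)
      (Continuous.intervalIntegrable (by fun_prop) _ _),
    intervalIntegral.integral_add (Continuous.intervalIntegrable (by fun_prop) _ _)
      (Continuous.intervalIntegrable (by fun_prop) _ _), intervalIntegral.integral_const_mul,
    intervalIntegral.integral_const_mul, intervalIntegral.integral_const_mul, h1, h2, modeIntegrand]
  ring

/-- Fubini's theorem carries the previous identity over to the field. -/
theorem integral_linField_mul_cos {a N lam : ℝ} (hlam : 0 < lam) (ha0 : 0 < a) (ha1 : a < 1)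
    (hv : HolderC2 a N v) (hve : Function.Even v) (hvp : Function.Periodic v (2 * π)) (k : ℕ) :
    ∫ s in (-π)..π, linField lam v s * Real.cos (k * s)
      = (∫ q, modeIntegrand lam k q ∂strip) * ∫ s in (-π)..π, v s * Real.cos (k * s) := by
  have hle : -π ≤ π := by linarith [Real.pi_pos]
  have hN := hv.nonneg
  have hc : Continuous v := hv.diff.continuous
  have hc1 : Continuous (deriv v) := hv.holderC1_deriv.diff.continuous
  have hm : Measurable (Function.uncurry fun (s : ℝ) (q : ℝ × ℝ) =>
      linIntegrand lam v s q * Real.cos (k * s)) := by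
    have h1 : Measurable fun p : ℝ × ℝ × ℝ => angularCoeff lam p.2.2 p.2.1 :=
      (measurable_angularCoeff lam).comp measurable_snd
    have h2 := measurable_cylKernel lam
    have h3 := measurable_regKernel lam
    have h4 := hc.measurable
    have h5 := hc1.measurable
    simp only [Function.uncurry_def, linIntegrand, taylorGap, linRegDensity, relDistLin]
    fun_prop
  have hint : Integrable (Function.uncurry fun (s : ℝ) (q : ℝ × ℝ) =>
      linIntegrand lam v s q * Real.cos (k * s))
      ((volume.restrict (Set.Ioc (-π) π)).prod strip) := by
    have hb : Integrable (fun q : ℝ × ℝ => 2 * N * lam * (gapOrder a q.1 * cylKernel lam q)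
        + 17 * lam * N * regKernel lam q) strip :=
      ((integrable_gapOrder_mul_cylKernel hlam ha0 ha1).const_mul _).add
        ((integrable_regKernel hlam).1.const_mul _)
    refine ((integrable_const (1 : ℝ)).mul_prod hb).mono' hm.aestronglyMeasurable
      (Eventually.of_forall fun ⟨s, q⟩ => ?_)
    have h1 := hv.abs_taylorGap_le_gapOrder ha0 ha1.le q.1 s
    have h2 := (hv.holderC1_linRegDensity hlam ha0 ha1.le q.2 q.1).bound s
    have h3 := cylKernel_nonneg lam q
    have h4 := regKernel_nonneg lam q
    have h5 := gapOrder_nonneg a q.1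
    simp only [Function.uncurry_apply_pair, one_mul]
    rw [norm_mul, Real.norm_eq_abs, Real.norm_eq_abs]
    refine (mul_le_of_le_one_right (abs_nonneg _) (Real.abs_cos_le_one _)).trans ?_
    rw [linIntegrand]
    refine (abs_sub _ _).trans ?_
    rw [abs_mul, abs_mul, abs_mul, abs_of_nonneg h3, abs_of_nonneg h4, abs_of_pos hlam]
    calc _ ≤ 2 * N * gapOrder a q.1 * lam * cylKernel lam q
          + 17 * lam * N * regKernel lam q := by gcongr
      _ = _ := by ring
  have hswap := integral_integral_swap hint
  simp only [integral_mul_const] at hswap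
  rw [intervalIntegral.integral_of_le hle]
  refine hswap.trans ?_
  rw [← integral_mul_const]
  refine integral_congr_ae (Eventually.of_forall fun q => ?_)
  simp only
  rw [← intervalIntegral.integral_of_le hle, integral_linIntegrand_mul_cos hc hc1 hve hvp]

end

theorem mainTheorem4 (α : ℝ≥0) (hα0 : 0 < α) (hα1 : α < 1) (lam : ℝ) (hlam : 0 < lam) :
    -- near the constant `lam`, `H(φ)` is given by absolutely convergent integrals and is in `C^{1,α}`
    (∀ᶠ φ : HolderPE 2 α in 𝓝 (constMode 2 α lam),
      (∀ s, 0 < φ s) ∧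
      (∀ s, Integrable (fieldIntegrand φ (s, 0)) (surfaceMeasure φ)) ∧
      fieldFun φ ∈ evenPeriodicHolder 1 α) ∧
    DifferentiableAt ℝ (fieldOperator α) (constMode 2 α lam) ∧
    -- `L e_k = V(lam k) e_k`
    (∀ k : ℕ, linearization α lam (cosMode 2 α hα1.le k)
      = eigenvalueV (lam * k) • cosMode 1 α hα1.le k) ∧
    -- `L` acts diagonally on the cosine coefficients of every function
    (∀ (v : HolderPE 2 α) (k : ℕ),
      ∫ s in (-π)..π, linearization α lam v s * Real.cos (k * s)
        = eigenvalueV (lam * k) * ∫ s in (-π)..π, v s * Real.cos (k * s)) := by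
  obtain ⟨hev, hdiff, hlin⟩ := fieldOperator_differentiableAt hlam hα0 hα1
  refine ⟨hev, hdiff, fun k => HolderPE.ext fun s => ?_, fun v k => ?_⟩
  · rw [hlin, HolderPE.coe_smul]
    change -lam * linField lam (fun s => Real.cos (k * s)) s
      = eigenvalueV (lam * k) * Real.cos (k * s)
    rw [linField_cos hlam]
    linear_combination -Real.cos (k * s) * mul_integral_modeIntegrand hlam k
  · have h := integral_linField_mul_cos hlam (NNReal.coe_pos.2 hα0) (NNReal.coe_lt_one.2 hα1)
      v.holderC2 v.spec.2.2.1 v.spec.2.2.2 k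
    simp only [hlin, mul_assoc, intervalIntegral.integral_const_mul]
    rw [h]
    linear_combination -(∫ s in (-π)..π, v s * Real.cos (k * s)) *
      mul_integral_modeIntegrand hlam k
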